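/- Fix an integer $k\ge 1$, constants $\beta,\gamma,\epsilon\in(0,1)$ and a function $g(n)=o(n^2)$. There is a function $f(n)=o(1/n)$, depending only on $k,\beta,\gamma,\epsilon,g$, such that the following holds for every $n$. Let $G=(V,E)$ be a graph on $V=[n]$, let $M\subseteq E$, let $E'\subseteq\binom{[n]}{2}\setminus E$, and let $m$ be an integer with $|m-\frac{n}{\log\log n}|\le 1$ (so that $m$ is $\frac{n}{\log\log n}$ up to rounding). Suppose that (i) $G$ has minimum degree at least $4$; (ii) $M$ is a 2-matching (every vertex of $V$ is incident to at most two edges of $M$) with $|M|\ge n-\frac{n}{(\log\log n)^{6-\epsilon}}$; (iii) $G$ does not contain $r$ pairwise vertex-disjoint cycles for any integer $r\ge \frac{n}{(\log\log n)^6}$; (iv) $|E'|\le g(n)$; (v) $E_R$ is a random set distributed uniformly over the $m$-element subsets of $\binom{[n]}{2}\setminus(E\cup E')$; (vi) every $S\subseteq V$ with $|S|<\gamma n$ spans fewer than $1.1|S|+1$ edges of $G$; (vii) every $S\subseteq V$ with $|S|<\beta\gamma n$ is incident to fewer than $2(1-\beta)\gamma n$ edges of $G$ (that is, fewer than this many edges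 of $G$ have an endpoint in $S$). Then, with probability at least $1-f(n)$, the graph $G\cup E_R$ has a Hamilton cycle $H$ with $$|E(H)\cap M|\ \ge\ n-\frac{n}{(\log\log n)^{6-\epsilon-\frac{1}{10k}}}.$$ -/

import Mathlib

open MeasureTheory Filter Asymptotics
open scoped Classical

noncomputable section

/-- The iterated logarithm `log log n`, as a real number. -/
def loglog (n : ℕ) : ℝ := Real.log (Real.log (n : ℝ))

/-- `M` is a 2-matching of `G`: a set of edges of `G` such that every vertex is incident to at
most two edges of `M`. -/
def IsTwoMatching {V : Type*} (G : SimpleGraph V) (M : Finset (Sym2 V)) : Prop :=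
  (∀ e ∈ M, e ∈ G.edgeSet) ∧ ∀ v : V, (M.filter (fun e => v ∈ e)).card ≤ 2

/-- `G` contains `r` pairwise vertex-disjoint cycles. -/
def HasDisjointCycles {V : Type*} (G : SimpleGraph V) (r : ℕ) : Prop :=
  ∃ (a : Fin r → V) (c : ∀ i, G.Walk (a i) (a i)),
    (∀ i, (c i).IsCycle) ∧ ∀ i j, i ≠ j → (c i).support.Disjoint (c j).support

/-- The number of edges of `G` with both endpoints in `S`. -/
def spannedEdges {V : Type*} [Fintype V] (G : SimpleGraph V) (S : Finset V) : ℕ :=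
  (G.edgeFinset.filter (fun e => ∀ v ∈ e, v ∈ S)).card

/-- The number of edges of `G` with at least one endpoint in `S`. -/
def incidentEdges {V : Type*} [Fintype V] (G : SimpleGraph V) (S : Finset V) : ℕ :=
  (G.edgeFinset.filter (fun e => ∃ v ∈ e, v ∈ S)).card

/-- The random set `R` is uniformly distributed over the `m`-element subsets of `A`. -/
def IsUniformSubset {Ω : Type*} [MeasurableSpace Ω] (P : Measure Ω) {α : Type*}
    (R : Ω → Finset α) (A : Finset α) (m : ℕ) : Prop :=
  (∀ B : Finset α, MeasurableSet (R ⁻¹' {B})) ∧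
  ∀ B : Finset α, P.real (R ⁻¹' {B}) =
    if B ∈ A.powersetCard m then (1 : ℝ) / ((A.powersetCard m).card : ℝ) else 0

/-- `G` has a Hamilton cycle that contains at least `x` edges of `M`. -/
def HasHamiltonCycleMeeting {V : Type*} [Fintype V] (G : SimpleGraph V)
    (M : Finset (Sym2 V)) (x : ℝ) : Prop :=
  ∃ (a : V) (p : G.Walk a a), p.IsHamiltonianCycle ∧
    x ≤ ((p.edges.toFinset ∩ M).card : ℝ)

/-- The deterministic hypotheses on the graph `G`, its 2-matching `M` and the parameters. -/
structure Admissible (β γ ε : ℝ) {n : ℕ} (G : SimpleGraph (Fin n))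
    (M : Finset (Sym2 (Fin n))) : Prop where
  minDegree : ∀ v, 4 ≤ G.degree v
  twoMatching : IsTwoMatching G M
  card_twoMatching : (n : ℝ) - n / loglog n ^ (6 - ε) ≤ (M.card : ℝ)
  few_disjoint_cycles :
    ∀ r : ℕ, (n : ℝ) / loglog n ^ 6 ≤ (r : ℝ) → ¬ HasDisjointCycles G r
  sparse : ∀ S : Finset (Fin n), (S.card : ℝ) < γ * n →
    (spannedEdges G S : ℝ) < 1.1 * S.card + 1
  few_incident : ∀ S : Finset (Fin n), (S.card : ℝ) < β * γ * n →
    (incidentEdges G S : ℝ) < 2 * (1 - β) * γ * n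

end

/-! The proof is Pósa's rotation method run on a budget. An ordering of the vertices is treated as a
Hamilton path of the complete graph whose consecutive pairs are edges of `G`, random pairs already
in use (the set `U`), or gaps. Joining the chains of the 2-matching gives an ordering with at most
`n - |M| + r` pairs outside `M`, where `G` has `r` disjoint cycles; by (ii) and (iii) this is at
most `T₀`, about `2n / (loglog n)^(6-ε)` (`exists_ordering_loss_le`).

Suppose that the number `t` of gaps cannot be lowered within the budget. Then no rotation along an
edge of `G` removes a gap. Exchanging blocks between gaps yields `max 1 t` starting heads at no cost
(`exists_isRootFamily`). From there the set of heads grows by one per cent per round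
(`exists_heads_large`): otherwise the heads and their path neighbours would span more edges than
sparsity allows, since the minimum degree is 4 and the permitted density is about 1.1
(`five_mul_card_le`). About `log (n / t) / log 1.01` rounds make it linear in `n`. Growing at both
ends gives quadratically many pairs that close the path to a cyclic ordering (`exists_many_ends`);
cutting this at a gap lowers `t`, and without gaps it is a Hamilton cycle.

Pairs of `U` take up path degree without being edges of `G`. Their ends are therefore kept far apart
and outside a small core that contains all vertices of large degree (`IsSeparated.spread`). While
the sets of heads are tiny no pair of `U` may be removed at all; this is achieved by starting from
an ordering of least cost.

Every set of random pairs that does not yet suffice is improved by a fixed proportion `c` of the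
further pairs. The mean of `2 ^ t` over the failures thus shrinks by `1 - c / 2` per pair, and
failure has probability at most `(1 - c / 2) ^ m * 2 ^ T₀` (`card_not_le`), which is tiny as `T₀` is
much smaller than `m`. The total loss is of order `T₀` plus the sum of `log (n / t)` over `t ≤ T₀`,
hence of order `T₀ * log (loglog n)`, which the extra factor `(loglog n)^(1/(10k))` absorbs
(`sum_rounds_maxGaps_le`). -/

/-! ### Consecutive pairs of a list. -/

/-- The list of consecutive pairs of a list. -/
def consec {V : Type*} : List V → List (Sym2 V)
  | a :: b :: l => s(a, b) :: consec (b :: l)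
  | _ => []

section Consec
variable {V : Type*}

@[simp] theorem consec_nil : consec ([] : List V) = [] := rfl

@[simp] theorem consec_singleton (a : V) : consec [a] = [] := rfl

@[simp] theorem consec_cons_cons (a b : V) (l : List V) :
    consec (a :: b :: l) = s(a, b) :: consec (b :: l) := rfl

theorem consec_append_cons (P : List V) (x : V) (Q : List V) :
    consec (P ++ x :: Q) = consec (P ++ [x]) ++ consec (x :: Q) := by
  induction P with
  | nil => simp
  | cons a P ih =>
    cases P with
    | nil => simp
    | cons b P => simpa using ih

theorem consec_append_pair (P : List V) (x y : V) (Q : List V) :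
    consec (P ++ [x] ++ y :: Q) = consec (P ++ [x]) ++ s(x, y) :: consec (y :: Q) := by
  rw [List.append_assoc, List.singleton_append, consec_append_cons]; simp

theorem consec_reverse (L : List V) : consec L.reverse = (consec L).reverse := by
  induction L with
  | nil => simp
  | cons a L ih =>
    cases L with
    | nil => simp
    | cons b L =>
      rw [consec_cons_cons, List.reverse_cons, List.reverse_cons, List.reverse_cons, ← ih,
        List.reverse_cons, consec_append_pair]
      simp [Sym2.eq_swap]

theorem length_consec (L : List V) : (consec L).length = L.length - 1 := by
  induction L with
  | nil => simp
  | cons a L ih => cases L <;> simp_all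

theorem mem_of_mem_consec {L : List V} {e : Sym2 V} (he : e ∈ consec L) {v : V} (hv : v ∈ e) :
    v ∈ L := by
  induction L with
  | nil => simp at he
  | cons a L ih =>
    cases L with
    | nil => simp at he
    | cons b L =>
      rw [consec_cons_cons, List.mem_cons] at he
      rcases he with rfl | he
      · rcases Sym2.mem_iff.1 hv with rfl | rfl <;> simp
      · exact List.mem_cons_of_mem _ (ih he)

theorem nodup_consec {L : List V} (hL : L.Nodup) : (consec L).Nodup := by
  induction L with
  | nil => simp
  | cons a L ih =>
    cases L with
    | nil => simp
    | cons b L =>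
      rw [consec_cons_cons, List.nodup_cons]
      rw [List.nodup_cons] at hL
      exact ⟨fun h => hL.1 (mem_of_mem_consec h (Sym2.mem_mk_left _ _)), ih hL.2⟩

/-- Every pair of consecutive elements splits the list. -/
theorem exists_split_of_mem_consec {L : List V} {e : Sym2 V} (he : e ∈ consec L) :
    ∃ P x y Q, L = P ++ [x] ++ y :: Q ∧ e = s(x, y) := by
  induction L with
  | nil => simp at he
  | cons a L ih =>
    cases L with
    | nil => simp at he
    | cons b L =>
      rw [consec_cons_cons, List.mem_cons] at he
      rcases he with rfl | he
      · exact ⟨[], a, b, L, by simp, rfl⟩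
      · obtain ⟨P, x, y, Q, h, rfl⟩ := ih he
        exact ⟨a :: P, x, y, Q, by simp [h], rfl⟩

variable [Fintype V]

theorem card_consec_head_le {a : V} {l : List V} (hL : (a :: l).Nodup) :
    (Finset.univ.filter fun y => s(a, y) ∈ consec (a :: l)).card ≤ 1 := by
  cases l with
  | nil => simp
  | cons b l =>
    rw [Finset.card_le_one]
    have key : ∀ y, s(a, y) ∈ consec (a :: b :: l) → y = b := by
      intro y hy
      rw [consec_cons_cons, List.mem_cons] at hy
      rcases hy with hy | hy
      · rw [Sym2.eq_iff] at hy
        rcases hy with ⟨_, h⟩ | ⟨h, h'⟩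
        · exact h
        · rw [h', h]
      · exact absurd (mem_of_mem_consec hy (Sym2.mem_mk_left _ _)) (List.nodup_cons.1 hL).1
    intro x hx y hy
    rw [key x (Finset.mem_filter.1 hx).2, key y (Finset.mem_filter.1 hy).2]

theorem card_consec_le {L : List V} (hL : L.Nodup) (w : V) :
    (Finset.univ.filter fun y => s(w, y) ∈ consec L).card ≤ 2 := by
  induction L with
  | nil => simp
  | cons a L ih =>
    by_cases hwa : w = a
    · subst hwa
      exact (card_consec_head_le hL).trans one_le_two
    cases L with
    | nil => simp
    | cons b L =>
      by_cases hwb : w = b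
      · subst hwb
        have h1 := card_consec_head_le (List.nodup_cons.1 hL).2
        have : (Finset.univ.filter fun y => s(w, y) ∈ consec (a :: w :: L)) ⊆
            insert a (Finset.univ.filter fun y => s(w, y) ∈ consec (w :: L)) := by
          intro y hy
          simp only [consec_cons_cons, List.mem_cons, Finset.mem_filter, Finset.mem_univ, true_and,
            Finset.mem_insert] at hy ⊢
          rcases hy with hy | hy
          · rw [Sym2.eq_iff] at hy
            rcases hy with ⟨h, _⟩ | ⟨_, h⟩
            · exact absurd h hwa
            · exact Or.inl h
          · exact Or.inr hy
        have h2 := Finset.card_le_card this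
        have h3 := Finset.card_insert_le a (Finset.univ.filter fun y => s(w, y) ∈ consec (w :: L))
        omega
      · refine le_trans (Finset.card_le_card ?_) (ih (List.nodup_cons.1 hL).2)
        intro y hy
        simp only [consec_cons_cons, List.mem_cons, Finset.mem_filter, Finset.mem_univ,
          true_and] at hy ⊢
        rcases hy with hy | hy
        · rw [Sym2.eq_iff] at hy
          rcases hy with ⟨h, _⟩ | ⟨h, _⟩
          · exact absurd h hwa
          · exact absurd h hwb
        · exact hy

end Consec

/-! ### Orderings and Pósa rotations. -/

/-- `L` lists every element of `V` exactly once. -/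
def IsOrdering {V : Type*} (L : List V) : Prop := L.Nodup ∧ ∀ v, v ∈ L

theorem IsOrdering.of_perm {V : Type*} {L L' : List V} (h : IsOrdering L) (hp : L.Perm L') :
    IsOrdering L' := ⟨hp.nodup_iff.1 h.1, fun v => hp.mem_iff.1 (h.2 v)⟩

theorem IsOrdering.length_eq {V : Type*} [Fintype V] {L : List V} (h : IsOrdering L) :
    L.length = Fintype.card V := by
  rw [← List.toFinset_card_of_nodup h.1, ← Finset.card_univ]
  congr 1
  ext v; simp [h.2 v]

/-- The Pósa rotation at `w` of a list with head `v`: the part before `w` is reversed; its last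
element `x` becomes the new head. -/
def IsRot {V : Type*} (v x w : V) (L L' : List V) : Prop :=
  ∃ P Q, L = P ++ w :: Q ∧ P.head? = some v ∧ P.getLast? = some x ∧ L' = P.reverse ++ w :: Q

section Rot
variable {V : Type*} {v x w : V} {L L' : List V}

theorem exists_isRot (hv : L.head? = some v) (hw : w ∈ L) (hwv : w ≠ v) :
    ∃ x L', IsRot v x w L L' := by
  obtain ⟨P, Q, rfl⟩ := List.append_of_mem hw
  cases P with
  | nil => simp at hv; exact absurd hv hwv
  | cons a P =>
    simp at hv
    exact ⟨(a :: P).getLast (by simp), _, a :: P, Q, rfl, by simp [hv],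
      List.getLast?_eq_getLast_of_ne_nil (by simp), rfl⟩

theorem IsRot.perm (h : IsRot v x w L L') : L.Perm L' := by
  obtain ⟨P, Q, rfl, _, _, rfl⟩ := h
  exact (List.reverse_perm P).symm.append_right _

theorem IsRot.head (h : IsRot v x w L L') : L'.head? = some x := by
  obtain ⟨P, Q, rfl, _, hx, rfl⟩ := h
  rw [List.head?_append, List.head?_reverse, hx]; rfl

theorem IsRot.last (h : IsRot v x w L L') : L'.getLast? = L.getLast? := by
  obtain ⟨P, Q, rfl, _, hx, rfl⟩ := h
  simp [List.getLast?_append, List.getLast?_cons]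

/-- The exchange behind all later estimates: reversing the initial segment keeps its pairs, so `s(x,
w)` is merely traded for `s(v, w)`. -/
theorem IsRot.consec_perm (h : IsRot v x w L L') :
    ∃ R, (consec L).Perm (s(x, w) :: R) ∧ (consec L').Perm (s(v, w) :: R) := by
  obtain ⟨P, Q, rfl, hv, hx, rfl⟩ := h
  obtain ⟨P', rfl⟩ : ∃ P', P = P' ++ [x] := by
    rcases List.eq_nil_or_concat P with rfl | ⟨P', y, rfl⟩
    · simp at hx
    · simp at hx; exact ⟨P', by simp [hx]⟩
  refine ⟨consec (P' ++ [x]) ++ consec (w :: Q), ?_, ?_⟩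
  · rw [consec_append_pair]
    exact List.perm_middle
  · obtain ⟨P'', h2⟩ : ∃ P'', (P' ++ [x]).reverse = P'' ++ [v] := by
      cases hP : P' ++ [x] with
      | nil => simp at hP
      | cons a l =>
        rw [hP] at hv; simp at hv; exact ⟨l.reverse, by simp [hv]⟩
    rw [h2, consec_append_pair, ← h2, consec_reverse]
    refine List.perm_middle.trans (List.Perm.cons _ ?_)
    exact (List.reverse_perm _).append_right _

/-- The pivot `w` occurs only once, so the segment before it, and with it the new head, is
determined. This makes the assignment of heads to edges in `heads_count` injective. -/
theorem IsRot.unique (hL : L.Nodup) {x₁ : V} {L₁ : List V} (h : IsRot v x w L L')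
    (h₁ : IsRot v x₁ w L L₁) : x = x₁ := by
  obtain ⟨P, Q, rfl, _, hx, _⟩ := h
  obtain ⟨P₁, Q₁, h, _, hx₁, _⟩ := h₁
  have : P = P₁ := by
    have hw : w ∉ P := fun hw => by
      rw [List.nodup_append] at hL
      exact hL.2.2 w hw w (by simp) rfl
    have hw₁ : w ∉ P₁ := fun hw => by
      rw [h, List.nodup_append] at hL
      exact hL.2.2 w hw w (by simp) rfl
    rw [List.append_eq_append_iff] at h
    rcases h with ⟨A, h1, h2⟩ | ⟨A, h1, h2⟩
    · cases A with
      | nil => simp at h1; exact h1.symm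
      | cons a A => simp at h2; exact absurd (by simp [h1, h2.1]) hw₁
    · cases A with
      | nil => simp at h1; exact h1
      | cons a A => simp at h2; exact absurd (by simp [h1, h2.1]) hw
  subst this
  rw [hx] at hx₁; exact Option.some.inj hx₁

theorem IsRot.mem_left (h : IsRot v x w L L') : s(x, w) ∈ consec L := by
  obtain ⟨R, h1, _⟩ := h.consec_perm
  exact h1.mem_iff.2 (by simp)

theorem IsRot.mem_of_ne (h : IsRot v x w L L') {e : Sym2 V} (he : e ∈ consec L)
    (hne : e ≠ s(x, w)) : e ∈ consec L' := by
  obtain ⟨R, h1, h2⟩ := h.consec_perm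
  have := h1.mem_iff.1 he
  simp [hne] at this
  exact h2.mem_iff.2 (by simp [this])

theorem IsRot.mem_of_ne' (h : IsRot v x w L L') {e : Sym2 V} (he : e ∈ consec L')
    (hne : e ≠ s(v, w)) : e ∈ consec L := by
  obtain ⟨R, h1, h2⟩ := h.consec_perm
  have := h2.mem_iff.1 he
  simp [hne] at this
  exact h1.mem_iff.2 (by simp [this])

theorem IsRot.not_mem (h : IsRot v x w L L') (hL : L.Nodup) (hxv : x ≠ v) :
    s(x, w) ∉ consec L' := by
  obtain ⟨R, h1, h2⟩ := h.consec_perm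
  have h3 := h1.nodup_iff.1 (nodup_consec hL)
  intro h4
  have := h2.mem_iff.1 h4
  rw [List.nodup_cons] at h3
  rcases List.mem_cons.1 this with h5 | h5
  · rw [Sym2.eq_iff] at h5
    rcases h5 with ⟨h5, _⟩ | ⟨h5, h6⟩
    · exact hxv h5
    · exact hxv (h5.trans h6)
  · exact h3.1 h5

/-- In a rotation at the second element the head does not change. -/
theorem IsRot.eq_of_mem (h : IsRot v x w L L') (hL : L.Nodup) (hm : s(v, w) ∈ consec L) :
    x = v := by
  obtain ⟨P, Q, rfl, hv, hx, rfl⟩ := h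
  cases P with
  | nil => simp at hv
  | cons a P =>
    simp at hv; subst hv
    cases P with
    | nil => simpa using hx.symm
    | cons b P =>
      exfalso
      simp only [List.cons_append, consec_cons_cons, List.mem_cons] at hm
      rcases hm with hm | hm
      · rw [Sym2.eq_iff] at hm
        rcases hm with ⟨_, rfl⟩ | ⟨rfl, _⟩
        · simp [List.nodup_append] at hL
        · simp at hL
      · have := mem_of_mem_consec hm (Sym2.mem_mk_left _ _)
        exact (List.nodup_cons.1 hL).1 (by simpa using this)

end Rot

/-! ### Cost, gaps and loss, and their change under a rotation. -/

/-- The cost of a pair: `0` for an edge of `G`, `1` for an edge of `U`, `2` for other pairs. -/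
noncomputable def pairCost {V : Type*} (G : SimpleGraph V) (U : Finset (Sym2 V)) (e : Sym2 V) : ℕ :=
  if e ∈ G.edgeSet then 0 else if e ∈ U then 1 else 2

/-- The pair `e` is an edge of `G` or belongs to `U`. -/
def IsReal {V : Type*} (G : SimpleGraph V) (U : Finset (Sym2 V)) (e : Sym2 V) : Prop :=
  e ∈ G.edgeSet ∨ e ∈ U

/-- The total cost of the consecutive pairs of a list. -/
noncomputable def listCost {V : Type*} (G : SimpleGraph V) (U : Finset (Sym2 V)) (L : List V) : ℕ :=
  ((consec L).map (pairCost G U)).sum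

/-- The number of consecutive pairs of a list that are neither in `G` nor in `U`. -/
noncomputable def gaps {V : Type*} (G : SimpleGraph V) (U : Finset (Sym2 V)) (L : List V) : ℕ :=
  (consec L).countP (fun e => ¬ IsReal G U e)

/-- The number of consecutive pairs of a list that are not in `M`. -/
noncomputable def listLoss {V : Type*} (M : Finset (Sym2 V)) (L : List V) : ℕ :=
  (consec L).countP (fun e => e ∉ M)

/-- Loss and cost of a list combined. -/
noncomputable def penalty {V : Type*} (G : SimpleGraph V) (U M : Finset (Sym2 V)) (L : List V) : ℕ :=
  listLoss M L + 200 * listCost G U L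

section Cost
variable {V : Type*} {G : SimpleGraph V} {U M : Finset (Sym2 V)}

theorem listCost_perm {L L' : List V} (h : (consec L).Perm (consec L')) :
    listCost G U L = listCost G U L' := (h.map _).sum_eq

theorem gaps_perm {L L' : List V} (h : (consec L).Perm (consec L')) :
    gaps G U L = gaps G U L' := h.countP_eq _

theorem listLoss_perm {L L' : List V} (h : (consec L).Perm (consec L')) :
    listLoss M L = listLoss M L' := h.countP_eq _

theorem penalty_perm {L L' : List V} (h : (consec L).Perm (consec L')) :
    penalty G U M L = penalty G U M L' := by
  unfold penalty; rw [listCost_perm h, listLoss_perm h]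

variable {v x w : V} {L L' : List V}

theorem IsRot.cost (h : IsRot v x w L L') (hvw : G.Adj v w) :
    listCost G U L' + pairCost G U s(x, w) = listCost G U L := by
  obtain ⟨R, h1, h2⟩ := h.consec_perm
  have e1 : listCost G U L = _ := (h1.map (pairCost G U)).sum_eq
  have e2 : listCost G U L' = _ := (h2.map (pairCost G U)).sum_eq
  have : pairCost G U s(v, w) = 0 := by simp [pairCost, hvw]
  simp only [List.map_cons, List.sum_cons, this] at e1 e2
  omega

theorem IsRot.gaps (h : IsRot v x w L L') (hvw : G.Adj v w) :
    gaps G U L' + (if IsReal G U s(x, w) then 0 else 1) = gaps G U L := by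
  obtain ⟨R, h1, h2⟩ := h.consec_perm
  have e1 : _root_.gaps G U L = _ := h1.countP_eq _
  have e2 : _root_.gaps G U L' = _ := h2.countP_eq _
  have : IsReal G U s(v, w) := Or.inl hvw
  rw [List.countP_cons] at e1 e2
  simp only [this, not_true_eq_false, decide_false] at e2
  rw [e1, e2]
  split_ifs <;> simp_all

theorem IsRot.loss (h : IsRot v x w L L') : listLoss M L' ≤ listLoss M L + 1 := by
  obtain ⟨R, h1, h2⟩ := h.consec_perm
  have e1 : listLoss M L = _ := h1.countP_eq _
  have e2 : listLoss M L' = _ := h2.countP_eq _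
  rw [List.countP_cons] at e1 e2
  rw [e1, e2]
  split_ifs <;> omega

theorem IsRot.cost_le (h : IsRot v x w L L') (hvw : G.Adj v w) :
    listCost G U L' ≤ listCost G U L := by have := h.cost (U := U) hvw; omega

theorem IsRot.gaps_le (h : IsRot v x w L L') (hvw : G.Adj v w) :
    _root_.gaps G U L' ≤ _root_.gaps G U L := by have := h.gaps (U := U) hvw; omega

theorem IsRot.gaps_lt (h : IsRot v x w L L') (hvw : G.Adj v w) (hx : ¬ IsReal G U s(x, w)) :
    _root_.gaps G U L' < _root_.gaps G U L := by
  have := h.gaps (U := U) hvw; rw [if_neg hx] at this; omega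

theorem IsRot.cost_lt (h : IsRot v x w L L') (hvw : G.Adj v w) (hx : s(x, w) ∉ G.edgeSet) :
    listCost G U L' < listCost G U L := by
  have := h.cost (U := U) hvw
  have h2 : 1 ≤ pairCost G U s(x, w) := by unfold pairCost; rw [if_neg hx]; split_ifs <;> omega
  omega

theorem IsRot.penalty_le (h : IsRot v x w L L') (hvw : G.Adj v w) :
    penalty G U M L' ≤ penalty G U M L + 1 := by
  have := h.cost_le (U := U) hvw
  have := h.loss (M := M)
  unfold penalty; omega

/-- The weight 200 in `penalty` at work: removing a non-edge of `G` lowers the cost by at least one,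
while the loss grows by at most one. The gain of 199 outweighs the losses of a hundred rounds. -/
theorem IsRot.penalty_le_of_not_mem (h : IsRot v x w L L') (hvw : G.Adj v w)
    (hx : s(x, w) ∉ G.edgeSet) : penalty G U M L' + 199 ≤ penalty G U M L := by
  have := h.cost_lt (U := U) hvw hx
  have := h.loss (M := M)
  unfold penalty; omega

end Cost

/-! ### Growing the set of end points by rotations -/

section Growth
variable {V : Type*} [Fintype V]

/-- `x` is the head of a rotation of one of the lists `Lv v`, `v ∈ S`, along an edge of `G`. -/
def IsNewHead (G : SimpleGraph V) (S : Finset V) (Lv : V → List V) (x : V) (L' : List V) : Prop :=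
  ∃ v ∈ S, ∃ w, G.Adj v w ∧ IsRot v x w (Lv v) L'

/-- One round of rotations: all new heads are added, with one list chosen for each. -/
noncomputable def growStep (G : SimpleGraph V) (p : Finset V × (V → List V)) : Finset V × (V → List V) :=
  (p.1 ∪ Finset.univ.filter fun x => ∃ L', IsNewHead G p.1 p.2 x L',
   fun x => if x ∈ p.1 then p.2 x else
    if h : ∃ L', IsNewHead G p.1 p.2 x L' then h.choose else [])

variable (G : SimpleGraph V) (S₀ : Finset V) (L₀ : V → List V)

/-- The heads reached after `i` rounds of rotations. -/
noncomputable def heads (i : ℕ) : Finset V := ((growStep G)^[i] (S₀, L₀)).1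

/-- The list chosen for each head after `i` rounds of rotations. -/
noncomputable def headList (i : ℕ) : V → List V := ((growStep G)^[i] (S₀, L₀)).2

/-- The heads reached in fewer than `i` rounds. -/
noncomputable def headsLT : ℕ → Finset V
  | 0 => ∅
  | i + 1 => heads G S₀ L₀ i

variable {G S₀ L₀}

@[simp] theorem heads_zero : heads G S₀ L₀ 0 = S₀ := rfl

@[simp] theorem headList_zero : headList G S₀ L₀ 0 = L₀ := rfl

theorem heads_succ (i : ℕ) : heads G S₀ L₀ (i + 1) = heads G S₀ L₀ i ∪
    Finset.univ.filter fun x => ∃ L', IsNewHead G (heads G S₀ L₀ i) (headList G S₀ L₀ i) x L' := by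
  unfold heads headList; rw [Function.iterate_succ_apply']; rfl

theorem headList_succ_of_mem {i : ℕ} {x : V} (hx : x ∈ heads G S₀ L₀ i) :
    headList G S₀ L₀ (i + 1) x = headList G S₀ L₀ i x := by
  unfold headList; rw [Function.iterate_succ_apply']; exact if_pos hx

theorem headList_succ_spec {i : ℕ} {x : V} (hx : x ∈ heads G S₀ L₀ (i + 1))
    (hx' : x ∉ heads G S₀ L₀ i) :
    IsNewHead G (heads G S₀ L₀ i) (headList G S₀ L₀ i) x (headList G S₀ L₀ (i + 1) x) := by
  rw [heads_succ, Finset.mem_union] at hx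
  have h : ∃ L', IsNewHead G (heads G S₀ L₀ i) (headList G S₀ L₀ i) x L' :=
    (Finset.mem_filter.1 (hx.resolve_left hx')).2
  have : headList G S₀ L₀ (i + 1) x = h.choose := by
    unfold headList; rw [Function.iterate_succ_apply']
    refine (if_neg hx').trans ?_
    rw [dif_pos]; rfl
  rw [this]; exact h.choose_spec

theorem heads_subset_succ (i : ℕ) : heads G S₀ L₀ i ⊆ heads G S₀ L₀ (i + 1) := by
  rw [heads_succ]; exact Finset.subset_union_left

theorem heads_mono : Monotone (heads G S₀ L₀) := monotone_nat_of_le_succ heads_subset_succ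

theorem headsLT_subset (i : ℕ) : headsLT G S₀ L₀ i ⊆ heads G S₀ L₀ i := by
  cases i with
  | zero => simp [headsLT]
  | succ i => exact heads_subset_succ i

theorem headsLT_mono : Monotone (headsLT G S₀ L₀) := by
  refine monotone_nat_of_le_succ fun i => ?_
  exact headsLT_subset i

theorem headList_eq_of_le {i j : ℕ} (hij : i ≤ j) {x : V} (hx : x ∈ heads G S₀ L₀ i) :
    headList G S₀ L₀ j x = headList G S₀ L₀ i x := by
  induction j, hij using Nat.le_induction with
  | base => rfl
  | succ j hij ih => rw [headList_succ_of_mem (heads_mono hij hx), ih]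

theorem mem_heads_succ {i : ℕ} {v w x : V} {L' : List V} (hv : v ∈ heads G S₀ L₀ i)
    (hvw : G.Adj v w) (h : IsRot v x w (headList G S₀ L₀ i v) L') : x ∈ heads G S₀ L₀ (i + 1) := by
  rw [heads_succ, Finset.mem_union]
  exact Or.inr (Finset.mem_filter.2 ⟨Finset.mem_univ _, L', v, hv, w, hvw, h⟩)

/-- The level `k` is the round in which `v` first appears; its list is fixed from then on. -/
theorem exists_level {i : ℕ} {v : V} (hv : v ∈ heads G S₀ L₀ i) :
    ∃ k ≤ i, v ∈ heads G S₀ L₀ k ∧ v ∉ headsLT G S₀ L₀ k := by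
  induction i with
  | zero => exact ⟨0, le_rfl, hv, by simp [headsLT]⟩
  | succ i ih =>
    by_cases h : v ∈ heads G S₀ L₀ i
    · obtain ⟨k, hk, h1⟩ := ih h
      exact ⟨k, by omega, h1⟩
    · exact ⟨i + 1, le_rfl, hv, h⟩

end Growth

/-! ### How the lists of the heads differ from the root lists. -/

theorem IsRot.symm {V : Type*} {v x w : V} {L L' : List V} (h : IsRot v x w L L') :
    IsRot x v w L' L := by
  obtain ⟨P, Q, rfl, hv, hx, rfl⟩ := h
  exact ⟨P.reverse, Q, rfl, by rw [List.head?_reverse, hx], by rw [List.getLast?_reverse, hv],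
    by rw [List.reverse_reverse]⟩

/-- The lists `L₀ v`, `v ∈ S₀`, are orderings with head `v` and the same set `F` of real
consecutive pairs, and have bounded cost, gaps and penalty. -/
structure IsRootFamily {V : Type*} (G : SimpleGraph V) (U M : Finset (Sym2 V)) (S₀ : Finset V)
    (L₀ : V → List V) (F : Set (Sym2 V)) (c g p : ℕ) : Prop where
  ordering : ∀ v ∈ S₀, IsOrdering (L₀ v)
  head : ∀ v ∈ S₀, (L₀ v).head? = some v
  real : ∀ v ∈ S₀, ∀ e, e ∈ consec (L₀ v) ∧ IsReal G U e ↔ e ∈ F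
  cost : ∀ v ∈ S₀, listCost G U (L₀ v) ≤ c
  gaps : ∀ v ∈ S₀, gaps G U (L₀ v) ≤ g
  penalty : ∀ v ∈ S₀, penalty G U M (L₀ v) ≤ p

section Invariants
variable {V : Type*} [Fintype V] {G : SimpleGraph V} {U M : Finset (Sym2 V)} {S₀ : Finset V}
  {L₀ : V → List V} {F H : Set (Sym2 V)} {c g p : ℕ}

theorem IsRootFamily.headList_spec (hr : IsRootFamily G U M S₀ L₀ F c g p) (i : ℕ) {v : V}
    (hv : v ∈ heads G S₀ L₀ i) :
    IsOrdering (headList G S₀ L₀ i v) ∧ (headList G S₀ L₀ i v).head? = some v ∧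
    (∃ r ∈ S₀, (headList G S₀ L₀ i v).getLast? = (L₀ r).getLast?) ∧
    listCost G U (headList G S₀ L₀ i v) ≤ c ∧ _root_.gaps G U (headList G S₀ L₀ i v) ≤ g ∧
    _root_.penalty G U M (headList G S₀ L₀ i v) ≤ p + i := by
  induction i generalizing v with
  | zero =>
    exact ⟨hr.ordering v hv, hr.head v hv, ⟨v, hv, rfl⟩, hr.cost v hv, hr.gaps v hv,
      hr.penalty v hv⟩
  | succ i ih =>
    by_cases h : v ∈ heads G S₀ L₀ i
    · obtain ⟨h1, h2, h3, h4, h5, h6⟩ := ih h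
      rw [headList_succ_of_mem h]
      exact ⟨h1, h2, h3, h4, h5, by omega⟩
    · obtain ⟨v', hv', w, hw, hrot⟩ := headList_succ_spec hv h
      obtain ⟨h1, h2, ⟨r, hr0, h3⟩, h4, h5, h6⟩ := ih hv'
      refine ⟨h1.of_perm hrot.perm, hrot.head, ⟨r, hr0, hrot.last.trans h3⟩,
        (hrot.cost_le hw).trans h4, (hrot.gaps_le hw).trans h5, ?_⟩
      have := hrot.penalty_le (U := U) (M := M) hw
      omega

variable (G U S₀ L₀ F H) in
/-- In the first `i` rounds every removed pair is real, and lies in `H` if it lies in `F`. -/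
def RemovesOnly (i : ℕ) : Prop :=
  ∀ j < i, ∀ v ∈ heads G S₀ L₀ j, ∀ w x L', G.Adj v w → IsRot v x w (headList G S₀ L₀ j v) L' →
    IsReal G U s(x, w) ∧ (s(x, w) ∈ F → s(x, w) ∈ H)

theorem RemovesOnly.mono {i j : ℕ} (h : RemovesOnly G U S₀ L₀ F H j) (hij : i ≤ j) :
    RemovesOnly G U S₀ L₀ F H i := fun k hk => h k (by omega)

/-- A rotation alters pairs only at the old head, the new head and the pivot. So a vertex that has
not been a head keeps its root pairs until it first serves as pivot; the pair removed then lies in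
`F`, hence in `H`, and joins it to the new head. Every removed pair contains the head it creates, so
a pair of `F` is missing only at a present or earlier head. -/
theorem grow_invariant (hr : IsRootFamily G U M S₀ L₀ F c g p) (i : ℕ)
    (hH : RemovesOnly G U S₀ L₀ F H i) {v : V} (hv : v ∈ heads G S₀ L₀ i) {k : ℕ} (hk : k ≤ i)
    (hvk : v ∈ heads G S₀ L₀ k) (hvk' : v ∉ headsLT G S₀ L₀ k) :
    (∀ w, w ≠ v → w ∉ headsLT G S₀ L₀ k →
      (∀ y, s(w, y) ∈ consec (headList G S₀ L₀ i v) ∧ IsReal G U s(w, y) ↔ s(w, y) ∈ F) ∨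
      ∃ x ∈ heads G S₀ L₀ k, s(w, x) ∈ H) ∧
    (∀ y z, s(y, z) ∈ F → s(y, z) ∉ consec (headList G S₀ L₀ i v) →
      (y ∈ headsLT G S₀ L₀ k ∨ y = v) ∨ (z ∈ headsLT G S₀ L₀ k ∨ z = v)) := by
  induction i generalizing v k with
  | zero =>
    exact ⟨fun w _ _ => Or.inl fun y => hr.real v hv _,
      fun y z h1 h2 => absurd ((hr.real v hv _).2 h1).1 h2⟩
  | succ i ih =>
    have hH' := hH.mono (Nat.le_succ i)
    by_cases h : v ∈ heads G S₀ L₀ i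
    · have hki : k ≤ i := by
        by_contra hcon
        obtain rfl : k = i + 1 := by omega
        exact hvk' h
      rw [headList_succ_of_mem h]
      exact ih hH' h hki hvk hvk'
    · obtain rfl : k = i + 1 := by
        by_contra hcon
        exact h (heads_mono (by omega) hvk)
      obtain ⟨u, hu, w, hw, hrot⟩ := headList_succ_spec hv h
      obtain ⟨m, hm, hum, hum'⟩ := exists_level hu
      obtain ⟨I1, I3⟩ := ih hH' hu hm hum hum'
      have hlt : headsLT G S₀ L₀ m ⊆ heads G S₀ L₀ i := (headsLT_subset m).trans (heads_mono hm)
      constructor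
      · intro w' hw'v hw'
        change w' ∉ heads G S₀ L₀ i at hw'
        have hw'u : w' ≠ u := fun h => hw' (h ▸ hu)
        rcases I1 w' hw'u (fun h => hw' (hlt h)) with h1 | ⟨x, hx, hx'⟩
        · by_cases hww : w' = w
          · subst hww
            obtain ⟨hreal, hFH⟩ := hH i (Nat.lt_succ_self i) u hu w' v _ hw hrot
            refine Or.inr ⟨v, hvk, ?_⟩
            rw [Sym2.eq_swap]
            apply hFH
            rw [Sym2.eq_swap]
            exact (h1 v).1 (by rw [Sym2.eq_swap]; exact ⟨hrot.mem_left, hreal⟩)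
          · refine Or.inl fun y => ?_
            rw [← h1 y]
            have n1 : s(w', y) ≠ s(v, w) := by
              intro h2
              rw [Sym2.eq_iff] at h2
              rcases h2 with ⟨h2, _⟩ | ⟨h2, _⟩
              · exact hw'v h2
              · exact hww h2
            have n2 : s(w', y) ≠ s(u, w) := by
              intro h2
              rw [Sym2.eq_iff] at h2
              rcases h2 with ⟨h2, _⟩ | ⟨h2, _⟩
              · exact hw'u h2
              · exact hww h2
            exact and_congr_left fun _ => ⟨fun h3 => hrot.mem_of_ne' h3 n2,
              fun h3 => hrot.mem_of_ne h3 n1⟩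
        · exact Or.inr ⟨x, heads_mono (by omega) hx, hx'⟩
      · intro y z hF hnot
        by_cases hin : s(y, z) ∈ consec (headList G S₀ L₀ i u)
        · have : s(y, z) = s(v, w) := by
            by_contra hne
            exact hnot (hrot.mem_of_ne hin hne)
          rw [Sym2.eq_iff] at this
          rcases this with ⟨h2, _⟩ | ⟨_, h2⟩
          · exact Or.inl (Or.inr h2)
          · exact Or.inr (Or.inr h2)
        · rcases I3 y z hF hin with (h1 | rfl) | (h1 | rfl)
          · exact Or.inl (Or.inl (hlt h1))
          · exact Or.inl (Or.inl hu)
          · exact Or.inr (Or.inl (hlt h1))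
          · exact Or.inr (Or.inl hu)

/-- A neighbour of a head that is not an earlier head has an `H`-neighbour among the heads of the
next round. -/
theorem exists_neighbor_of_adj (hr : IsRootFamily G U M S₀ L₀ F c g p) {k : ℕ}
    (hH : RemovesOnly G U S₀ L₀ F H (k + 1)) {v w : V} (hvk : v ∈ heads G S₀ L₀ k)
    (hvk' : v ∉ headsLT G S₀ L₀ k) (hvw : G.Adj v w) (hw : w ∉ headsLT G S₀ L₀ k) :
    ∃ x ∈ heads G S₀ L₀ (k + 1), s(w, x) ∈ H := by
  obtain ⟨h1, h2, -⟩ := hr.headList_spec k hvk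
  obtain ⟨x, L', hrot⟩ := exists_isRot h2 (h1.2 w) hvw.ne'
  obtain ⟨hreal, hFH⟩ := hH k (Nat.lt_succ_self k) v hvk w x _ hvw hrot
  rcases (grow_invariant hr k (hH.mono (Nat.le_succ k)) hvk le_rfl hvk hvk').1 w hvw.ne' hw with
    h | ⟨y, hy, hy'⟩
  · refine ⟨x, mem_heads_succ hvk hvw hrot, ?_⟩
    rw [Sym2.eq_swap]
    apply hFH
    rw [Sym2.eq_swap]
    exact (h x).1 (by rw [Sym2.eq_swap]; exact ⟨hrot.mem_left, hreal⟩)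
  · exact ⟨y, heads_subset_succ k hy, hy'⟩

theorem exists_neighbor_of_adj_of_not_mem (hr : IsRootFamily G U M S₀ L₀ F c g p) {i : ℕ}
    (hH : RemovesOnly G U S₀ L₀ F H (i + 1)) {v w : V} (hv : v ∈ heads G S₀ L₀ i)
    (hvw : G.Adj v w) (hw : w ∉ heads G S₀ L₀ i) :
    ∃ x ∈ heads G S₀ L₀ (i + 1), s(w, x) ∈ H := by
  obtain ⟨k, hk, h1, h2⟩ := exists_level hv
  obtain ⟨x, hx, hx'⟩ := exists_neighbor_of_adj hr (hH.mono (by omega)) h1 h2 hvw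
    (fun h => hw (heads_mono hk (headsLT_subset k h)))
  exact ⟨x, heads_mono (by omega) hx, hx'⟩

/-- The edge is used from its end of smaller level: the other end is then not an earlier head and
may serve as pivot. -/
theorem exists_neighbor_of_adj_of_mem (hr : IsRootFamily G U M S₀ L₀ F c g p) {i : ℕ}
    (hH : RemovesOnly G U S₀ L₀ F H (i + 1)) {v w : V} (hv : v ∈ heads G S₀ L₀ i)
    (hvw : G.Adj v w) (hw : w ∈ heads G S₀ L₀ i) :
    ∃ y ∈ heads G S₀ L₀ i, ∃ x ∈ heads G S₀ L₀ (i + 1), s(y, x) ∈ H := by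
  obtain ⟨k, hk, h1, h2⟩ := exists_level hv
  obtain ⟨m, hm, h3, h4⟩ := exists_level hw
  rcases le_total k m with hkm | hkm
  · obtain ⟨x, hx, hx'⟩ := exists_neighbor_of_adj hr (hH.mono (by omega)) h1 h2 hvw
      (fun h => h4 (headsLT_mono hkm h))
    exact ⟨w, hw, x, heads_mono (by omega) hx, hx'⟩
  · obtain ⟨x, hx, hx'⟩ := exists_neighbor_of_adj hr (hH.mono (by omega)) h3 h4 hvw.symm
      (fun h => h2 (headsLT_mono hkm h))
    exact ⟨v, hv, x, heads_mono (by omega) hx, hx'⟩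

/-- A head without `H`-neighbour among the heads comes from a rotation along an edge outside `F`,
at an `H`-neighbour. -/
theorem exists_parent (hr : IsRootFamily G U M S₀ L₀ F c g p) {i : ℕ}
    (hH : RemovesOnly G U S₀ L₀ F H (i + 1)) {b : V} (hb : b ∈ heads G S₀ L₀ i) (hb₀ : b ∉ S₀)
    (hbN : ∀ x ∈ heads G S₀ L₀ (i + 1), s(b, x) ∉ H) :
    ∃ a ∈ heads G S₀ L₀ i, ∃ w, G.Adj a w ∧ s(b, w) ∈ H ∧ s(a, w) ∉ F ∧
      ∃ L', IsRot a b w (headList G S₀ L₀ i a) L' := by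
  obtain ⟨k, hk, hbk, hbk'⟩ := exists_level hb
  obtain _ | j := k
  · exact absurd hbk hb₀
  obtain ⟨a, ha, w, haw, hrot⟩ := headList_succ_spec hbk hbk'
  change b ∉ heads G S₀ L₀ j at hbk'
  obtain ⟨m, hm, ham, ham'⟩ := exists_level ha
  have hba : b ≠ a := fun h => hbk' (h ▸ ha)
  obtain ⟨hreal, hFH⟩ := hH j (by omega) a ha w b _ haw hrot
  have hbw : s(b, w) ∈ H := by
    rcases (grow_invariant hr j (hH.mono (by omega)) ha hm ham ham').1 b hba
      (fun h => hbk' (heads_mono hm (headsLT_subset m h))) with h | ⟨x, hx, hx'⟩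
    · exact hFH ((h w).1 ⟨hrot.mem_left, hreal⟩)
    · exact absurd hx' (hbN x (heads_mono (by omega) hx))
  -- The pivot lies outside the set of heads, so `a w` is an edge of `G` that leaves it.
  have hw : w ∉ heads G S₀ L₀ (i + 1) := fun h => hbN w h hbw
  refine ⟨a, heads_mono (by omega) ha, w, haw, hbw, fun hF => ?_, ?_⟩
  · have hord := (hr.headList_spec j ha).1
    by_cases hin : s(a, w) ∈ consec (headList G S₀ L₀ j a)
    · exact hba (hrot.eq_of_mem hord.1 hin)
    rw [headList_eq_of_le hm ham] at hin hrot hord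
    obtain _ | l := m
    · exact hin ((hr.real a ham _).2 hF).1
    · change a ∉ heads G S₀ L₀ l at ham'
      obtain ⟨u, hu, w₀, huw, hrot'⟩ := headList_succ_spec ham ham'
      obtain ⟨n, hn, hun, hun'⟩ := exists_level hu
      have hlt : headsLT G S₀ L₀ n ⊆ heads G S₀ L₀ l :=
        (headsLT_subset n).trans (heads_mono hn)
      have hin' : s(a, w) ∈ consec (headList G S₀ L₀ l u) := by
        by_contra hcon
        rcases (grow_invariant hr l (hH.mono (by omega)) hu hn hun hun').2 a w hF hcon with
          (h1 | rfl) | (h1 | rfl)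
        · exact ham' (hlt h1)
        · exact ham' hu
        · exact hw (heads_mono (by omega) (hlt h1))
        · exact hw (heads_mono (by omega) hu)
      -- A pair of `F` missing from the list of `a` can only have been lost in the rotation that
      -- created `a`. Rotating at the same pivot again undoes that rotation, so `b` would be the
      -- older head `u`.
      have heq : s(a, w) = s(a, w₀) := by
        by_contra hne
        exact hin (hrot'.mem_of_ne hin' hne)
      rw [Sym2.congr_right] at heq
      subst heq
      have := hrot.unique hord.1 hrot'.symm
      exact hbk' (this ▸ heads_mono (by omega) hu)
  · rw [headList_eq_of_le (show j ≤ i by omega) ha]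
    exact ⟨_, hrot⟩

end Invariants

/-! ### Counting edges at a set and its neighbourhood. -/

section Count
variable {V : Type*} [Fintype V]

theorem two_mul_spannedEdges (G : SimpleGraph V) (T : Finset V) :
    2 * spannedEdges G T = ∑ v ∈ T, (T.filter fun w => G.Adj v w).card := by
  let K : SimpleGraph V :=
    { Adj := fun a b => G.Adj a b ∧ a ∈ T ∧ b ∈ T
      symm := ⟨fun a b h => ⟨h.1.symm, h.2.2, h.2.1⟩⟩
      loopless := ⟨fun a h => G.loopless.irrefl a h.1⟩ }
  have h1 := K.sum_degrees_eq_twice_card_edges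
  have h2 : K.edgeFinset = G.edgeFinset.filter (fun e => ∀ v ∈ e, v ∈ T) := by
    ext e
    induction e with
    | _ a b => simp [K]
  unfold spannedEdges
  rw [← h2, ← h1, ← Finset.sum_subset (Finset.subset_univ T)]
  · refine Finset.sum_congr rfl fun v hv => ?_
    rw [← SimpleGraph.card_neighborFinset_eq_degree]
    congr 1
    ext w
    simp [K, hv, and_comm]
  · intro v _ hv
    rw [← SimpleGraph.card_neighborFinset_eq_degree, Finset.card_eq_zero]
    ext w
    simp [K, hv]

/-- An edge leaving `S` has both ends in `T` and is seen from both in the degree sum over `T`,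
whence the factor two. -/
theorem spannedEdges_ge (G : SimpleGraph V) {S T : Finset V} (hST : S ⊆ T)
    (hT : ∀ v ∈ S, ∀ w, G.Adj v w → w ∈ T) :
    ∑ v ∈ S, (S.filter fun w => G.Adj v w).card +
      2 * ∑ v ∈ S, ((Finset.univ \ S).filter fun w => G.Adj v w).card ≤ 2 * spannedEdges G T := by
  rw [two_mul_spannedEdges, ← Finset.sum_sdiff hST]
  have e1 : ∀ v ∈ S, (T.filter fun w => G.Adj v w).card =
      (S.filter fun w => G.Adj v w).card +
        ((Finset.univ \ S).filter fun w => G.Adj v w).card := by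
    intro v hv
    rw [← Finset.card_union_of_disjoint]
    · congr 1
      ext w
      simp only [Finset.mem_filter, Finset.mem_union, Finset.mem_sdiff, Finset.mem_univ, true_and]
      constructor
      · rintro ⟨_, h⟩; by_cases hw : w ∈ S <;> simp [hw, h]
      · rintro (⟨h, h'⟩ | ⟨h, h'⟩)
        · exact ⟨hST h, h'⟩
        · exact ⟨hT v hv w h', h'⟩
    · rw [Finset.disjoint_left]
      intro w hw hw'
      simp at hw hw'
      exact hw'.1 hw.1
  rw [Finset.sum_congr rfl e1, Finset.sum_add_distrib]
  have e2 : ∑ v ∈ S, ((Finset.univ \ S).filter fun w => G.Adj v w).card ≤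
      ∑ w ∈ T \ S, (T.filter fun v => G.Adj w v).card := by
    have := Finset.sum_card_bipartiteAbove_eq_sum_card_bipartiteBelow (s := S) (t := T \ S)
      (fun v w => G.Adj v w)
    calc _ ≤ ∑ v ∈ S, (Finset.bipartiteAbove (fun v w => G.Adj v w) (T \ S) v).card := by
          refine Finset.sum_le_sum fun v hv => Finset.card_le_card ?_
          intro w hw
          simp [Finset.mem_bipartiteAbove] at hw ⊢
          exact ⟨⟨hT v hv w hw.2, hw.1⟩, hw.2⟩
      _ = _ := this
      _ ≤ _ := by
          refine Finset.sum_le_sum fun w hw => Finset.card_le_card ?_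
          intro v hv
          simp [Finset.mem_bipartiteBelow] at hv ⊢
          exact ⟨hST hv.1, hv.2.symm⟩
  omega

/-- A set together with all its `H`-neighbours. -/
noncomputable def closedNbhd (H : Set (Sym2 V)) (S : Finset V) : Finset V :=
  S ∪ Finset.univ.filter fun w => ∃ x ∈ S, s(w, x) ∈ H

/-- The `H`-degree of a vertex. -/
noncomputable def setDeg (H : Set (Sym2 V)) (v : V) : ℕ :=
  (Finset.univ.filter fun x => s(v, x) ∈ H).card

/-- The number of ordered pairs in `S` that form an element of `H`. -/
noncomputable def innerDeg (H : Set (Sym2 V)) (S : Finset V) : ℕ :=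
  ∑ v ∈ S, (S.filter fun x => s(v, x) ∈ H).card

/-- A vertex of `S` adds at most as many new vertices as its `H`-degree, and neighbours inside `S`
add none. -/
theorem card_closedNbhd_le (H : Set (Sym2 V)) (S : Finset V) :
    (closedNbhd H S).card + innerDeg H S ≤ S.card + ∑ v ∈ S, setDeg H v := by
  have h1 : closedNbhd H S ⊆ S ∪ S.biUnion fun v =>
      (Finset.univ \ S).filter fun x => s(v, x) ∈ H := by
    intro w hw
    simp only [closedNbhd, Finset.mem_union, Finset.mem_filter, Finset.mem_univ, true_and,
      Finset.mem_biUnion, Finset.mem_sdiff] at hw ⊢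
    by_cases hwS : w ∈ S
    · exact Or.inl hwS
    · obtain ⟨x, hx, h⟩ := hw.resolve_left hwS
      exact Or.inr ⟨x, hx, hwS, by rwa [Sym2.eq_swap]⟩
  have h2 := (Finset.card_le_card h1).trans ((Finset.card_union_le _ _).trans
    (Nat.add_le_add_left Finset.card_biUnion_le _))
  have h3 : ∑ v ∈ S, setDeg H v = ∑ v ∈ S, ((Finset.univ \ S).filter fun x => s(v, x) ∈ H).card +
      innerDeg H S := by
    unfold innerDeg
    rw [← Finset.sum_add_distrib]
    refine Finset.sum_congr rfl fun v _ => ?_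
    unfold setDeg
    rw [← Finset.card_union_of_disjoint]
    · congr 1
      ext x
      simp only [Finset.mem_filter, Finset.mem_union, Finset.mem_sdiff, Finset.mem_univ, true_and]
      tauto
    · rw [Finset.disjoint_left]
      intro w hw hw'
      simp at hw hw'
      exact hw.1 hw'.1
  omega

variable (G : SimpleGraph V) {S S' R₀ : Finset V} {F H : Set (Sym2 V)}

/-- The degrees in `S` sum to at least `4 * S.card`. Combined with `spannedEdges_ge`, the first
bound eliminates the edges leaving `S` and the second keeps them. -/
theorem eight_mul_card_le {T : Finset V} (hST : S ⊆ T)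
    (hT : ∀ v ∈ S, ∀ w, G.Adj v w → w ∈ T) (hdeg : ∀ v, 4 ≤ G.degree v) :
    8 * S.card ≤ 2 * spannedEdges G T + ∑ v ∈ S, (S.filter fun w => G.Adj v w).card ∧
    4 * S.card + ∑ v ∈ S, ((Finset.univ \ S).filter fun w => G.Adj v w).card ≤
      2 * spannedEdges G T := by
  have h1 := spannedEdges_ge G hST hT
  have h2 : 4 * S.card ≤ ∑ v ∈ S, (S.filter fun w => G.Adj v w).card +
      ∑ v ∈ S, ((Finset.univ \ S).filter fun w => G.Adj v w).card := by
    rw [← Finset.sum_add_distrib, mul_comm, ← smul_eq_mul]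
    refine Finset.card_nsmul_le_sum _ _ _ fun v _ => (hdeg v).trans ?_
    rw [← SimpleGraph.card_neighborFinset_eq_degree, ← Finset.card_union_of_disjoint]
    · refine Finset.card_le_card fun w hw => ?_
      simp at hw
      simp only [Finset.mem_filter, Finset.mem_union, Finset.mem_sdiff, Finset.mem_univ, true_and]
      tauto
    · rw [Finset.disjoint_left]
      intro w hw hw'
      simp at hw hw'
      exact hw'.1 hw.1
  omega

theorem nbhd_subset_closedNbhd (hSS' : S ⊆ S')
    (h1 : ∀ v ∈ S, ∀ w, G.Adj v w → w ∉ S → ∃ x ∈ S', s(w, x) ∈ H) :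
    ∀ v ∈ S, ∀ w, G.Adj v w → w ∈ closedNbhd H S' := by
  intro v hv w hvw
  unfold closedNbhd
  by_cases hw : w ∈ S
  · exact Finset.mem_union_left _ (hSS' hw)
  · exact Finset.mem_union_right _ (Finset.mem_filter.2 ⟨Finset.mem_univ _, h1 v hv w hvw hw⟩)

/-- Two disjoint families of edges leaving `S` are fed into the second bound of `eight_mul_card_le`:
the edges of `F` and `G` that go out of `S'`, and for each non-root `b` without `H`-neighbour in
`S'` an edge `a w` outside `F`, from which `Pred` recovers `b`. The second family supplies the fifth
`S.card`; the exceptions are charged to `innerDeg` and `R₀`. -/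
theorem five_mul_card_le (hSS' : S ⊆ S') (hdeg : ∀ v, 4 ≤ G.degree v)
    (hGH : ∀ v w, G.Adj v w → s(v, w) ∈ F → s(v, w) ∈ H)
    (h1 : ∀ v ∈ S, ∀ w, G.Adj v w → w ∉ S → ∃ x ∈ S', s(w, x) ∈ H)
    (Pred : V → V → V → Prop) (hPred : ∀ a w b b', Pred a w b → Pred a w b' → b = b')
    (h3 : ∀ b ∈ S, b ∉ R₀ → (∀ x ∈ S', s(b, x) ∉ H) →
      ∃ a ∈ S, ∃ w, G.Adj a w ∧ s(b, w) ∈ H ∧ s(a, w) ∉ F ∧ Pred a w b) :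
    5 * S.card + ∑ v ∈ S, setDeg (F ∩ G.edgeSet) v ≤
      2 * spannedEdges G (closedNbhd H S') + 2 * innerDeg H S' + R₀.card := by
  have hb := (eight_mul_card_le G (hSS'.trans (by unfold closedNbhd; exact Finset.subset_union_left))
    (nbhd_subset_closedNbhd G hSS' h1) hdeg).2
  set C := ∑ v ∈ S, ((Finset.univ \ S).filter fun w => G.Adj v w).card with hC
  set B := S.filter (fun b => b ∉ R₀ ∧ ∀ x ∈ S', s(b, x) ∉ H) with hB
  have hg : ∑ v ∈ S, (S'.filter fun x => s(v, x) ∈ H).card ≤ innerDeg H S' :=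
    Finset.sum_le_sum_of_subset hSS'
  have hBcard : S.card ≤ B.card + R₀.card + innerDeg H S' := by
    have : S ⊆ B ∪ R₀ ∪ S.filter (fun b => ∃ x ∈ S', s(b, x) ∈ H) := by
      intro b hb
      simp only [hB, Finset.mem_union, Finset.mem_filter]
      by_cases h : b ∈ R₀
      · exact Or.inl (Or.inr h)
      · by_cases h' : ∃ x ∈ S', s(b, x) ∈ H
        · exact Or.inr ⟨hb, h'⟩
        · push Not at h'; exact Or.inl (Or.inl ⟨hb, h, h'⟩)
    have h4 := (Finset.card_le_card this).trans (Finset.card_union_le _ _)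
    have h5 := Finset.card_union_le B R₀
    have h6 : (S.filter (fun b => ∃ x ∈ S', s(b, x) ∈ H)).card ≤
        ∑ v ∈ S, (S'.filter fun x => s(v, x) ∈ H).card := by
      rw [Finset.card_filter]
      refine Finset.sum_le_sum fun v _ => ?_
      split_ifs with h
      · obtain ⟨x, hx, hx'⟩ := h
        exact Finset.card_pos.2 ⟨x, Finset.mem_filter.2 ⟨hx, hx'⟩⟩
      · exact Nat.zero_le _
    omega
  have hNG : ∑ v ∈ S, setDeg (F ∩ G.edgeSet) v ≤
      ∑ v ∈ S, ((Finset.univ \ S').filter fun w => s(v, w) ∈ F ∩ G.edgeSet).card +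
        innerDeg H S' := by
    refine le_trans ?_ (Nat.add_le_add_left hg _)
    rw [← Finset.sum_add_distrib]
    refine Finset.sum_le_sum fun v _ => ?_
    refine le_trans (Finset.card_le_card ?_) (Finset.card_union_le _ _)
    intro w hw
    simp only [Finset.mem_filter, Finset.mem_union, Finset.mem_sdiff, Finset.mem_univ,
      true_and] at hw ⊢
    by_cases h : w ∈ S'
    · exact Or.inr ⟨h, hGH v w hw.2 hw.1⟩
    · exact Or.inl ⟨h, hw⟩
  have hC2 : ∑ v ∈ S, ((Finset.univ \ S').filter fun w => s(v, w) ∈ F ∩ G.edgeSet).card + B.card ≤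
      C := by
    rw [hC, ← Finset.card_sigma, ← Finset.card_sigma]
    have hpar : ∀ b : V, ∃ q : (_ : V) × V, b ∈ B → q.1 ∈ S ∧ G.Adj q.1 q.2 ∧ s(b, q.2) ∈ H ∧
        s(q.1, q.2) ∉ F ∧ Pred q.1 q.2 b := by
      intro b
      by_cases hb : b ∈ B
      · simp only [hB, Finset.mem_filter] at hb
        obtain ⟨a, ha, w, h⟩ := h3 b hb.1 hb.2.1 hb.2.2
        exact ⟨⟨a, w⟩, fun _ => ⟨ha, h⟩⟩
      · exact ⟨⟨b, b⟩, fun h => absurd h hb⟩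
    choose q hq using hpar
    have hinj : Set.InjOn q B := by
      intro b hb b' hb' h
      have h1 := (hq b hb).2.2.2.2
      have h2 := (hq b' hb').2.2.2.2
      rw [h] at h1
      exact hPred _ _ _ _ h1 h2
    rw [← Finset.card_image_of_injOn hinj, ← Finset.card_union_of_disjoint]
    · refine Finset.card_le_card fun z hz => ?_
      rw [Finset.mem_union] at hz
      rcases hz with hz | hz
      · simp only [Finset.mem_sigma, Finset.mem_filter, Finset.mem_sdiff, Finset.mem_univ,
          true_and] at hz ⊢
        exact ⟨hz.1, fun h => hz.2.1 (hSS' h), hz.2.2.2⟩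
      · obtain ⟨b, hb, rfl⟩ := Finset.mem_image.1 hz
        obtain ⟨a1, a2, a3, a4, a5⟩ := hq b hb
        simp only [Finset.mem_sigma, Finset.mem_filter, Finset.mem_sdiff, Finset.mem_univ,
          true_and]
        refine ⟨a1, fun h => ?_, a2⟩
        exact ((Finset.mem_filter.1 hb).2.2 _ (hSS' h)) a3
    · rw [Finset.disjoint_left]
      intro z hz hz'
      obtain ⟨b, hb, rfl⟩ := Finset.mem_image.1 hz'
      simp only [Finset.mem_sigma, Finset.mem_filter, Finset.mem_sdiff, Finset.mem_univ,
        true_and] at hz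
      exact (hq b hb).2.2.2.1 hz.2.2.1
  omega

end Count

/-! ### Growth of the set of heads. -/

theorem sum_card_filter_adj_le {V : Type*} (G : SimpleGraph V) (S : Finset V) :
    ∑ v ∈ S, (S.filter fun w => G.Adj v w).card ≤ S.card * (S.card - 1) := by
  refine Finset.sum_le_card_nsmul _ _ _ fun v hv => ?_
  rw [← Finset.card_erase_of_mem hv]
  refine Finset.card_le_card fun w hw => ?_
  simp only [Finset.mem_filter] at hw
  exact Finset.mem_erase.2 ⟨hw.2.ne', hw.1⟩

theorem innerDeg_ne_zero {V : Type*} [Fintype V] {H : Set (Sym2 V)} {S : Finset V} {x y : V}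
    (hy : y ∈ S) (hx : x ∈ S) (h : s(y, x) ∈ H) : innerDeg H S ≠ 0 := by
  intro h0
  exact Finset.card_ne_zero_of_mem (Finset.mem_filter.2 ⟨hx, h⟩)
    (Finset.sum_eq_zero_iff.1 h0 y hy)

section GrowthRate
variable {V : Type*} [Fintype V] {G : SimpleGraph V} {U M : Finset (Sym2 V)} {S₀ : Finset V}
  {L₀ : V → List V} {F H : Set (Sym2 V)} {c g p : ℕ}

theorem RemovesOnly.of_real {i : ℕ} (h : ∀ j < i, ∀ v ∈ heads G S₀ L₀ j, ∀ w x L', G.Adj v w →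
    IsRot v x w (headList G S₀ L₀ j v) L' → IsReal G U s(x, w)) : RemovesOnly G U S₀ L₀ F F i :=
  fun j hj v hv w x L' hvw hrot => ⟨h j hj v hv w x L' hvw hrot, id⟩

theorem RemovesOnly.of_mem_edgeSet {i : ℕ} (h : ∀ j < i, ∀ v ∈ heads G S₀ L₀ j, ∀ w x L',
    G.Adj v w → IsRot v x w (headList G S₀ L₀ j v) L' → s(x, w) ∈ G.edgeSet) :
    RemovesOnly G U S₀ L₀ F (F ∩ G.edgeSet) i :=
  fun j hj v hv w x L' hvw hrot => ⟨Or.inl (h j hj v hv w x L' hvw hrot),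
    fun hF => ⟨hF, h j hj v hv w x L' hvw hrot⟩⟩

theorem setDeg_mono {F H : Set (Sym2 V)} (h : F ⊆ H) (v : V) : setDeg F v ≤ setDeg H v :=
  Finset.card_le_card fun x hx => by
    simp only [Finset.mem_filter, Finset.mem_univ, true_and] at hx ⊢
    exact h hx

theorem IsRootFamily.setDeg_le_two (hr : IsRootFamily G U M S₀ L₀ F c g p) (h₀ : S₀.Nonempty)
    (v : V) : setDeg F v ≤ 2 := by
  obtain ⟨r, hr₀⟩ := h₀
  refine le_trans (Finset.card_le_card fun x hx => ?_) (card_consec_le (hr.ordering r hr₀).1 v)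
  simp only [Finset.mem_filter, Finset.mem_univ, true_and] at hx ⊢
  exact ((hr.real r hr₀ _).2 hx).1

theorem IsRootFamily.setDeg_le_one (hr : IsRootFamily G U M S₀ L₀ F c g p) {r : V}
    (hr₀ : r ∈ S₀) : setDeg F r ≤ 1 := by
  have h1 := hr.head r hr₀
  have h2 := (hr.ordering r hr₀).1
  have h3 := hr.real r hr₀
  cases hL : L₀ r with
  | nil => rw [hL] at h1; simp at h1
  | cons a l =>
    rw [hL] at h1 h2 h3
    simp only [List.head?_cons, Option.some.injEq] at h1
    subst h1
    refine le_trans (Finset.card_le_card fun x hx => ?_) (card_consec_head_le h2)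
    simp only [Finset.mem_filter, Finset.mem_univ, true_and] at hx ⊢
    exact ((h3 _).2 hx).1

/-- Path degrees are at most two, and a root, being first in its own list, has degree at most one.
-/
theorem IsRootFamily.sum_setDeg_le (hr : IsRootFamily G U M S₀ L₀ F c g p) (h₀ : S₀.Nonempty)
    (hHF : H ⊆ F) {S : Finset V} (hS : S₀ ⊆ S) :
    ∑ v ∈ S, setDeg H v + S₀.card ≤ 2 * S.card := by
  rw [← Finset.sum_sdiff hS]
  have h1 : ∑ v ∈ S \ S₀, setDeg H v ≤ (S \ S₀).card * 2 :=
    Finset.sum_le_card_nsmul _ _ _ fun v _ =>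
      (setDeg_mono hHF v).trans (hr.setDeg_le_two h₀ v)
  have h2 : ∑ v ∈ S₀, setDeg H v ≤ S₀.card * 1 :=
    Finset.sum_le_card_nsmul _ _ _ fun v hv => (setDeg_mono hHF v).trans (hr.setDeg_le_one hv)
  have h3 := Finset.card_sdiff_add_card_eq_card hS
  omega

theorem IsRootFamily.sum_setDeg_le_of_subset (hr : IsRootFamily G U M S₀ L₀ F c g p)
    (h₀ : S₀.Nonempty) (hHF : H ⊆ F) {S S' : Finset V} (hS : S ⊆ S') :
    ∑ v ∈ S', setDeg H v + 2 * S.card ≤ ∑ v ∈ S, setDeg H v + 2 * S'.card := by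
  rw [← Finset.sum_sdiff hS]
  have h1 : ∑ v ∈ S' \ S, setDeg H v ≤ (S' \ S).card * 2 :=
    Finset.sum_le_card_nsmul _ _ _ fun v _ =>
      (setDeg_mono hHF v).trans (hr.setDeg_le_two h₀ v)
  have h3 := Finset.card_sdiff_add_card_eq_card hS
  omega

theorem heads_count (hr : IsRootFamily G U M S₀ L₀ F c g p) (hdeg : ∀ v, 4 ≤ G.degree v) {i : ℕ}
    (hH : RemovesOnly G U S₀ L₀ F H (i + 1))
    (hGH : ∀ v w, G.Adj v w → s(v, w) ∈ F → s(v, w) ∈ H) :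
    5 * (heads G S₀ L₀ i).card + ∑ v ∈ heads G S₀ L₀ i, setDeg (F ∩ G.edgeSet) v ≤
      2 * spannedEdges G (closedNbhd H (heads G S₀ L₀ (i + 1))) +
        2 * innerDeg H (heads G S₀ L₀ (i + 1)) + S₀.card := by
  refine five_mul_card_le G (heads_subset_succ i) hdeg hGH
    (fun v hv w hvw hw => exists_neighbor_of_adj_of_not_mem hr hH hv hvw hw)
    (fun a w b => a ∈ heads G S₀ L₀ i ∧ ∃ L', IsRot a b w (headList G S₀ L₀ i a) L') ?_ ?_
  · rintro a w b b' ⟨ha, L, h⟩ ⟨-, L', h'⟩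
    exact h.unique (hr.headList_spec i ha).1.1 h'
  · intro b hb hb₀ hbN
    obtain ⟨a, ha, w, h1, h2, h3, h4⟩ := exists_parent hr hH hb hb₀ hbN
    exact ⟨a, ha, w, h1, h2, h3, ha, h4⟩

theorem card_closedNbhd_le_three_mul (hr : IsRootFamily G U M S₀ L₀ F c g p) (h₀ : S₀.Nonempty)
    (hHF : H ⊆ F) (S : Finset V) : (closedNbhd H S).card ≤ 3 * S.card := by
  have h1 := card_closedNbhd_le H S
  have h2 : ∑ v ∈ S, setDeg H v ≤ S.card * 2 := Finset.sum_le_card_nsmul _ _ _ fun v _ =>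
      (setDeg_mono hHF v).trans (hr.setDeg_le_two h₀ v)
  omega

/-- As long as only edges of `G` are removed and the sets are small, every round produces a new
head. -/
theorem heads_card_lt_succ (hr : IsRootFamily G U M S₀ L₀ F c g p) (h₀ : S₀.Nonempty)
    (hdeg : ∀ v, 4 ≤ G.degree v) {i : ℕ}
    (hH : RemovesOnly G U S₀ L₀ F (F ∩ G.edgeSet) (i + 1)) {B : ℝ}
    (hsp : ∀ T : Finset V, (T.card : ℝ) < B → 10 * spannedEdges G T ≤ 11 * T.card + 9)
    (hB : 3 * ((heads G S₀ L₀ (i + 1)).card : ℝ) < B) :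
    (heads G S₀ L₀ i).card < (heads G S₀ L₀ (i + 1)).card := by
  by_contra hcon
  have heq : heads G S₀ L₀ i = heads G S₀ L₀ (i + 1) :=
    Finset.eq_of_subset_of_card_le (heads_subset_succ i) (not_lt.1 hcon)
  have h1 := heads_count hr hdeg hH fun v w hvw hF => ⟨hF, hvw⟩
  have hN := nbhd_subset_closedNbhd G (heads_subset_succ i)
    (fun v hv w hvw hw => exists_neighbor_of_adj_of_not_mem hr hH hv hvw hw)
  have h2 := (eight_mul_card_le G ((heads_subset_succ i).trans
    (by unfold closedNbhd; exact Finset.subset_union_left)) hN hdeg).1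
  have hint := fun v w (hv : v ∈ heads G S₀ L₀ i) (hw : w ∈ heads G S₀ L₀ i) (hvw : G.Adj v w) =>
    exists_neighbor_of_adj_of_mem hr hH hv hvw hw
  have h3 := card_closedNbhd_le (F ∩ G.edgeSet) (heads G S₀ L₀ (i + 1))
  have h4 : 10 * spannedEdges G (closedNbhd (F ∩ G.edgeSet) (heads G S₀ L₀ (i + 1))) ≤
      11 * (closedNbhd (F ∩ G.edgeSet) (heads G S₀ L₀ (i + 1))).card + 9 := by
    refine hsp _ (lt_of_le_of_lt ?_ hB)
    exact_mod_cast card_closedNbhd_le_three_mul hr h₀ Set.inter_subset_left _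
  rw [← heq] at *
  have hS₀ : S₀ ⊆ heads G S₀ L₀ i := heads_mono (Nat.zero_le i)
  have h5 := hr.sum_setDeg_le h₀ (H := F ∩ G.edgeSet) Set.inter_subset_left hS₀
  have h6 := Finset.card_pos.2 h₀
  have h7 := Finset.card_le_card hS₀
  have h8 : innerDeg (F ∩ G.edgeSet) (heads G S₀ L₀ i) = 0 →
      ∑ v ∈ heads G S₀ L₀ i, ((heads G S₀ L₀ i).filter fun w => G.Adj v w).card = 0 := by
    intro h0
    rw [Finset.sum_eq_zero_iff]
    intro v hv
    rw [Finset.card_eq_zero, Finset.filter_eq_empty_iff]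
    intro w hw hvw
    obtain ⟨y, hy, x, hx, hyx⟩ := hint v w hv hw hvw
    exact innerDeg_ne_zero hy hx hyx h0
  have h9 := sum_card_filter_adj_le G (heads G S₀ L₀ i)
  generalize (∑ v ∈ heads G S₀ L₀ i, ((heads G S₀ L₀ i).filter fun w => G.Adj v w).card) = I at *
  generalize innerDeg (F ∩ G.edgeSet) (heads G S₀ L₀ i) = γ at *
  generalize (∑ v ∈ heads G S₀ L₀ i, setDeg (F ∩ G.edgeSet) v) = D at *
  generalize spannedEdges G (closedNbhd (F ∩ G.edgeSet) (heads G S₀ L₀ i)) = E at *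
  generalize (closedNbhd (F ∩ G.edgeSet) (heads G S₀ L₀ i)).card = T at *
  generalize (heads G S₀ L₀ i).card = s at *
  generalize S₀.card = ρ at *
  -- Inserting `T ≤ s + D - γ`, `10E ≤ 11T + 9` and `D ≤ 2s - ρ` into `5s + D ≤ 2E + 2γ + ρ` gives
  -- `2s ≤ 9 - ρ - γ`. The few remaining sizes fall to `8s ≤ 2E + I` and `I ≤ s(s - 1)`.
  have hs : s ≤ 4 := by omega
  have hγ : γ ≠ 0 := fun h => by have := h8 h; omega
  interval_cases s <;> omega

/-- The vertices of the pairs in `U`. -/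
noncomputable def pairVerts (U : Finset (Sym2 V)) : Finset V :=
  Finset.univ.filter fun v => ∃ e ∈ U, v ∈ e

/-- Pairs of `U` form a matching, so at most one real pair at `v` is not an edge of `G`. -/
theorem setDeg_le_add (hr : IsRootFamily G U M S₀ L₀ F c g p) (h₀ : S₀.Nonempty)
    (hU : ∀ v x y, s(v, x) ∈ U → s(v, y) ∈ U → x = y) (v : V) :
    setDeg F v ≤ setDeg (F ∩ G.edgeSet) v + if v ∈ pairVerts U then 1 else 0 := by
  have h1 : (Finset.univ.filter fun x => s(v, x) ∈ F) ⊆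
      (Finset.univ.filter fun x => s(v, x) ∈ F ∩ G.edgeSet) ∪
        Finset.univ.filter fun x => s(v, x) ∈ U := by
    intro x hx
    simp only [Finset.mem_filter, Finset.mem_univ, true_and, Finset.mem_union] at hx ⊢
    obtain ⟨r, hr₀⟩ := h₀
    rcases ((hr.real r hr₀ _).2 hx).2 with h | h
    · exact Or.inl ⟨hx, h⟩
    · exact Or.inr h
  refine (Finset.card_le_card h1).trans ((Finset.card_union_le _ _).trans ?_)
  unfold setDeg
  refine add_le_add (Finset.card_le_card fun x hx => by simpa using hx) ?_
  split_ifs with h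
  · rw [Finset.card_le_one]
    intro x hx y hy
    simp only [Finset.mem_filter, Finset.mem_univ, true_and] at hx hy
    exact hU v x y hx hy
  · rw [Nat.le_zero, Finset.card_eq_zero, Finset.filter_eq_empty_iff]
    intro x _ hx
    exact h (Finset.mem_filter.2 ⟨Finset.mem_univ _, _, hx, Sym2.mem_mk_left _ _⟩)

/-- Large sets of heads grow by a constant factor in every round. -/
theorem heads_card_growth (hr : IsRootFamily G U M S₀ L₀ F c g p) (h₀ : S₀.Nonempty)
    (hdeg : ∀ v, 4 ≤ G.degree v) (hU : ∀ v x y, s(v, x) ∈ U → s(v, y) ∈ U → x = y) {i : ℕ}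
    (hH : RemovesOnly G U S₀ L₀ F F (i + 1)) {B : ℝ}
    (hsp : ∀ S T : Finset V, (T.card : ℝ) < B → S ⊆ T → (∀ v ∈ S, ∀ w, G.Adj v w → w ∈ T) →
      20 * spannedEdges G T + 10 * (S ∩ pairVerts U).card ≤ 23 * T.card + 20)
    (hB : 3 * ((heads G S₀ L₀ (i + 1)).card : ℝ) < B) (h100 : 100 ≤ (heads G S₀ L₀ i).card) :
    101 * (heads G S₀ L₀ i).card ≤ 100 * (heads G S₀ L₀ (i + 1)).card := by
  have h1 := heads_count hr hdeg hH fun v w hvw hF => hF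
  have hN := nbhd_subset_closedNbhd G (heads_subset_succ i)
    (fun v hv w hvw hw => exists_neighbor_of_adj_of_not_mem hr hH hv hvw hw)
  have h3 := card_closedNbhd_le F (heads G S₀ L₀ (i + 1))
  have h4 := hsp (heads G S₀ L₀ i) (closedNbhd F (heads G S₀ L₀ (i + 1)))
    (lt_of_le_of_lt (by exact_mod_cast card_closedNbhd_le_three_mul hr h₀ le_rfl _) hB)
    ((heads_subset_succ i).trans (by unfold closedNbhd; exact Finset.subset_union_left)) hN
  have hS₀ : S₀ ⊆ heads G S₀ L₀ i := heads_mono (Nat.zero_le i)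
  have h5 := hr.sum_setDeg_le h₀ (H := F) le_rfl hS₀
  have h6 := hr.sum_setDeg_le_of_subset h₀ (H := F) le_rfl (heads_subset_succ (G := G) (S₀ := S₀) (L₀ := L₀) i)
  have h7 : ∑ v ∈ heads G S₀ L₀ i, setDeg F v ≤
      ∑ v ∈ heads G S₀ L₀ i, setDeg (F ∩ G.edgeSet) v +
        (heads G S₀ L₀ i ∩ pairVerts U).card := by
    rw [← Finset.filter_mem_eq_inter, Finset.card_filter, ← Finset.sum_add_distrib]
    exact Finset.sum_le_sum fun v _ => setDeg_le_add hr h₀ hU v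
  have h8 := Finset.card_le_card (heads_subset_succ (G := G) (S₀ := S₀) (L₀ := L₀) i)
  -- The ends of pairs of `U` cost in `h7` exactly what they regain in `h4`. For consecutive sizes
  -- `s`, `s'` there remains `70 s ≤ 69 s' + 20`, which suffices once `s ≥ 100`.
  omega

/-- Growing for `J` rounds gives a large set of heads. -/
theorem exists_heads_large (hr : IsRootFamily G U M S₀ L₀ F c g p) (h₀ : S₀.Nonempty)
    (hdeg : ∀ v, 4 ≤ G.degree v) (hU : ∀ v x y, s(v, x) ∈ U → s(v, y) ∈ U → x = y) {J : ℕ}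
    (hreal : ∀ j < J, ∀ v ∈ heads G S₀ L₀ j, ∀ w x L', G.Adj v w →
      IsRot v x w (headList G S₀ L₀ j v) L' → IsReal G U s(x, w))
    (hedge : ∀ j < J, j < 100 → ∀ v ∈ heads G S₀ L₀ j, ∀ w x L', G.Adj v w →
      IsRot v x w (headList G S₀ L₀ j v) L' → s(x, w) ∈ G.edgeSet) {B : ℝ}
    (hsp : ∀ T : Finset V, (T.card : ℝ) < B → 10 * spannedEdges G T ≤ 11 * T.card + 9)
    (hsp' : ∀ S T : Finset V, (T.card : ℝ) < B → S ⊆ T → (∀ v ∈ S, ∀ w, G.Adj v w → w ∈ T) →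
      20 * spannedEdges G T + 10 * (S ∩ pairVerts U).card ≤ 23 * T.card + 20)
    (hJ : (Fintype.card V : ℝ) < 1.01 ^ J * S₀.card) :
    ∃ i ≤ J, B ≤ 3 * ((heads G S₀ L₀ i).card : ℝ) := by
  by_contra! hcon
  -- Up to 100 heads, one new head per round already is one per cent. Having more than `j` heads
  -- after `j` rounds ends this phase before round 100, as `hedge` requires.
  have key : ∀ j ≤ J, (1.01 : ℝ) ^ j * S₀.card ≤ (heads G S₀ L₀ j).card ∧
      (100 ≤ (heads G S₀ L₀ j).card ∨ j < (heads G S₀ L₀ j).card) := by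
    intro j
    induction j with
    | zero => intro _; exact ⟨by simp, Or.inr (Finset.card_pos.2 h₀)⟩
    | succ j ih =>
      intro hj
      obtain ⟨h1, h2⟩ := ih (by omega)
      have hmono := Finset.card_le_card (heads_subset_succ (G := G) (S₀ := S₀) (L₀ := L₀) j)
      have step : (1.01 : ℝ) * (heads G S₀ L₀ j).card ≤ (heads G S₀ L₀ (j + 1)).card ∧
          (100 ≤ (heads G S₀ L₀ j).card ∨
            (heads G S₀ L₀ j).card < (heads G S₀ L₀ (j + 1)).card) := by
        by_cases h100 : 100 ≤ (heads G S₀ L₀ j).card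
        · have := heads_card_growth hr h₀ hdeg hU
            (RemovesOnly.of_real fun k hk => hreal k (by omega)) hsp' (hcon _ hj) h100
          refine ⟨?_, Or.inl h100⟩
          have h : (101 : ℝ) * (heads G S₀ L₀ j).card ≤ 100 * (heads G S₀ L₀ (j + 1)).card := by
            exact_mod_cast this
          linarith
        · have := heads_card_lt_succ hr h₀ hdeg
            (RemovesOnly.of_mem_edgeSet fun k hk => hedge k (by omega) (by omega)) hsp
            (hcon _ hj)
          refine ⟨?_, Or.inr this⟩
          have h3 : ((heads G S₀ L₀ j).card : ℝ) + 1 ≤ (heads G S₀ L₀ (j + 1)).card := by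
            exact_mod_cast this
          have h4 : ((heads G S₀ L₀ j).card : ℝ) ≤ 100 := by
            exact_mod_cast (not_le.1 h100).le
          linarith
      refine ⟨?_, by omega⟩
      rw [pow_succ]
      linarith [step.1]
  have h1 := (key J le_rfl).1
  have h2 : ((heads G S₀ L₀ J).card : ℝ) ≤ Fintype.card V := by
    exact_mod_cast Finset.card_le_univ _
  linarith

end GrowthRate

/-! ### Balls in the graph without the core. -/

/-- The graph `G` without the edges that meet `Z`. -/
def avoiding {V : Type*} (G : SimpleGraph V) (Z : Set V) : SimpleGraph V where
  Adj a b := G.Adj a b ∧ a ∉ Z ∧ b ∉ Z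
  symm := ⟨fun _ _ h => ⟨h.1.symm, h.2.2, h.2.1⟩⟩
  loopless := ⟨fun _ h => h.1.ne rfl⟩

section Ball
variable {V : Type*} [Fintype V]

/-- The vertices that are joined to `v` by a walk of length at most `i`. -/
noncomputable def walkBall (H : SimpleGraph V) (i : ℕ) (v : V) : Finset V :=
  Finset.univ.filter fun w => ∃ p : H.Walk v w, p.length ≤ i

variable {H : SimpleGraph V} {i j : ℕ} {u v w : V}

theorem mem_walkBall : w ∈ walkBall H i v ↔ ∃ p : H.Walk v w, p.length ≤ i := by
  simp [walkBall]

theorem self_mem_walkBall : v ∈ walkBall H i v := mem_walkBall.2 ⟨.nil, Nat.zero_le _⟩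

theorem walkBall_symm (h : w ∈ walkBall H i v) : v ∈ walkBall H i w := by
  obtain ⟨p, hp⟩ := mem_walkBall.1 h
  exact mem_walkBall.2 ⟨p.reverse, by simpa using hp⟩

theorem walkBall_trans (h : v ∈ walkBall H i u) (h' : w ∈ walkBall H j v) :
    w ∈ walkBall H (i + j) u := by
  obtain ⟨p, hp⟩ := mem_walkBall.1 h
  obtain ⟨q, hq⟩ := mem_walkBall.1 h'
  exact mem_walkBall.2 ⟨p.append q, by rw [SimpleGraph.Walk.length_append]; omega⟩

theorem walkBall_mono {H' : SimpleGraph V} (h : H ≤ H') : walkBall H i v ⊆ walkBall H' i v := by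
  intro w hw
  obtain ⟨p, hp⟩ := mem_walkBall.1 hw
  exact mem_walkBall.2 ⟨p.mapLe h, by simpa using hp⟩

theorem mem_walkBall_succ : w ∈ walkBall H (i + 1) v ↔
    w ∈ walkBall H i v ∨ ∃ x ∈ walkBall H i v, H.Adj x w := by
  constructor
  · intro h
    obtain ⟨p, hp⟩ := mem_walkBall.1 (walkBall_symm h)
    cases p with
    | nil => exact Or.inl self_mem_walkBall
    | @cons _ x _ hx p =>
      rw [SimpleGraph.Walk.length_cons] at hp
      exact Or.inr ⟨x, walkBall_symm (mem_walkBall.2 ⟨p, by omega⟩), hx.symm⟩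
  · rintro (h | ⟨x, h, hx⟩)
    · obtain ⟨p, hp⟩ := mem_walkBall.1 h
      exact mem_walkBall.2 ⟨p, by omega⟩
    · exact walkBall_trans h (mem_walkBall.2 ⟨.cons hx .nil, by simp⟩)

/-- Each step adds a vertex until the ball is a whole component. -/
theorem walkBall_large_or_closed (H : SimpleGraph V) (i : ℕ) (v : V) :
    i + 1 ≤ (walkBall H i v).card ∨
      ∀ x ∈ walkBall H i v, ∀ w, H.Adj x w → w ∈ walkBall H i v := by
  induction i with
  | zero => exact Or.inl (Finset.card_pos.2 ⟨v, self_mem_walkBall⟩)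
  | succ i ih =>
    have hsub : walkBall H i v ⊆ walkBall H (i + 1) v := fun x hx => mem_walkBall_succ.2 (Or.inl hx)
    by_cases hc : ∀ x ∈ walkBall H i v, ∀ w, H.Adj x w → w ∈ walkBall H i v
    · have heq : walkBall H (i + 1) v = walkBall H i v := by
        refine Finset.Subset.antisymm (fun x hx => ?_) hsub
        rcases mem_walkBall_succ.1 hx with h | ⟨y, hy, hyx⟩
        · exact h
        · exact hc y hy x hyx
      rw [heq]; exact Or.inr hc
    · have h1 := ih.resolve_right hc
      push Not at hc
      obtain ⟨x, hx, w, hxw, hw⟩ := hc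
      have : walkBall H i v ⊂ walkBall H (i + 1) v :=
        Finset.ssubset_iff_subset_ne.2 ⟨hsub, fun h => hw (h ▸ mem_walkBall_succ.2
          (Or.inr ⟨x, hx, hxw⟩))⟩
      have := Finset.card_lt_card this
      exact Or.inl (by omega)

theorem card_walkBall_le {K : ℕ} (hK : ∀ v, H.degree v ≤ K) (i : ℕ) (v : V) :
    (walkBall H i v).card ≤ (K + 1) ^ i := by
  induction i with
  | zero =>
    rw [pow_zero, Finset.card_le_one]
    have : ∀ a ∈ walkBall H 0 v, v = a := by
      intro a ha
      obtain ⟨p, hp⟩ := mem_walkBall.1 ha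
      exact SimpleGraph.Walk.eq_of_length_eq_zero (Nat.le_zero.1 hp)
    intro a ha b hb
    rw [← this a ha, ← this b hb]
  | succ i ih =>
    have hsub : walkBall H (i + 1) v ⊆
        (walkBall H i v).biUnion fun x => insert x (H.neighborFinset x) := by
      intro w hw
      rw [Finset.mem_biUnion]
      rcases mem_walkBall_succ.1 hw with h | ⟨y, hy, hyx⟩
      · exact ⟨w, h, Finset.mem_insert_self _ _⟩
      · exact ⟨y, hy, Finset.mem_insert_of_mem (by simpa using hyx)⟩
    calc _ ≤ _ := Finset.card_le_card hsub
      _ ≤ (walkBall H i v).card * (K + 1) := by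
        refine Finset.card_biUnion_le_card_mul _ _ _ fun x _ => ?_
        refine (Finset.card_insert_le _ _).trans ?_
        rw [SimpleGraph.card_neighborFinset_eq_degree]
        exact Nat.succ_le_succ (hK x)
      _ ≤ _ := by rw [pow_succ]; exact Nat.mul_le_mul_right _ ih

end Ball

/-! ### The core and separated pairs. -/

section Core
variable {V : Type*} [Fintype V] {G : SimpleGraph V}

/-- The number of edges inside `T` that meet `A`. -/
noncomputable def touchingEdges (G : SimpleGraph V) (A T : Finset V) : ℕ :=
  (G.edgeFinset.filter fun e => (∀ v ∈ e, v ∈ T) ∧ ∃ v ∈ e, v ∈ A).card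

theorem spannedEdges_le_add (G : SimpleGraph V) (A T : Finset V) :
    spannedEdges G T ≤ spannedEdges G (T \ A) + touchingEdges G A T := by
  refine le_trans (Finset.card_le_card ?_) (Finset.card_union_le _ _)
  intro e he
  simp only [Finset.mem_filter, Finset.mem_union, Finset.mem_sdiff] at he ⊢
  by_cases h : ∃ v ∈ e, v ∈ A
  · exact Or.inr ⟨he.1, he.2, h⟩
  · push Not at h
    exact Or.inl ⟨he.1, fun v hv => ⟨he.2 v hv, h v hv⟩⟩

theorem spannedEdges_union (G : SimpleGraph V) {Z A : Finset V} (h : Disjoint Z A) :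
    spannedEdges G (Z ∪ A) = spannedEdges G Z + touchingEdges G A (Z ∪ A) := by
  unfold spannedEdges touchingEdges
  rw [← Finset.card_union_of_disjoint]
  · congr 1
    ext e
    simp only [Finset.mem_filter, Finset.mem_union]
    constructor
    · rintro ⟨h1, h2⟩
      by_cases h3 : ∃ v ∈ e, v ∈ A
      · exact Or.inr ⟨h1, h2, h3⟩
      · push Not at h3
        exact Or.inl ⟨h1, fun v hv => (h2 v hv).resolve_right (h3 v hv)⟩
    · rintro (⟨h1, h2⟩ | ⟨h1, h2, -⟩)
      · exact ⟨h1, fun v hv => Or.inl (h2 v hv)⟩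
      · exact ⟨h1, h2⟩
  · rw [Finset.disjoint_left]
    intro e he he'
    simp only [Finset.mem_filter] at he he'
    obtain ⟨-, -, v, hv, hvA⟩ := he'
    exact Finset.disjoint_left.1 h (he.2 v hv) hvA

/-- `Z` contains all vertices of degree larger than `K`, and sets outside `Z` send few edges to
themselves and to `Z`. -/
structure IsCore (G : SimpleGraph V) (Z : Finset V) (K : ℕ) (B : ℝ) : Prop where
  degree_le : ∀ v, v ∉ Z → G.degree v ≤ K
  touching_le : ∀ A, Disjoint Z A → (Z.card + A.card : ℝ) < B →
    100 * touchingEdges G A (Z ∪ A) ≤ 111 * A.card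

/-- `Z` maximises `100 e(Z) - 111 |Z|` over the sets of size below `B` containing `D`. Adding `A`
cannot increase this value, which bounds the edges touching `A`; comparison with `D`, using density
1.1 for `Z`, bounds `Z.card`. -/
theorem exists_isCore {K : ℕ} {B : ℝ}
    (hsp : ∀ T : Finset V, (T.card : ℝ) < B → 10 * spannedEdges G T ≤ 11 * T.card + 9)
    {D : Finset V} (hD : ∀ v, v ∉ D → G.degree v ≤ K) (hDB : (D.card : ℝ) < B) :
    ∃ Z, IsCore G Z K B ∧ Z.card ≤ 90 + 111 * D.card := by
  obtain ⟨Z, hZ, hmax⟩ := Finset.exists_max_image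
    (Finset.univ.filter fun Z : Finset V => D ⊆ Z ∧ (Z.card : ℝ) < B)
    (fun Z => (100 * spannedEdges G Z : ℤ) - 111 * Z.card) ⟨D, by simp [hDB]⟩
  simp only [Finset.mem_filter, Finset.mem_univ, true_and] at hZ hmax
  refine ⟨Z, ⟨fun v hv => hD v fun h => hv (hZ.1 h), fun A hA hAB => ?_⟩, ?_⟩
  · have h1 := hmax (Z ∪ A) ⟨hZ.1.trans Finset.subset_union_left, by
      rw [Finset.card_union_of_disjoint hA]; exact_mod_cast hAB⟩
    rw [spannedEdges_union G hA, Finset.card_union_of_disjoint hA] at h1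
    push_cast at h1
    omega
  · have h1 := hmax D ⟨le_rfl, hDB⟩
    have h2 := hsp Z hZ.2
    omega

variable {Z : Finset V} {K : ℕ} {B : ℝ}

theorem IsCore.degree_avoiding_le (h : IsCore G Z K B) (v : V) :
    (avoiding G (Z : Set V)).degree v ≤ K := by
  by_cases hv : v ∈ Z
  · have : (avoiding G (Z : Set V)).degree v = 0 := by
      rw [← SimpleGraph.card_neighborFinset_eq_degree, Finset.card_eq_zero]
      ext w
      rw [SimpleGraph.mem_neighborFinset]
      simp [avoiding, hv]
    omega
  · refine le_trans ?_ (h.degree_le v hv)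
    exact SimpleGraph.degree_le_of_le (fun a b hab => hab.1)

/-- The pairs in `U` form a matching of non-edges of `G`, and their ends are outside `Z` and far
from each other. -/
structure IsSeparated (G : SimpleGraph V) (Z : Finset V) (U : Finset (Sym2 V)) : Prop where
  not_mem_edgeSet : ∀ e ∈ U, e ∉ G.edgeSet
  unique : ∀ v x y, s(v, x) ∈ U → s(v, y) ∈ U → x = y
  not_mem : ∀ v ∈ pairVerts U, v ∉ Z
  disjoint : ∀ v ∈ pairVerts U, ∀ w ∈ pairVerts U, v ≠ w →
    Disjoint (walkBall (avoiding G (Z : Set V)) 9 v) (walkBall (avoiding G (Z : Set V)) 9 w)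

theorem touchingEdges_mono (G : SimpleGraph V) {A T T' : Finset V}
    (h : ∀ v ∈ A, ∀ w, G.Adj v w → w ∈ T → w ∈ T') (hA : A ⊆ T') :
    touchingEdges G A T ≤ touchingEdges G A T' := by
  refine Finset.card_le_card fun e he => ?_
  simp only [Finset.mem_filter] at he ⊢
  obtain ⟨h1, h2, v, hv, hvA⟩ := he
  obtain ⟨w, rfl⟩ := hv
  refine ⟨h1, ?_, v, Sym2.mem_mk_left _ _, hvA⟩
  intro x hx
  rcases Sym2.mem_iff.1 hx with rfl | rfl
  · exact hA hvA
  · exact h v hvA _ (by simpa using h1) (h2 _ (Sym2.mem_mk_right _ _))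

theorem degree_le_touchingEdges (G : SimpleGraph V) {A T : Finset V} {y : V} (hy : y ∈ A)
    (hyT : y ∈ T) (h : ∀ w, G.Adj y w → w ∈ T) : G.degree y ≤ touchingEdges G A T := by
  rw [← SimpleGraph.card_incidenceFinset_eq_degree]
  refine Finset.card_le_card fun e he => ?_
  rw [SimpleGraph.mem_incidenceFinset] at he
  obtain ⟨h1, h2⟩ := he
  obtain ⟨w, rfl⟩ := h2
  simp only [Finset.mem_filter, SimpleGraph.mem_edgeFinset]
  refine ⟨h1, ?_, y, Sym2.mem_mk_left _ _, hy⟩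
  intro x hx
  rcases Sym2.mem_iff.1 hx with rfl | rfl
  · exact hyT
  · exact h _ h1

theorem touchingEdges_biUnion_le {ι : Type*} (G : SimpleGraph V) (I : Finset ι)
    (A : ι → Finset V) (T : Finset V) :
    touchingEdges G (I.biUnion A) T ≤ ∑ i ∈ I, touchingEdges G (A i) T := by
  refine le_trans (Finset.card_le_card ?_) Finset.card_biUnion_le
  intro e he
  simp only [Finset.mem_filter, Finset.mem_biUnion] at he ⊢
  obtain ⟨h1, h2, v, hv, i, hi, hvi⟩ := he
  exact ⟨i, hi, h1, h2, v, hv, hvi⟩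

/-- Sets that contain the neighbourhoods of many ends of pairs in `U` span fewer edges. -/
theorem IsSeparated.spread {U : Finset (Sym2 V)} (hU : IsSeparated G Z U) (hZ : IsCore G Z K B)
    (hdeg : ∀ v, 4 ≤ G.degree v)
    (hsp : ∀ T : Finset V, (T.card : ℝ) < B → 10 * spannedEdges G T ≤ 11 * T.card + 9)
    {S T : Finset V} (hT : (Z.card + T.card : ℝ) < B) (hST : S ⊆ T)
    (hN : ∀ v ∈ S, ∀ w, G.Adj v w → w ∈ T) :
    20 * spannedEdges G T + 10 * (S ∩ pairVerts U).card ≤ 23 * T.card + 20 := by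
  let H := avoiding G ((Z : Set V) ∪ (T : Set V)ᶜ)
  have hH : H ≤ avoiding G (Z : Set V) := fun a b h =>
    ⟨h.1, fun h' => h.2.1 (Or.inl h'), fun h' => h.2.2 (Or.inl h')⟩
  let A : V → Finset V := walkBall H 9
  let Y := S ∩ pairVerts U
  have hYT : ∀ y ∈ Y, y ∈ T ∧ y ∉ Z := fun y hy =>
    ⟨hST (Finset.mem_inter.1 hy).1, hU.not_mem y (Finset.mem_inter.1 hy).2⟩
  have hA : ∀ y ∈ Y, ∀ x ∈ A y, x ∈ T ∧ x ∉ Z := by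
    intro y hy x hx
    have hx' := mem_walkBall.1 (walkBall_symm hx)
    obtain ⟨p, -⟩ := hx'
    cases p with
    | nil => exact hYT _ hy
    | cons h p =>
      have := h.2.1
      simp only [Set.mem_union, Finset.mem_coe, Set.mem_compl_iff, not_or, not_not] at this
      exact ⟨this.2, this.1⟩
  have hdisj : ∀ y ∈ Y, ∀ z ∈ Y, y ≠ z → Disjoint (A y) (A z) := fun y hy z hz hyz =>
    (hU.disjoint y (Finset.mem_inter.1 hy).2 z (Finset.mem_inter.1 hz).2 hyz).mono
      (walkBall_mono hH) (walkBall_mono hH)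
  -- A ball with at least ten vertices pays for its centre out of the slack between 22 and 23 per
  -- vertex. A smaller ball is a whole component of `T` outside `Z`, where the core condition
  -- applies.
  let Y₁ := Y.filter fun y => (A y).card ≤ 9
  let Y₂ := Y.filter fun y => ¬ (A y).card ≤ 9
  have hY : Y₁.card + Y₂.card = Y.card := Finset.card_filter_add_card_filter_not _
  have hsub₁ : Y₁.biUnion A ⊆ T := by
    intro x hx
    obtain ⟨y, hy, hx⟩ := Finset.mem_biUnion.1 hx
    exact (hA y (Finset.mem_filter.1 hy).1 x hx).1
  have hcard₁ : (Y₁.biUnion A).card = ∑ y ∈ Y₁, (A y).card :=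
    Finset.card_biUnion fun y hy z hz hyz =>
      hdisj y (Finset.mem_filter.1 hy).1 z (Finset.mem_filter.1 hz).1 hyz
  have hcard₂ : 10 * Y₂.card ≤ (T \ Y₁.biUnion A).card := by
    have h1 : (Y₂.biUnion A).card = ∑ y ∈ Y₂, (A y).card :=
      Finset.card_biUnion fun y hy z hz hyz =>
        hdisj y (Finset.mem_filter.1 hy).1 z (Finset.mem_filter.1 hz).1 hyz
    have h2 : Y₂.card * 10 ≤ ∑ y ∈ Y₂, (A y).card :=
      Finset.card_nsmul_le_sum Y₂ (fun y => (A y).card) 10 fun y hy => by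
        have : ¬ (A y).card ≤ 9 := (Finset.mem_filter.1 hy).2
        omega
    have h3 : Y₂.biUnion A ⊆ T \ Y₁.biUnion A := by
      intro x hx
      obtain ⟨y, hy, hx⟩ := Finset.mem_biUnion.1 hx
      obtain ⟨hy1, hy2⟩ := Finset.mem_filter.1 hy
      refine Finset.mem_sdiff.2 ⟨(hA y hy1 x hx).1, fun hx' => ?_⟩
      obtain ⟨z, hz, hxz⟩ := Finset.mem_biUnion.1 hx'
      obtain ⟨hz1, hz2⟩ := Finset.mem_filter.1 hz
      have hyz : y ≠ z := by rintro rfl; exact hy2 hz2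
      exact Finset.disjoint_left.1 (hdisj y hy1 z hz1 hyz) hx hxz
    have := Finset.card_le_card h3
    omega
  have htouch : ∀ y ∈ Y₁, 20 * touchingEdges G (A y) T + 10 ≤ 23 * (A y).card := by
    intro y hy
    obtain ⟨hy1, hy2⟩ := Finset.mem_filter.1 hy
    have hclosed := (walkBall_large_or_closed H 9 y).resolve_left (fun h => by
      change 9 + 1 ≤ (A y).card at h; omega)
    have h1 : touchingEdges G (A y) T ≤ touchingEdges G (A y) (Z ∪ A y) := by
      refine touchingEdges_mono G (fun v hv w hvw hw => ?_) Finset.subset_union_right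
      by_cases hwZ : w ∈ Z
      · exact Finset.mem_union_left _ hwZ
      · obtain ⟨hvT, hvZ⟩ := hA y hy1 v hv
        exact Finset.mem_union_right _ (hclosed v hv w ⟨hvw, by simp [hvT, hvZ], by simp [hw, hwZ]⟩)
    have hAT : A y ⊆ T := fun x hx => (hA y hy1 x hx).1
    have h2 := hZ.touching_le (A y) (Finset.disjoint_left.2 fun x hx hx' => (hA y hy1 x hx').2 hx)
      (lt_of_le_of_lt (by have := Finset.card_le_card hAT; gcongr) hT)
    have h3 := degree_le_touchingEdges G (A := A y) self_mem_walkBall (hYT y hy1).1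
      (hN y (Finset.mem_inter.1 hy1).1)
    have h4 := hdeg y
    -- For at most nine vertices the ratio 1.11 becomes 1 by integrality. As `y` has degree at least
    -- 4, the ball then has at least 4 vertices, which yields the required `10 ≤ 3 * (A y).card`.
    have h5 : touchingEdges G (A y) (Z ∪ A y) ≤ (A y).card := by omega
    omega
  have h1 := spannedEdges_le_add G (Y₁.biUnion A) T
  have h2 := touchingEdges_biUnion_le G Y₁ A T
  have h3 : 20 * (∑ y ∈ Y₁, touchingEdges G (A y) T) + 10 * Y₁.card ≤
      23 * ∑ y ∈ Y₁, (A y).card := by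
    rw [Finset.mul_sum, Finset.mul_sum, mul_comm 10, ← smul_eq_mul Y₁.card, ← Finset.sum_const,
      ← Finset.sum_add_distrib]
    exact Finset.sum_le_sum htouch
  have h4 : (Y₁.biUnion A).card + (T \ Y₁.biUnion A).card = T.card := by
    rw [add_comm]; exact Finset.card_sdiff_add_card_eq_card hsub₁
  have h5 := hsp (T \ Y₁.biUnion A) (lt_of_le_of_lt (by
    have := Finset.card_le_card (Finset.sdiff_subset (s := T) (t := Y₁.biUnion A))
    have h : (((T \ Y₁.biUnion A).card : ℕ) : ℝ) ≤ T.card := by exact_mod_cast this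
    have : (0 : ℝ) ≤ Z.card := Nat.cast_nonneg _
    linarith) hT)
  change 20 * spannedEdges G T + 10 * Y.card ≤ 23 * T.card + 20
  omega

/-- The vertices in `Z` or close to `W`. -/
noncomputable def nearby (G : SimpleGraph V) (Z W : Finset V) : Finset V :=
  Z ∪ W.biUnion (walkBall (avoiding G (Z : Set V)) 18)

theorem IsCore.card_nearby_le (h : IsCore G Z K B) (W : Finset V) :
    (nearby G Z W).card ≤ Z.card + W.card * (K + 1) ^ 18 :=
  (Finset.card_union_le _ _).trans (Nat.add_le_add_left
    (Finset.card_biUnion_le_card_mul _ _ _ fun v _ =>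
      card_walkBall_le h.degree_avoiding_le 18 v) _)

theorem pairVerts_insert (u v : V) (U : Finset (Sym2 V)) :
    pairVerts (insert s(u, v) U) = insert u (insert v (pairVerts U)) := by
  ext x
  simp only [pairVerts, Finset.mem_filter, Finset.mem_univ, true_and, Finset.mem_insert,
    exists_eq_or_imp, Sym2.mem_iff]
  tauto

theorem card_pairVerts_le (U : Finset (Sym2 V)) : (pairVerts U).card ≤ 2 * U.card := by
  have h : pairVerts U ⊆ U.biUnion fun e => e.toFinset := by
    intro v hv
    simp only [pairVerts, Finset.mem_filter, Finset.mem_univ, true_and] at hv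
    obtain ⟨e, he, hve⟩ := hv
    exact Finset.mem_biUnion.2 ⟨e, he, by simpa using hve⟩
  refine (Finset.card_le_card h).trans ?_
  rw [mul_comm]
  refine Finset.card_biUnion_le_card_mul _ _ _ fun e _ => ?_
  by_cases hd : e.IsDiag
  · rw [Sym2.card_toFinset_of_isDiag _ hd]; omega
  · rw [Sym2.card_toFinset_of_not_isDiag _ hd]

/-- The radius 18 in `nearby` is twice 9: a common point of two balls of radius 9 would join their
centres by a walk of length 18. -/
theorem IsSeparated.insert {U : Finset (Sym2 V)} (hU : IsSeparated G Z U) {u v : V}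
    (hu : u ∉ nearby G Z (pairVerts U)) (hv : v ∉ nearby G Z (insert u (pairVerts U)))
    (huv : ¬ G.Adj u v) : IsSeparated G Z (insert s(u, v) U) := by
  simp only [nearby, Finset.mem_union, not_or, Finset.mem_biUnion, not_exists, not_and] at hu hv
  have huv' : v ≠ u := by
    rintro rfl
    exact hv.2 v (Finset.mem_insert_self _ _) self_mem_walkBall
  have huU : u ∉ pairVerts U := fun h => hu.2 u h self_mem_walkBall
  have hvU : v ∉ pairVerts U := fun h =>
    hv.2 v (Finset.mem_insert_of_mem h) self_mem_walkBall
  have hmem : ∀ x y, s(x, y) ∈ U → x ∈ pairVerts U := fun x y h =>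
    Finset.mem_filter.2 ⟨Finset.mem_univ _, _, h, Sym2.mem_mk_left _ _⟩
  have hd : ∀ a b, b ∉ walkBall (avoiding G (Z : Set V)) 18 a →
      Disjoint (walkBall (avoiding G (Z : Set V)) 9 a)
        (walkBall (avoiding G (Z : Set V)) 9 b) := by
    intro a b hab
    rw [Finset.disjoint_left]
    intro x hx hx'
    exact hab (walkBall_trans hx (walkBall_symm hx'))
  refine ⟨?_, ?_, ?_, ?_⟩
  · intro e he
    rcases Finset.mem_insert.1 he with rfl | he
    · exact huv
    · exact hU.not_mem_edgeSet e he
  · intro a x y hx hy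
    rcases Finset.mem_insert.1 hx with hx | hx <;> rcases Finset.mem_insert.1 hy with hy | hy
    · rw [← hy, Sym2.congr_right] at hx; exact hx
    · have := hmem _ _ hy
      rw [Sym2.eq_iff] at hx
      rcases hx with ⟨rfl, _⟩ | ⟨rfl, _⟩ <;> contradiction
    · have := hmem _ _ hx
      rw [Sym2.eq_iff] at hy
      rcases hy with ⟨rfl, _⟩ | ⟨rfl, _⟩ <;> contradiction
    · exact hU.unique a x y hx hy
  · rw [pairVerts_insert]
    intro x hx
    rcases Finset.mem_insert.1 hx with rfl | hx
    · exact hu.1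
    rcases Finset.mem_insert.1 hx with rfl | hx
    · exact hv.1
    · exact hU.not_mem x hx
  · rw [pairVerts_insert]
    intro x hx y hy hxy
    simp only [Finset.mem_insert] at hx hy
    rcases hx with rfl | rfl | hx <;> rcases hy with rfl | rfl | hy
    · exact absurd rfl hxy
    · exact hd _ _ (hv.2 _ (Finset.mem_insert_self _ _))
    · exact (hd _ _ (hu.2 _ hy)).symm
    · exact (hd _ _ (hv.2 _ (Finset.mem_insert_self _ _))).symm
    · exact absurd rfl hxy
    · exact (hd _ _ (hv.2 _ (Finset.mem_insert_of_mem hy))).symm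
    · exact hd _ _ (hu.2 _ hx)
    · exact hd _ _ (hv.2 _ (Finset.mem_insert_of_mem hx))
    · exact hU.disjoint x hx y hy hxy

/-- Few vertices have large degree if small sets are incident to few edges. -/
theorem card_large_degree_le {K : ℕ} {b I : ℝ}
    (hinc : ∀ S : Finset V, (S.card : ℝ) < b → (incidentEdges G S : ℝ) < I)
    (hI : 0 ≤ I) (hKb : 2 * I + K < b * K) :
    ((Finset.univ.filter fun v => K < G.degree v).card : ℝ) * K ≤ 2 * I := by
  by_contra! hcon
  have hK0 : (0 : ℝ) < K := by
    by_contra h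
    have h' : (K : ℝ) = 0 := le_antisymm (not_lt.1 h) (Nat.cast_nonneg _)
    rw [h'] at hcon; linarith
  have hdm : 2 * I / K < (⌊2 * I / K⌋₊ + 1 : ℕ) := by push_cast; exact Nat.lt_floor_add_one _
  -- Just over `2 * I / K` vertices of large degree give a contradiction, and `hKb` keeps this
  -- number below `b`.
  obtain ⟨S, hS, hSc⟩ := Finset.exists_subset_card_eq (s := Finset.univ.filter fun v =>
    K < G.degree v) (n := ⌊2 * I / K⌋₊ + 1) (by
      rw [Nat.succ_le_iff, Nat.floor_lt (by positivity), div_lt_iff₀ hK0]; exact hcon)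
  have h1 : (S.card : ℝ) < b := by
    rw [hSc]; push_cast
    have := Nat.floor_le (show 0 ≤ 2 * I / K by positivity)
    have h2 : 2 * I / K + 1 < b := by
      rw [← mul_lt_mul_iff_of_pos_right hK0]; field_simp; linarith
    linarith
  have h2 := hinc S h1
  have h3 : ∑ v ∈ S, G.degree v ≤ 2 * incidentEdges G S := by
    have : ∀ v ∈ S, G.degree v = ((G.edgeFinset.filter fun e => ∃ v ∈ e, v ∈ S).filter
        fun e => v ∈ e).card := by
      intro v hv
      rw [← SimpleGraph.card_incidenceFinset_eq_degree]
      congr 1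
      ext e
      simp only [SimpleGraph.mem_incidenceFinset, Finset.mem_filter,
        SimpleGraph.mem_edgeFinset, SimpleGraph.incidenceSet, Set.mem_ofPred_eq]
      exact ⟨fun h => ⟨⟨h.1, v, h.2, hv⟩, h.2⟩, fun h => ⟨h.1.1, h.2⟩⟩
    rw [Finset.sum_congr rfl this]
    have hb := Finset.sum_card_bipartiteAbove_eq_sum_card_bipartiteBelow (s := S)
      (t := G.edgeFinset.filter fun e => ∃ v ∈ e, v ∈ S) (fun v e => v ∈ e)
    unfold Finset.bipartiteAbove Finset.bipartiteBelow at hb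
    rw [hb, mul_comm]
    refine Finset.sum_le_card_nsmul _ _ _ fun e _ => ?_
    calc _ ≤ e.toFinset.card := Finset.card_le_card fun v hv => by
            simpa using (Finset.mem_filter.1 hv).2
      _ ≤ 2 := by
        by_cases hd : e.IsDiag
        · rw [Sym2.card_toFinset_of_isDiag _ hd]; omega
        · rw [Sym2.card_toFinset_of_not_isDiag _ hd]
  have h4 : S.card * K ≤ ∑ v ∈ S, G.degree v := Finset.card_nsmul_le_sum _ _ _ fun v hv =>
    (Finset.mem_filter.1 (hS hv)).2.le
  have h5 : (S.card : ℝ) * K ≤ 2 * incidentEdges G S := by exact_mod_cast h4.trans h3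
  rw [hSc] at h5
  rw [div_lt_iff₀ hK0] at hdm
  linarith

end Core

/-! ### Rearranging an ordering at its gaps. -/

section Cut
variable {V : Type*} {G : SimpleGraph V} {U M : Finset (Sym2 V)}

theorem consec_append {A B : List V} {x y : V} (hx : A.getLast? = some x)
    (hy : B.head? = some y) : consec (A ++ B) = consec A ++ s(x, y) :: consec B := by
  obtain ⟨A', rfl⟩ := List.getLast?_eq_some_iff.1 hx
  obtain ⟨B', rfl⟩ := List.head?_eq_some_iff.1 hy
  exact consec_append_pair A' x y B'

variable (G U) in
/-- The second elements of the gaps of a list. -/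
noncomputable def gapHeads : List V → List V
  | a :: b :: l => if IsReal G U s(a, b) then gapHeads (b :: l) else b :: gapHeads (b :: l)
  | _ => []

theorem gapHeads_sublist (a : V) (l : List V) : (gapHeads G U (a :: l)).Sublist l := by
  induction l generalizing a with
  | nil => simp [gapHeads]
  | cons b l ih =>
    rw [gapHeads]
    split_ifs
    · exact (ih b).cons b
    · exact (ih b).cons_cons b

theorem length_gapHeads (L : List V) : (gapHeads G U L).length = gaps G U L := by
  induction L with
  | nil => simp [gapHeads, gaps]
  | cons a l ih =>
    cases l with
    | nil => simp [gapHeads, gaps]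
    | cons b l =>
      unfold gaps at *
      rw [gapHeads, consec_cons_cons, List.countP_cons]
      split_ifs with h1 h2 <;> simp_all

theorem exists_split_of_mem_gapHeads {L : List V} {y : V} (h : y ∈ gapHeads G U L) :
    ∃ A B x, L = A ++ B ∧ A.getLast? = some x ∧ B.head? = some y ∧ ¬ IsReal G U s(x, y) := by
  induction L with
  | nil => simp [gapHeads] at h
  | cons a l ih =>
    cases l with
    | nil => simp [gapHeads] at h
    | cons b l =>
      rw [gapHeads] at h
      have key : y ∈ gapHeads G U (b :: l) → ∃ A B x, a :: b :: l = A ++ B ∧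
          A.getLast? = some x ∧ B.head? = some y ∧ ¬ IsReal G U s(x, y) := by
        intro h
        obtain ⟨A, B, x, h1, h2, h3⟩ := ih h
        exact ⟨a :: A, B, x, by rw [h1]; rfl, by simp [List.getLast?_cons, h2], h3⟩
      split_ifs at h with hr
      · exact key h
      · rcases List.mem_cons.1 h with rfl | h
        · exact ⟨[a], y :: l, a, rfl, rfl, rfl, hr⟩
        · exact key h

theorem exists_split_last_gap {L : List V} (h : gaps G U L ≠ 0) :
    ∃ A B x y, L = A ++ B ∧ A.getLast? = some x ∧ B.head? = some y ∧ ¬ IsReal G U s(x, y) ∧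
      gaps G U L = gaps G U A + 1 := by
  induction L with
  | nil => simp [gaps] at h
  | cons a l ih =>
    cases l with
    | nil => simp [gaps] at h
    | cons b l =>
      by_cases h0 : gaps G U (b :: l) = 0
      · have hc : gaps G U (a :: b :: l) = gaps G U (b :: l) +
            if ¬ IsReal G U s(a, b) then 1 else 0 := by
          unfold gaps; rw [consec_cons_cons, List.countP_cons]; simp
        refine ⟨[a], b :: l, a, b, rfl, rfl, rfl, fun hr => h ?_, ?_⟩
        · rw [hc, h0]; simp [hr]
        · have : gaps G U [a] = 0 := by simp [gaps]
          rw [hc, h0] at h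
          rw [hc, h0, this]
          split_ifs at h ⊢ <;> simp_all
      · obtain ⟨A, B, x, y, h1, h2, h3, h4, h5⟩ := ih h0
        refine ⟨a :: A, B, x, y, by rw [h1]; rfl, by simp [List.getLast?_cons, h2], h3, h4, ?_⟩
        obtain ⟨A', rfl⟩ : ∃ A', A = b :: A' := by
          cases A with
          | nil => simp at h2
          | cons c A => simp at h1; exact ⟨A, by rw [h1.1]⟩
        unfold gaps at *
        rw [consec_cons_cons, List.countP_cons, h5, consec_cons_cons, List.countP_cons]
        omega

theorem pairCost_of_not_isReal {e : Sym2 V} (h : ¬ IsReal G U e) : pairCost G U e = 2 := by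
  unfold IsReal at h; push Not at h
  unfold pairCost; rw [if_neg h.1, if_neg h.2]

theorem pairCost_le_two (e : Sym2 V) : pairCost G U e ≤ 2 := by
  unfold pairCost; split_ifs <;> omega

section Swap
variable {L L' : List V} {R : List (Sym2 V)} {r₁ r₂ a₁ a₂ : Sym2 V}

/-- Replacing two gaps does not increase the cost, and keeps the real pairs if the number of gaps
stays the same. -/
theorem swap_two (hMG : ∀ e ∈ M, e ∈ G.edgeSet) (h : (consec L).Perm (r₁ :: r₂ :: R))
    (h' : (consec L').Perm (a₁ :: a₂ :: R)) (h₁ : ¬ IsReal G U r₁) (h₂ : ¬ IsReal G U r₂) :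
    listCost G U L' ≤ listCost G U L ∧ gaps G U L' ≤ gaps G U L ∧
      penalty G U M L' ≤ penalty G U M L ∧ (gaps G U L ≤ gaps G U L' →
        ∀ e, (e ∈ consec L' ∧ IsReal G U e ↔ e ∈ consec L ∧ IsReal G U e)) := by
  have c1 : listCost G U L = _ := (h.map (pairCost G U)).sum_eq
  have c2 : listCost G U L' = _ := (h'.map (pairCost G U)).sum_eq
  have g1 : gaps G U L = _ := h.countP_eq _
  have g2 : gaps G U L' = _ := h'.countP_eq _
  have l1 : listLoss M L = _ := h.countP_eq _
  have l2 : listLoss M L' = _ := h'.countP_eq _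
  have m₁ : r₁ ∉ M := fun h => h₁ (Or.inl (hMG _ h))
  have m₂ : r₂ ∉ M := fun h => h₂ (Or.inl (hMG _ h))
  simp only [List.map_cons, List.sum_cons, pairCost_of_not_isReal h₁,
    pairCost_of_not_isReal h₂] at c1 c2
  simp only [List.countP_cons, h₁, h₂, m₁, m₂, not_false_eq_true, decide_true, if_true]
    at g1 g2 l1 l2
  have p1 := pairCost_le_two (G := G) (U := U) a₁
  have p2 := pairCost_le_two (G := G) (U := U) a₂
  have hc : listCost G U L' ≤ listCost G U L := by omega
  refine ⟨hc, ?_, ?_, ?_⟩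
  · rw [g1, g2]; split_ifs <;> omega
  · have : listLoss M L' ≤ listLoss M L := by rw [l1, l2]; split_ifs <;> omega
    unfold penalty; omega
  · intro hg e
    rw [g1, g2] at hg
    have n₁ : ¬ IsReal G U a₁ := by
      intro hr; simp only [hr, not_true_eq_false, decide_false] at hg
      split_ifs at hg <;> omega
    have n₂ : ¬ IsReal G U a₂ := by
      intro hr; simp only [hr, not_true_eq_false, decide_false] at hg
      split_ifs at hg <;> omega
    rw [h.mem_iff, h'.mem_iff]
    simp only [List.mem_cons]
    constructor
    · rintro ⟨rfl | rfl | h3, h4⟩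
      · exact absurd h4 n₁
      · exact absurd h4 n₂
      · exact ⟨Or.inr (Or.inr h3), h4⟩
    · rintro ⟨rfl | rfl | h3, h4⟩
      · exact absurd h4 h₁
      · exact absurd h4 h₂
      · exact ⟨Or.inr (Or.inr h3), h4⟩

theorem swap_one (hMG : ∀ e ∈ M, e ∈ G.edgeSet) (h : (consec L).Perm (r₁ :: R))
    (h' : (consec L').Perm (a₁ :: R)) (h₁ : ¬ IsReal G U r₁) (h₂ : IsReal G U a₁) :
    gaps G U L' + 1 = gaps G U L ∧ penalty G U M L' ≤ penalty G U M L := by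
  have c1 : listCost G U L = _ := (h.map (pairCost G U)).sum_eq
  have c2 : listCost G U L' = _ := (h'.map (pairCost G U)).sum_eq
  have g1 : gaps G U L = _ := h.countP_eq _
  have g2 : gaps G U L' = _ := h'.countP_eq _
  have l1 : listLoss M L = _ := h.countP_eq _
  have l2 : listLoss M L' = _ := h'.countP_eq _
  have m₁ : r₁ ∉ M := fun h => h₁ (Or.inl (hMG _ h))
  simp only [List.map_cons, List.sum_cons, pairCost_of_not_isReal h₁] at c1 c2
  simp only [List.countP_cons, h₁, h₂, m₁, not_false_eq_true, decide_true, if_true,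
    not_true_eq_false, decide_false] at g1 g2 l1 l2
  have p1 := pairCost_le_two (G := G) (U := U) a₁
  constructor
  · rw [g1, g2]; simp
  · have : listLoss M L' ≤ listLoss M L := by rw [l1, l2]; split_ifs <;> omega
    unfold penalty; omega

end Swap

theorem gaps_reverse (L : List V) : gaps G U L.reverse = gaps G U L :=
  gaps_perm (by rw [consec_reverse]; exact List.reverse_perm _)

theorem penalty_reverse (L : List V) : penalty G U M L.reverse = penalty G U M L :=
  penalty_perm (by rw [consec_reverse]; exact List.reverse_perm _)

theorem getLast?_eq_of_append {A B : List V} {y : V} (h : B.head? = some y) :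
    (A ++ B).getLast? = B.getLast? := by
  cases B with
  | nil => simp at h
  | cons b B => simp [List.getLast?_append, List.getLast?_cons]

theorem head?_eq_of_append {A B : List V} {x : V} (h : A.getLast? = some x) :
    (A ++ B).head? = A.head? := by
  cases A with
  | nil => simp at h
  | cons b B => simp

/-- A closed ordering can be cut open at one of its gaps. -/
theorem exists_cut (hMG : ∀ e ∈ M, e ∈ G.edgeSet) {L : List V} (hL : IsOrdering L) {u v : V}
    (hv : L.head? = some v) (hu : L.getLast? = some u) (hr : IsReal G U s(u, v))
    (hg : gaps G U L ≠ 0) :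
    ∃ L', IsOrdering L' ∧ gaps G U L' + 1 = gaps G U L ∧ penalty G U M L' ≤ penalty G U M L := by
  obtain ⟨A, B, x, y, rfl, hx, hy, hxy, -⟩ := exists_split_last_gap hg
  -- A cyclic shift, in which the closing pair replaces the gap `s(x, y)`.
  refine ⟨B ++ A, hL.of_perm List.perm_append_comm, ?_⟩
  rw [head?_eq_of_append hx] at hv
  rw [getLast?_eq_of_append hy] at hu
  refine swap_one (R := consec A ++ consec B) hMG ?_ ?_ hxy hr
  · rw [consec_append hx hy]; exact List.perm_middle
  · rw [consec_append hu hv]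
    exact List.perm_middle.trans (List.Perm.cons _ List.perm_append_comm)

/-- An ordering with the minimum number of gaps gives, with every gap except the last one,
another ordering with the same last vertex and the same real pairs. -/
theorem exists_isRootFamily (hMG : ∀ e ∈ M, e ∈ G.edgeSet) {L : List V} (hL : IsOrdering L)
    {h : V} (hh : L.head? = some h)
    (hmin : ∀ L', IsOrdering L' → penalty G U M L' ≤ penalty G U M L →
      gaps G U L ≤ gaps G U L') :
    ∃ S₀ L₀ F, IsRootFamily G U M S₀ L₀ F (listCost G U L) (gaps G U L) (penalty G U M L) ∧
      max 1 (gaps G U L) ≤ S₀.card ∧ ∀ v ∈ S₀, (L₀ v).getLast? = L.getLast? := by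
  by_cases hg : gaps G U L = 0
  · refine ⟨{h}, fun _ => L, {e | e ∈ consec L ∧ IsReal G U e}, ?_, by simp [hg], by simp⟩
    constructor <;> simp [hL, hh]
  -- All that follows the last gap stays in place as `C`. Exchanging the blocks `A`, `B` on the two
  -- sides of another gap makes the first vertex of `B` the head; the two gaps give way to two pairs
  -- that are gaps again, by minimality.
  obtain ⟨N, C, x, y, rfl, hx, hy, hxy, hgN⟩ := exists_split_last_gap hg
  have key : ∀ z, ∃ L', (z = h ∨ z ∈ gapHeads G U N) → IsOrdering L' ∧ L'.head? = some z ∧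
      L'.getLast? = (N ++ C).getLast? ∧ listCost G U L' ≤ listCost G U (N ++ C) ∧
      gaps G U L' ≤ gaps G U (N ++ C) ∧ penalty G U M L' ≤ penalty G U M (N ++ C) ∧
      ∀ e, (e ∈ consec L' ∧ IsReal G U e ↔ e ∈ consec (N ++ C) ∧ IsReal G U e) := by
    intro z
    by_cases hzh : z = h
    · exact ⟨N ++ C, fun _ => ⟨hL, hzh ▸ hh, rfl, le_rfl, le_rfl, le_rfl, fun e => Iff.rfl⟩⟩
    by_cases hz : z ∈ gapHeads G U N
    · obtain ⟨A, B, x', rfl, hx', hz', hgap⟩ := exists_split_of_mem_gapHeads hz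
      have hxB : B.getLast? = some x := by rw [← hx, getLast?_eq_of_append hz']
      have hhA : A.head? = some h := by
        rw [← hh, List.append_assoc, head?_eq_of_append hx']
      have hord : IsOrdering (B ++ A ++ C) :=
        hL.of_perm (List.perm_append_comm.append_right C)
      have hBA : (B ++ A).getLast? = some x' := by rw [← hx', getLast?_eq_of_append hhA]
      obtain ⟨h1, h2, h3, h4⟩ := swap_two (U := U) (L := A ++ B ++ C) (L' := B ++ A ++ C)
        (R := consec A ++ consec B ++ consec C) (a₁ := s(x', y)) (a₂ := s(x, h)) hMG
        (by
          rw [consec_append hx hy, consec_append hx' hz']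
          refine List.perm_middle.trans ((List.Perm.cons _ ?_).trans (List.Perm.swap _ _ _))
          rw [List.append_assoc, List.append_assoc]
          exact List.perm_middle)
        (by
          rw [consec_append hBA hy, consec_append hxB hhA]
          refine List.perm_middle.trans (List.Perm.cons _ ?_)
          refine (List.Perm.append_right _ List.perm_middle).trans ?_
          exact List.Perm.cons _ (List.perm_append_comm.append_right _)) hgap hxy
      refine ⟨B ++ A ++ C, fun _ => ⟨hord, ?_, ?_, h1, h2, h3, h4 (hmin _ hord h3)⟩⟩
      · rw [List.append_assoc, head?_eq_of_append hxB, hz']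
      · rw [getLast?_eq_of_append hy, getLast?_eq_of_append hy]
    · exact ⟨[], fun h => absurd h (by simp [hzh, hz])⟩
  choose L₀ hL₀ using key
  obtain ⟨N', rfl⟩ : ∃ N', N = h :: N' := by
    rw [head?_eq_of_append hx] at hh
    cases N with
    | nil => simp at hh
    | cons c N => simp at hh; exact ⟨N, by rw [hh]⟩
  have hsub := gapHeads_sublist (G := G) (U := U) h N'
  have hnd : (h :: N').Nodup := (List.nodup_append.1 hL.1).1
  rw [List.nodup_cons] at hnd
  have hmem : ∀ z, z ∈ insert h (gapHeads G U (h :: N')).toFinset →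
      z = h ∨ z ∈ gapHeads G U (h :: N') := fun z hz => by simpa using hz
  refine ⟨insert h (gapHeads G U (h :: N')).toFinset, L₀,
    {e | e ∈ consec (h :: N' ++ C) ∧ IsReal G U e}, ?_, ?_, fun v hv => (hL₀ v (hmem v hv)).2.2.1⟩
  · exact ⟨fun v hv => (hL₀ v (hmem v hv)).1, fun v hv => (hL₀ v (hmem v hv)).2.1,
      fun v hv => (hL₀ v (hmem v hv)).2.2.2.2.2.2, fun v hv => (hL₀ v (hmem v hv)).2.2.2.1,
      fun v hv => (hL₀ v (hmem v hv)).2.2.2.2.1, fun v hv => (hL₀ v (hmem v hv)).2.2.2.2.2.1⟩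
  · rw [Finset.card_insert_of_notMem, List.toFinset_card_of_nodup (hsub.nodup hnd.2),
      length_gapHeads]
    · omega
    · intro hcon
      exact hnd.1 (hsub.subset (List.mem_toFinset.1 hcon))

end Cut

/-! ### Many possible pairs of end vertices. -/

/-- The conditions on `G` under which sets of heads grow linearly large: minimum degree at least
`4`, sets of size less than `B` are sparse, and `Z` is a core of at most `B / 2` vertices. -/
structure IsExpanding {V : Type*} [Fintype V] (G : SimpleGraph V) (Z : Finset V) (K : ℕ)
    (B : ℝ) : Prop where
  degree : ∀ v, 4 ≤ G.degree v
  sparse : ∀ T : Finset V, (T.card : ℝ) < B → 10 * spannedEdges G T ≤ 11 * T.card + 9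
  core : IsCore G Z K B
  card_le : (Z.card : ℝ) ≤ B / 2

section Heads
variable {V : Type*} [Fintype V] {G : SimpleGraph V} {U M : Finset (Sym2 V)} {Z : Finset V}
  {K : ℕ} {B : ℝ}

theorem exists_many_heads (hG : IsExpanding G Z K B) (hMG : ∀ e ∈ M, e ∈ G.edgeSet)
    (hU : IsSeparated G Z U) {L : List V} (hL : IsOrdering L) {u : V}
    (hu : L.getLast? = some u) {p J : ℕ} (hp : penalty G U M L ≤ p)
    (hmin : ∀ L', IsOrdering L' → penalty G U M L' ≤ p + J → gaps G U L ≤ gaps G U L')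
    (hJ : (Fintype.card V : ℝ) < 1.01 ^ J * (max 1 (gaps G U L) : ℕ)) :
    ∃ S : Finset V, B / 2 ≤ 3 * (S.card : ℝ) ∧ ∀ v ∈ S, ∃ L', IsOrdering L' ∧
      L'.head? = some v ∧ L'.getLast? = some u ∧ gaps G U L' ≤ gaps G U L ∧
      penalty G U M L' ≤ p + J := by
  -- An ordering of least cost among the admissible ones ending in `u` is the start, so that the
  -- first hundred rounds remove edges of `G` only.
  have hex : ∃ c, ∃ L', IsOrdering L' ∧ L'.getLast? = some u ∧ gaps G U L' ≤ gaps G U L ∧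
      penalty G U M L' ≤ p ∧ listCost G U L' = c := ⟨_, L, hL, hu, le_rfl, hp, rfl⟩
  obtain ⟨N, hN, hNu, hNg, hNp, hNc⟩ := Nat.find_spec hex
  have hfind : ∀ L', IsOrdering L' → L'.getLast? = some u → gaps G U L' ≤ gaps G U L →
      penalty G U M L' ≤ p → listCost G U N ≤ listCost G U L' := by
    intro L' h1 h2 h3 h4
    rw [hNc]
    exact Nat.find_min' hex ⟨L', h1, h2, h3, h4, rfl⟩
  have hgN : gaps G U N = gaps G U L := le_antisymm hNg (hmin N hN (by omega))
  obtain ⟨h, hh⟩ : ∃ h, N.head? = some h := by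
    cases N with
    | nil => simp at hNu
    | cons a N => exact ⟨a, rfl⟩
  obtain ⟨S₀, L₀, F, hr, hcard, hlast⟩ := exists_isRootFamily (U := U) hMG hN hh
    (fun L' h1 h2 => hgN ▸ hmin L' h1 (by omega))
  rw [hgN] at hcard hr
  have hS₀ : S₀.Nonempty := Finset.card_pos.1 (by omega)
  have hlast' : ∀ i, ∀ v ∈ heads G S₀ L₀ i, (headList G S₀ L₀ i v).getLast? = some u := by
    intro i v hv
    obtain ⟨-, -, ⟨r, hr₀, h⟩, -⟩ := hr.headList_spec i hv
    rw [h, hlast r hr₀, hNu]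
  obtain ⟨i, hi, hB⟩ := exists_heads_large (B := B / 2) hr hS₀ hG.degree hU.unique (J := J)
    (by
      intro j hj v hv w x L' hvw hrot
      by_contra hreal
      obtain ⟨h1, h2, h3, h4, h5, h6⟩ := hr.headList_spec j hv
      have := hrot.gaps_lt hvw hreal
      have h7 := hrot.penalty_le (U := U) (M := M) hvw
      have := hmin L' (h1.of_perm hrot.perm) (by omega)
      omega)
    (by
      intro j hj hj' v hv w x L' hvw hrot
      by_contra hreal
      obtain ⟨h1, h2, h3, h4, h5, h6⟩ := hr.headList_spec j hv
      have := hrot.cost_lt (U := U) hvw hreal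
      have := hrot.penalty_le_of_not_mem (U := U) (M := M) hvw hreal
      have := hrot.gaps_le (U := U) hvw
      have := hfind L' (h1.of_perm hrot.perm) (hrot.last.trans (hlast' j v hv)) (by omega)
        (by omega)
      omega)
    (fun T hT => hG.sparse T (by
      have : (0 : ℝ) ≤ Z.card := Nat.cast_nonneg _
      have := hG.card_le
      linarith))
    (fun S T hT hST hN => hU.spread hG.core hG.degree hG.sparse
      (by have := hG.card_le; linarith) hST hN)
    (hJ.trans_le (by gcongr))
  refine ⟨_, hB, fun v hv => ?_⟩
  obtain ⟨h1, h2, h3, h4, h5, h6⟩ := hr.headList_spec i hv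
  exact ⟨_, h1, h2, hlast' i v hv, h5, by omega⟩

/-- Many pairs of vertices far from the pairs of `U` are the two ends of good orderings. -/
theorem exists_many_ends (hG : IsExpanding G Z K B) (hMG : ∀ e ∈ M, e ∈ G.edgeSet)
    (hU : IsSeparated G Z U) {L : List V} (hL : IsOrdering L) (hne : L ≠ []) {p J : ℕ}
    (hp : penalty G U M L ≤ p)
    (hmin : ∀ L', IsOrdering L' → penalty G U M L' ≤ p + 2 * J → gaps G U L ≤ gaps G U L')
    (hJ : (Fintype.card V : ℝ) < 1.01 ^ J * (max 1 (gaps G U L) : ℕ)) {b : ℝ}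
    (hb : (Z.card : ℝ) + (2 * U.card + 1) * (K + 1) ^ 18 ≤ b) (hbB : b ≤ B / 6) :
    ∃ E : Finset (Sym2 V), (B / 6 - b) ^ 2 ≤ 2 * (E.card : ℝ) ∧ ∀ e ∈ E, ∃ u v L',
      e = s(u, v) ∧ u ∉ nearby G Z (pairVerts U) ∧ v ∉ nearby G Z (insert u (pairVerts U)) ∧
      IsOrdering L' ∧ L'.head? = some v ∧ L'.getLast? = some u ∧
      gaps G U L' = gaps G U L ∧ penalty G U M L' ≤ p + 2 * J := by
  obtain ⟨z, hz⟩ : ∃ z, L.getLast? = some z := ⟨_, List.getLast?_eq_getLast_of_ne_nil hne⟩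
  have hnear : ∀ W : Finset V, W.card ≤ 2 * U.card + 1 → ((nearby G Z W).card : ℝ) ≤ b := by
    intro W hW
    refine le_trans ?_ hb
    have h1 := hG.core.card_nearby_le W
    have h2 : Z.card + W.card * (K + 1) ^ 18 ≤ Z.card + (2 * U.card + 1) * (K + 1) ^ 18 := by
      gcongr
    exact_mod_cast h1.trans h2
  have hsd : ∀ S W : Finset V, B / 2 ≤ 3 * (S.card : ℝ) → W.card ≤ 2 * U.card + 1 →
      B / 6 - b ≤ ((S \ nearby G Z W).card : ℝ) := by
    intro S W hS hW
    have h1 : (S.card : ℝ) ≤ (S \ nearby G Z W).card + (nearby G Z W).card := by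
      have := Finset.le_card_sdiff (nearby G Z W) S
      have : S.card ≤ (S \ nearby G Z W).card + (nearby G Z W).card := by omega
      exact_mod_cast this
    have := hnear W hW
    linarith
  obtain ⟨S, hS, hSL⟩ := exists_many_heads hG hMG hU hL hz hp
    (fun L' h1 h2 => hmin L' h1 (by omega)) hJ
  -- Reversing the ordering with head `u` makes `u` the fixed last vertex, and a second phase of
  -- growth runs at the other end.
  have key : ∀ u, ∃ T : Finset V, u ∈ S → B / 2 ≤ 3 * (T.card : ℝ) ∧ ∀ v ∈ T, ∃ L',
      IsOrdering L' ∧ L'.head? = some v ∧ L'.getLast? = some u ∧ gaps G U L' = gaps G U L ∧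
      penalty G U M L' ≤ p + 2 * J := by
    intro u
    by_cases hu : u ∈ S
    · obtain ⟨N, h1, h2, -, h4, h5⟩ := hSL u hu
      have hgN : gaps G U N.reverse = gaps G U L := by
        rw [gaps_reverse]
        exact le_antisymm h4 (hmin N h1 (by omega))
      obtain ⟨T, hT, hTL⟩ := exists_many_heads (p := p + J) (J := J) hG hMG hU
        (h1.of_perm (List.reverse_perm N).symm) (by rw [List.getLast?_reverse, h2])
        (by rw [penalty_reverse]; exact h5)
        (fun L' h1 h2 => hgN ▸ hmin L' h1 (by omega)) (hgN.symm ▸ hJ)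
      refine ⟨T, fun _ => ⟨hT, fun v hv => ?_⟩⟩
      obtain ⟨L', h1, h2, h3, h4, h5⟩ := hTL v hv
      exact ⟨L', h1, h2, h3, le_antisymm (hgN ▸ h4) (hmin L' h1 (by omega)), by omega⟩
    · exact ⟨∅, fun h => absurd h hu⟩
  choose T hT using key
  let P : Finset ((_ : V) × V) := (S \ nearby G Z (pairVerts U)).sigma
    fun u => T u \ nearby G Z (insert u (pairVerts U))
  have hU2 := card_pairVerts_le U
  have hP : (B / 6 - b) ^ 2 ≤ (P.card : ℝ) := by
    rw [Finset.card_sigma, sq]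
    push_cast
    calc (B / 6 - b) * (B / 6 - b)
        ≤ (S \ nearby G Z (pairVerts U)).card * (B / 6 - b) := by
          refine mul_le_mul_of_nonneg_right (hsd _ _ hS (by omega)) (by linarith)
      _ = ∑ u ∈ S \ nearby G Z (pairVerts U), (B / 6 - b) := by
          rw [Finset.sum_const, nsmul_eq_mul]
      _ ≤ _ := by
          refine Finset.sum_le_sum fun u hu => hsd _ _ (hT u (Finset.mem_sdiff.1 hu).1).1 ?_
          have := Finset.card_insert_le u (pairVerts U)
          omega
  refine ⟨P.image fun q => s(q.1, q.2), hP.trans ?_, ?_⟩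
  · have : P.card ≤ 2 * (P.image fun q => s(q.1, q.2)).card := by
      refine Finset.card_le_mul_card_image _ _ fun e _ => ?_
      induction e with
      | _ x y =>
        refine (Finset.card_le_card (t := {⟨x, y⟩, ⟨y, x⟩}) fun q hq => ?_).trans
          Finset.card_le_two
        obtain ⟨q₁, q₂⟩ := q
        have := (Finset.mem_filter.1 hq).2
        simp only [Finset.mem_insert, Finset.mem_singleton]
        rw [Sym2.eq_iff] at this
        rcases this with ⟨rfl, rfl⟩ | ⟨rfl, rfl⟩ <;> simp
    exact_mod_cast this
  · intro e he
    obtain ⟨⟨u, v⟩, hq, rfl⟩ := Finset.mem_image.1 he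
    obtain ⟨hu, hv⟩ := Finset.mem_sigma.1 hq
    obtain ⟨hu1, hu2⟩ := Finset.mem_sdiff.1 hu
    obtain ⟨hv1, hv2⟩ := Finset.mem_sdiff.1 hv
    obtain ⟨L', h⟩ := (hT u hu1).2 v hv1
    exact ⟨u, v, L', rfl, hu2, hv2, h⟩

end Heads

/-! ### Improvement by one additional pair. -/

section States
variable {V : Type*} [Fintype V] (G : SimpleGraph V) (M : Finset (Sym2 V)) (Z : Finset V)
  (ℓ : ℕ) (D : ℕ → ℕ) (T₀ : ℕ)

/-- With the help of pairs in `X` there is an ordering with `t` gaps and small penalty. -/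
def IsReachable (X : Finset (Sym2 V)) (t : ℕ) : Prop :=
  ∃ (L : List V) (U : Finset (Sym2 V)), IsOrdering L ∧ U ⊆ X ∧ IsSeparated G Z U ∧
    gaps G U L = t ∧ U.card + t ≤ T₀ ∧ penalty G U M L ≤ ℓ + ∑ τ ∈ Finset.Ioc t T₀, D τ

/-- With the help of pairs in `X` there is a cyclic ordering without gaps and with few pairs
outside `M`. -/
def IsClosable (Q : ℕ) (X : Finset (Sym2 V)) : Prop :=
  ∃ (L : List V) (u v : V), IsOrdering L ∧ L.head? = some v ∧ L.getLast? = some u ∧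
    (∀ e ∈ consec L, IsReal G X e) ∧ IsReal G X s(u, v) ∧ listLoss M L ≤ Q

variable {G M Z ℓ D T₀} {X Y : Finset (Sym2 V)} {t : ℕ}

theorem IsReachable.mono (h : IsReachable G M Z ℓ D T₀ X t) (hXY : X ⊆ Y) :
    IsReachable G M Z ℓ D T₀ Y t := by
  obtain ⟨L, U, h1, h2, h3⟩ := h
  exact ⟨L, U, h1, h2.trans hXY, h3⟩

theorem IsReal.mono {V : Type*} {G : SimpleGraph V} {X Y : Finset (Sym2 V)} {e : Sym2 V}
    (h : IsReal G X e) (hXY : X ⊆ Y) : IsReal G Y e := h.imp_right fun h => hXY h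

theorem IsClosable.mono {V : Type*} {G : SimpleGraph V} {M X Y : Finset (Sym2 V)} {Q : ℕ}
    (h : IsClosable G M Q X) (hXY : X ⊆ Y) : IsClosable G M Q Y := by
  obtain ⟨L, u, v, h1, h2, h3, h4, h5, h6⟩ := h
  exact ⟨L, u, v, h1, h2, h3, fun e he => (h4 e he).mono hXY, h5.mono hXY, h6⟩

theorem gaps_anti {V : Type*} {G : SimpleGraph V} {X Y : Finset (Sym2 V)} (hXY : X ⊆ Y)
    (L : List V) : gaps G Y L ≤ gaps G X L := by
  unfold gaps
  refine List.countP_mono_left fun e _ h => ?_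
  simp only [decide_eq_true_eq] at h ⊢
  exact fun h' => h (h'.mono hXY)

theorem penalty_anti {V : Type*} {G : SimpleGraph V} {M X Y : Finset (Sym2 V)} (hXY : X ⊆ Y)
    (L : List V) : penalty G Y M L ≤ penalty G X M L := by
  unfold penalty listCost
  gcongr
  refine List.sum_le_sum fun e _ => ?_
  unfold pairCost
  have := @hXY e
  split_ifs <;> first | omega | tauto

theorem sum_Ioc_add_le (D : ℕ → ℕ) {t t' T₀ : ℕ} (h : t' < t) (ht : t ≤ T₀) :
    ∑ τ ∈ Finset.Ioc t T₀, D τ + D t ≤ ∑ τ ∈ Finset.Ioc t' T₀, D τ := by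
  rw [add_comm, ← Finset.sum_insert (by simp)]
  refine Finset.sum_le_sum_of_subset fun τ hτ => ?_
  simp only [Finset.mem_insert, Finset.mem_Ioc] at hτ ⊢
  omega

/-- Passing from `U` to `Y` may already fill a gap. If it does not, an ordering without gaps closes
to a cycle, and any other is closed up and cut at a gap. The rounds at level `t` are paid by `D t`,
and a new pair in use is offset by a lost gap in `U.card + t ≤ T₀`. -/
theorem isClosable_or_isReachable {U : Finset (Sym2 V)} (hMG : ∀ e ∈ M, e ∈ G.edgeSet)
    {L : List V} (hL : IsOrdering L) {u v : V} (hv : L.head? = some v) (hu : L.getLast? = some u)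
    (hUY : U ⊆ Y) (hYX : Y ⊆ X) (hY : IsSeparated G Z Y) (hYc : Y.card ≤ U.card + 1)
    (hr : IsReal G Y s(u, v)) (hg : gaps G U L = t) (hT : U.card + t ≤ T₀)
    (hp : penalty G U M L ≤ ℓ + ∑ τ ∈ Finset.Ioc t T₀, D τ + D t) :
    IsClosable G M (ℓ + ∑ τ ∈ Finset.range (T₀ + 1), D τ) X ∨
      ∃ t' < t, IsReachable G M Z ℓ D T₀ X t' := by
  have hp' := (penalty_anti (M := M) (G := G) hUY L).trans hp
  have hg' := gaps_anti (G := G) hUY L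
  rcases lt_or_eq_of_le hg' with hlt | heq
  · rw [hg] at hlt
    refine Or.inr ⟨_, hlt, L, Y, hL, hYX, hY, rfl, by omega, ?_⟩
    have := sum_Ioc_add_le D hlt (show t ≤ T₀ by omega)
    omega
  · rw [hg] at heq
    by_cases ht : t = 0
    · subst ht
      refine Or.inl ⟨L, u, v, hL, hv, hu, fun e he => ?_, hr.mono hYX, ?_⟩
      · unfold gaps at heq
        rw [List.countP_eq_zero] at heq
        have := heq e he
        simp only [decide_not, Bool.not_eq_true', decide_eq_false_iff_not, not_not] at this
        exact this.mono hYX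
      · have h1 : listLoss M L ≤ penalty G Y M L := by unfold penalty; omega
        have h2 : ∑ τ ∈ Finset.Ioc 0 T₀, D τ + D 0 ≤ ∑ τ ∈ Finset.range (T₀ + 1), D τ := by
          rw [add_comm, ← Finset.sum_insert (by simp)]
          refine Finset.sum_le_sum_of_subset fun τ hτ => ?_
          simp only [Finset.mem_insert, Finset.mem_Ioc, Finset.mem_range] at hτ ⊢
          omega
        omega
    · obtain ⟨L', h1, h2, h3⟩ := exists_cut (U := Y) hMG hL hv hu hr (by omega)
      refine Or.inr ⟨gaps G Y L', by omega, L', Y, h1, hYX, hY, rfl, by omega, ?_⟩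
      have := sum_Ioc_add_le D (show gaps G Y L' < t by omega) (show t ≤ T₀ by omega)
      omega

/-- If `X` does not suffice yet, then many additional pairs lead to an improvement. -/
theorem exists_many_improving {K : ℕ} {B b : ℝ} (hG : IsExpanding G Z K B)
    (hMG : ∀ e ∈ M, e ∈ G.edgeSet) (hV : Nonempty V)
    (hX : IsReachable G M Z ℓ D T₀ X t) (hmin : ∀ t' < t, ¬ IsReachable G M Z ℓ D T₀ X t')
    (hXc : ¬ IsClosable G M (ℓ + ∑ τ ∈ Finset.range (T₀ + 1), D τ) X) {J : ℕ}
    (hD : 2 * J ≤ D t) (hJ : (Fintype.card V : ℝ) < 1.01 ^ J * (max 1 t : ℕ))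
    (hb : (Z.card : ℝ) + (2 * T₀ + 1) * (K + 1) ^ 18 ≤ b) (hbB : b ≤ B / 6) :
    ∃ E : Finset (Sym2 V), (B / 6 - b) ^ 2 ≤ 2 * (E.card : ℝ) ∧ ∀ e ∈ E,
      e ∈ Gᶜ.edgeFinset ∧ e ∉ X ∧
      (IsClosable G M (ℓ + ∑ τ ∈ Finset.range (T₀ + 1), D τ) (insert e X) ∨
        ∃ t' < t, IsReachable G M Z ℓ D T₀ (insert e X) t') := by
  obtain ⟨L, U, hL, hUX, hU, hg, hT, hp⟩ := hX
  have hne : L ≠ [] := by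
    rintro rfl
    obtain ⟨v⟩ := hV
    simpa using hL.2 v
  -- `D t` covers `J` rounds at either end; an ordering with fewer gaps within this budget would
  -- contradict the minimality of `t`.
  obtain ⟨E, hE, hE'⟩ := exists_many_ends (J := J) (b := b) hG hMG hU hL hne hp
    (by
      intro L' h1 h2
      by_contra! hlt
      rw [hg] at hlt
      refine hmin _ hlt ⟨L', U, h1, hUX, hU, rfl, by omega, ?_⟩
      have := sum_Ioc_add_le D hlt (show t ≤ T₀ by omega)
      omega)
    (hg.symm ▸ hJ)
    (le_trans (by
      have : (U.card : ℝ) ≤ T₀ := by exact_mod_cast (show U.card ≤ T₀ by omega)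
      gcongr) hb) hbB
  refine ⟨E, hE, fun e he => ?_⟩
  obtain ⟨u, v, L', rfl, hu, hv, h1, h2, h3, h4, h5⟩ := hE' e he
  have himp : ∀ {X' Y : Finset (Sym2 V)}, U ⊆ Y → Y ⊆ X' → IsSeparated G Z Y →
      Y.card ≤ U.card + 1 → IsReal G Y s(u, v) →
      IsClosable G M (ℓ + ∑ τ ∈ Finset.range (T₀ + 1), D τ) X' ∨
        ∃ t' < t, IsReachable G M Z ℓ D T₀ X' t' := fun a1 a2 a3 a4 a5 =>
    isClosable_or_isReachable hMG h1 h2 h3 a1 a2 a3 a4 a5 (h4.trans hg) hT (by omega)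
  -- Pairs of `X` alone allow no improvement, so `s(u, v)` must be new: neither an edge of `G` nor
  -- in `X`.
  have hno : ∀ {Y : Finset (Sym2 V)}, U ⊆ Y → Y ⊆ X → IsSeparated G Z Y →
      Y.card ≤ U.card + 1 → ¬ IsReal G Y s(u, v) := by
    intro Y a1 a2 a3 a4 a5
    rcases himp a1 a2 a3 a4 a5 with h | ⟨t', h, h'⟩
    · exact hXc h
    · exact hmin t' h h'
  have hreal := hno le_rfl hUX hU (Nat.le_succ _)
  have hadj : ¬ G.Adj u v := fun h => hreal (Or.inl h)
  have hins := hU.insert hu hv hadj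
  have hX' : s(u, v) ∉ X := fun h => hno (Finset.subset_insert _ _)
    (Finset.insert_subset h hUX) hins (Finset.card_insert_le _ _)
    (Or.inr (Finset.mem_insert_self _ _))
  refine ⟨?_, hX', himp (Finset.subset_insert _ _) (Finset.insert_subset_insert _ hUX) hins
    (Finset.card_insert_le _ _) (Or.inr (Finset.mem_insert_self _ _))⟩
  rw [SimpleGraph.mem_edgeFinset, SimpleGraph.mem_edgeSet, SimpleGraph.compl_adj]
  refine ⟨?_, hadj⟩
  rintro rfl
  refine hv (Finset.mem_union_right _ (Finset.mem_biUnion.2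
    ⟨u, Finset.mem_insert_self _ _, self_mem_walkBall⟩))

end States

/-! ### Failure probability for uniform random subsets. -/

section Counting
variable {α : Type*} [DecidableEq α]

/-- Double count of the pairs `(Y, e)` with `e ∈ Y`, by way of `Y.erase e`. -/
theorem sum_powersetCard_succ (A : Finset α) (j : ℕ) (w : Finset α → ℝ) :
    (j + 1 : ℝ) * ∑ Y ∈ A.powersetCard (j + 1), w Y =
      ∑ X ∈ A.powersetCard j, ∑ e ∈ A \ X, w (insert e X) := by
  have h1 : (j + 1 : ℝ) * ∑ Y ∈ A.powersetCard (j + 1), w Y =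
      ∑ Y ∈ A.powersetCard (j + 1), ∑ _e ∈ Y, w Y := by
    rw [Finset.mul_sum]
    refine Finset.sum_congr rfl fun Y hY => ?_
    rw [Finset.sum_const, (Finset.mem_powersetCard.1 hY).2, nsmul_eq_mul]
    push_cast; ring
  rw [h1, Finset.sum_sigma', Finset.sum_sigma']
  refine Finset.sum_bij' (fun p _ => ⟨p.1.erase p.2, p.2⟩) (fun p _ => ⟨insert p.2 p.1, p.2⟩)
    ?_ ?_ ?_ ?_ ?_
  · rintro ⟨Y, e⟩ h
    simp only [Finset.mem_sigma, Finset.mem_powersetCard, Finset.mem_sdiff] at h ⊢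
    exact ⟨⟨(Finset.erase_subset _ _).trans h.1.1, by rw [Finset.card_erase_of_mem h.2]; omega⟩,
      h.1.1 h.2, Finset.notMem_erase _ _⟩
  · rintro ⟨X, e⟩ h
    simp only [Finset.mem_sigma, Finset.mem_powersetCard, Finset.mem_sdiff] at h ⊢
    exact ⟨⟨Finset.insert_subset h.2.1 h.1.1, by rw [Finset.card_insert_of_notMem h.2.2]; omega⟩,
      Finset.mem_insert_self _ _⟩
  · rintro ⟨Y, e⟩ h
    simp only [Finset.mem_sigma] at h
    simp [Finset.insert_erase h.2]
  · rintro ⟨X, e⟩ h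
    simp only [Finset.mem_sigma, Finset.mem_sdiff] at h
    simp [Finset.erase_insert h.2.2]
  · rintro ⟨Y, e⟩ h
    simp only [Finset.mem_sigma] at h
    simp [Finset.insert_erase h.2]

/-- Elements are added one at a time at random; each step multiplies the mean of `w` by at most `ρ`.
-/
theorem sum_powersetCard_le (A : Finset α) (w : Finset α → ℝ) {ρ : ℝ} (hρ : 0 ≤ ρ)
    (h : ∀ X ⊆ A, ∑ e ∈ A \ X, w (insert e X) ≤ ρ * (A \ X).card * w X) (j : ℕ) :
    ∑ X ∈ A.powersetCard j, w X ≤ (A.card.choose j) * ρ ^ j * w ∅ := by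
  induction j with
  | zero => simp
  | succ j ih =>
    by_cases hj : j < A.card
    · have h0 : (0 : ℝ) < j + 1 := by positivity
      rw [← mul_le_mul_iff_right₀ h0, sum_powersetCard_succ]
      have h1 : ∑ X ∈ A.powersetCard j, ∑ e ∈ A \ X, w (insert e X) ≤
          ρ * (A.card - j : ℕ) * ∑ X ∈ A.powersetCard j, w X := by
        rw [Finset.mul_sum]
        refine Finset.sum_le_sum fun X hX => ?_
        obtain ⟨hXA, hXc⟩ := Finset.mem_powersetCard.1 hX
        rw [← hXc, ← Finset.card_sdiff_of_subset hXA]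
        exact h X hXA
      refine h1.trans ((mul_le_mul_of_nonneg_left ih (by positivity)).trans (le_of_eq ?_))
      have h2 : (A.card.choose (j + 1) : ℝ) * (j + 1) = A.card.choose j * (A.card - j : ℕ) := by
        exact_mod_cast Nat.choose_succ_right_eq A.card j
      rw [pow_succ]
      linear_combination (-(ρ ^ j * ρ * w ∅)) * h2
    · rw [Finset.powersetCard_eq_empty.2 (by omega), Nat.choose_eq_zero_of_lt (by omega)]
      simp

/-- If from every set that does not have the property `C` a fixed proportion of the additional
elements decreases the rank, then few sets do not have the property. -/
theorem card_not_le {A : Finset α} {C : Finset α → Prop} {r : Finset α → ℕ} {T₀ : ℕ} {c : ℝ}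
    (hc : c ≤ 1) (hC : ∀ X e, C X → C (insert e X)) (hr : ∀ X e, r (insert e X) ≤ r X)
    (h₀ : r ∅ ≤ T₀)
    (h : ∀ X ⊆ A, ¬ C X → c * (A \ X).card ≤
      (((A \ X).filter fun e => C (insert e X) ∨ r (insert e X) < r X).card : ℝ)) (m : ℕ) :
    (((A.powersetCard m).filter fun X => ¬ C X).card : ℝ) ≤
      A.card.choose m * (1 - c / 2) ^ m * 2 ^ T₀ := by
  -- An exponential potential: zero after success, and at least halved by a fall of the rank, so its
  -- mean shrinks by `1 - c / 2` per element. It is at most `2 ^ T₀` at the start and at least one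
  -- on every failure.
  let w : Finset α → ℝ := fun X => if C X then 0 else 2 ^ r X
  have hw0 : ∀ X, 0 ≤ w X := fun X => by simp only [w]; split_ifs <;> positivity
  have hw : ∀ X e, w (insert e X) ≤ w X := by
    intro X e
    simp only [w]
    split_ifs with h1 h2 h2
    · exact le_rfl
    · positivity
    · exact absurd (hC X e h2) h1
    · exact pow_le_pow_right₀ one_le_two (hr X e)
  have key := sum_powersetCard_le A w (ρ := 1 - c / 2) (by linarith) (by
    intro X hX
    by_cases hCX : C X
    · have : ∀ e ∈ A \ X, w (insert e X) = 0 := fun e _ => if_pos (hC X e hCX)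
      rw [Finset.sum_congr rfl this]
      simp [w, hCX]
    · have h1 : ∀ e ∈ A \ X, w (insert e X) ≤
          w X - if C (insert e X) ∨ r (insert e X) < r X then w X / 2 else 0 := by
        intro e _
        split_ifs with h2
        · have h3 : w X = 2 ^ r X := if_neg hCX
          rcases h2 with h2 | h2
          · have h4 : w (insert e X) = 0 := if_pos h2
            rw [h4]; linarith [hw0 X]
          · have h4 : w (insert e X) ≤ 2 ^ r (insert e X) := by
              simp only [w]; split_ifs
              · positivity
              · exact le_rfl
            have h5 : (2 : ℝ) ^ (r (insert e X) + 1) ≤ 2 ^ r X :=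
              pow_le_pow_right₀ one_le_two h2
            rw [pow_succ] at h5
            rw [h3]; linarith
        · rw [sub_zero]; exact hw X e
      refine (Finset.sum_le_sum h1).trans ?_
      rw [Finset.sum_sub_distrib, ← Finset.sum_filter, Finset.sum_const, Finset.sum_const,
        nsmul_eq_mul, nsmul_eq_mul]
      have := mul_le_mul_of_nonneg_right (h X hX hCX) (hw0 X)
      linarith) m
  have hρ : (0 : ℝ) ≤ 1 - c / 2 := by linarith
  calc (((A.powersetCard m).filter fun X => ¬ C X).card : ℝ)
      ≤ ∑ X ∈ A.powersetCard m, w X := by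
        rw [Finset.card_filter]
        push_cast
        refine Finset.sum_le_sum fun X _ => ?_
        simp only [w]
        split_ifs <;> simp_all [one_le_pow₀]
    _ ≤ _ := key
    _ ≤ _ := by
        refine mul_le_mul_of_nonneg_left ?_ (by positivity)
        simp only [w]
        split_ifs
        · positivity
        · exact pow_le_pow_right₀ one_le_two h₀

end Counting

theorem IsUniformSubset.measureReal_ge {Ω : Type*} [MeasurableSpace Ω] {P : Measure Ω}
    [IsProbabilityMeasure P] {α : Type*} [Fintype α] {R : Ω → Finset α} {A : Finset α} {m : ℕ}
    (h : IsUniformSubset P R A m) {C : Finset α → Prop} {δ : ℝ} (hδ : 0 ≤ δ)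
    (hC : (((A.powersetCard m).filter fun X => ¬ C X).card : ℝ) ≤ A.card.choose m * δ) :
    1 - δ ≤ P.real {ω | C (R ω)} := by
  have hmeas : ∀ S : Finset (Finset α), MeasurableSet (R ⁻¹' (S : Set (Finset α))) := by
    intro S
    have : R ⁻¹' (S : Set (Finset α)) = ⋃ B ∈ S, R ⁻¹' {B} := by ext; simp
    rw [this]
    exact S.measurableSet_biUnion fun B _ => h.1 B
  have hsum : ∀ S : Finset (Finset α), P.real (R ⁻¹' (S : Set (Finset α))) =
      ∑ B ∈ S, P.real (R ⁻¹' {B}) := by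
    intro S
    have : R ⁻¹' (S : Set (Finset α)) = ⋃ B ∈ S, R ⁻¹' {B} := by ext; simp
    rw [this, measureReal_biUnion_finset]
    · intro B _ B' _ hBB'
      exact Disjoint.preimage _ (by simpa using hBB')
    · exact fun B _ => h.1 B
  let S : Finset (Finset α) := Finset.univ.filter fun X => ¬ C X
  have hS : {ω | C (R ω)} = (R ⁻¹' (S : Set (Finset α)))ᶜ := by
    ext ω; simp [S]
  rw [hS, probReal_compl_eq_one_sub (hmeas S), hsum]
  refine sub_le_sub_left ?_ _
  rw [Finset.sum_congr rfl fun B _ => h.2 B, ← Finset.sum_filter, Finset.sum_const, nsmul_eq_mul,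
    Finset.card_powersetCard]
  have h1 : S.filter (fun B => B ∈ A.powersetCard m) =
      (A.powersetCard m).filter fun X => ¬ C X := by
    ext X; simp [S, and_comm]
  rw [h1]
  by_cases h0 : A.card.choose m = 0
  · rw [h0]; simpa using hδ
  · have : (0 : ℝ) < A.card.choose m := by exact_mod_cast Nat.pos_of_ne_zero h0
    rw [mul_one_div, div_le_iff₀ this, mul_comm δ]
    exact hC

/-! ### From lists to cycles. -/

section Walks
variable {V : Type*} {G : SimpleGraph V}

theorem exists_walk_of_list {L : List V} {a b : V} (ha : L.head? = some a)
    (hb : L.getLast? = some b) (h : ∀ e ∈ consec L, e ∈ G.edgeSet) :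
    ∃ p : G.Walk a b, p.support = L ∧ p.edges = consec L := by
  induction L generalizing a with
  | nil => simp at ha
  | cons c L ih =>
    simp only [List.head?_cons, Option.some.injEq] at ha
    subst ha
    cases L with
    | nil =>
      simp only [List.getLast?_singleton, Option.some.injEq] at hb
      subst hb
      exact ⟨.nil, rfl, rfl⟩
    | cons d L =>
      obtain ⟨p, h1, h2⟩ := ih (a := d) rfl (by simpa [List.getLast?_cons] using hb)
        (fun e he => h e (List.mem_cons_of_mem _ he))
      have hcd : G.Adj c d := h s(c, d) (by simp)
      refine ⟨.cons hcd p, ?_, ?_⟩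
      · rw [SimpleGraph.Walk.support_cons, h1]
      · rw [SimpleGraph.Walk.edges_cons, h2, consec_cons_cons]

theorem closing_not_mem_consec {L : List V} (hL : L.Nodup) (h3 : 3 ≤ L.length) {a b : V}
    (ha : L.head? = some a) (hb : L.getLast? = some b) : s(b, a) ∉ consec L := by
  match L, h3 with
  | c :: d :: e :: l, _ =>
    simp only [List.head?_cons, Option.some.injEq] at ha
    subst ha
    intro h
    have hbm : b ∈ e :: l := by
      have : (e :: l).getLast? = some b := by simpa [List.getLast?_cons] using hb
      exact List.mem_of_getLast? this
    rw [consec_cons_cons, List.mem_cons] at h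
    rcases h with h | h
    · rw [Sym2.eq_swap, Sym2.congr_right] at h
      subst h
      exact (List.nodup_cons.1 (List.nodup_cons.1 hL).2).1 hbm
    · exact (List.nodup_cons.1 hL).1 (mem_of_mem_consec h (Sym2.mem_mk_right _ _))

/-- A list whose consecutive pairs and whose closing pair are edges is a cycle. -/
theorem exists_cycle_of_list {L : List V} (hL : L.Nodup) (h3 : 3 ≤ L.length) {a b : V}
    (ha : L.head? = some a) (hb : L.getLast? = some b) (h : ∀ e ∈ consec L, e ∈ G.edgeSet)
    (hba : G.Adj b a) :
    ∃ p : G.Walk b b, p.IsCycle ∧ p.support = b :: L ∧ p.edges = s(b, a) :: consec L := by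
  obtain ⟨p, h1, h2⟩ := exists_walk_of_list ha hb h
  refine ⟨.cons hba p, ?_, by simp [h1], by simp [h2]⟩
  rw [SimpleGraph.Walk.cons_isCycle_iff, SimpleGraph.Walk.isPath_def, h1, h2]
  exact ⟨hL, closing_not_mem_consec hL h3 ha hb⟩

end Walks

/-! ### Chains of the 2-matching and the initial ordering. -/

section Chains
variable {V : Type*} {M : Finset (Sym2 V)}

/-- A list of at least three elements whose closing pair is in `M`. -/
def IsClosedChain (M : Finset (Sym2 V)) (c : List V) : Prop :=
  3 ≤ c.length ∧ ∃ a b, c.head? = some a ∧ c.getLast? = some b ∧ s(b, a) ∈ M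

theorem exists_closing (M : Finset (Sym2 V)) (c : List V) :
    ∃ l : List (Sym2 V), l.length ≤ (if IsClosedChain M c then 1 else 0) ∧
      ∀ a b, c.head? = some a → c.getLast? = some b → 3 ≤ c.length → s(b, a) ∈ M → s(b, a) ∈ l := by
  by_cases h : IsClosedChain M c
  · obtain ⟨h3, a, b, h1, h2, h4⟩ := h
    refine ⟨[s(b, a)], by rw [if_pos ⟨h3, a, b, h1, h2, h4⟩]; simp, fun a' b' h1' h2' _ _ => ?_⟩
    rw [h1] at h1'; rw [h2] at h2'
    simp only [Option.some.injEq] at h1' h2'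
    subst h1' h2'
    simp
  · exact ⟨[], by simp, fun a b h1 h2 h3 h4 => absurd ⟨h3, a, b, h1, h2, h4⟩ h⟩

/-- Only the joints between chains can lie outside `M`. -/
theorem listLoss_flatten_le {𝒞 : List (List V)} (h : ∀ c ∈ 𝒞, ∀ e ∈ consec c, e ∈ M) :
    listLoss M 𝒞.flatten ≤ 𝒞.length := by
  induction 𝒞 with
  | nil => simp [listLoss]
  | cons c 𝒞 ih =>
    have h1 := ih fun c hc => h c (List.mem_cons_of_mem _ hc)
    have h0 : listLoss M c = 0 := by
      unfold listLoss
      rw [List.countP_eq_zero]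
      intro e he
      simpa using h c List.mem_cons_self e he
    rw [List.flatten_cons, List.length_cons]
    cases hx : c.getLast? with
    | none => rw [List.getLast?_eq_none_iff] at hx; subst hx; rw [List.nil_append]; omega
    | some x =>
      cases hy : 𝒞.flatten.head? with
      | none => rw [List.head?_eq_none_iff] at hy; rw [hy, List.append_nil]; omega
      | some y =>
        have : listLoss M (c ++ 𝒞.flatten) ≤ listLoss M c + (listLoss M 𝒞.flatten + 1) := by
          unfold listLoss
          rw [consec_append hx hy, List.countP_append, List.countP_cons]
          split_ifs <;> omega
        omega

theorem getLast?_eq_or_exists {c : List V} {x : V} (hx : x ∈ c) :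
    c.getLast? = some x ∨ ∃ P y Q, c = P ++ x :: y :: Q := by
  obtain ⟨P, Q, rfl⟩ := List.append_of_mem hx
  cases Q with
  | nil => left; simp
  | cons y Q => exact Or.inr ⟨P, y, Q, rfl⟩

/-- A vertex on an unused edge is an end of its chain. -/
theorem isEnd_of_unused (hM : ∀ v : V, (M.filter (fun e => v ∈ e)).card ≤ 2) {c : List V}
    (hc : c.Nodup) (hcM : ∀ e ∈ consec c, e ∈ M) {x y : V} (hx : x ∈ c) (he : s(x, y) ∈ M)
    (hec : s(x, y) ∉ consec c) : c.head? = some x ∨ c.getLast? = some x := by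
  rcases getLast?_eq_or_exists hx with h | ⟨P, z, Q, rfl⟩
  · exact Or.inr h
  rcases List.eq_nil_or_concat P with rfl | ⟨P, w, rfl⟩
  · exact Or.inl rfl
  exfalso
  rw [List.concat_eq_append, consec_append_pair] at hec hcM
  have e1 : s(w, x) ∈ M := hcM _ (by simp)
  have e2 : s(x, z) ∈ M := hcM _ (by simp)
  have hwz : w ≠ z := by
    rintro rfl
    simp [List.nodup_append] at hc
  have h1 : s(x, w) ≠ s(x, z) := fun h => hwz (Sym2.congr_right.1 h)
  have h2 : s(x, w) ≠ s(x, y) := fun h => hec (by rw [← h, Sym2.eq_swap]; simp)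
  have h3 : s(x, z) ≠ s(x, y) := fun h => hec (by rw [← h]; simp)
  have h4 : ({s(x, w), s(x, z), s(x, y)} : Finset (Sym2 V)) ⊆ M.filter fun e => x ∈ e := by
    intro e he'
    simp only [Finset.mem_insert, Finset.mem_singleton] at he'
    rcases he' with rfl | rfl | rfl
    · simpa [Sym2.eq_swap] using e1
    · simpa using e2
    · simpa using he
  have h5 := (Finset.card_le_card h4).trans (hM x)
  rw [Finset.card_insert_of_notMem (by simp [h1, h2]),
    Finset.card_insert_of_notMem (by simp [h3]), Finset.card_singleton] at h5
  omega

/-- A partition of `V` into chains of `M`. -/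
structure IsChainPartition (M : Finset (Sym2 V)) (𝒞 : List (List V)) : Prop where
  ordering : IsOrdering 𝒞.flatten
  ne_nil : ∀ c ∈ 𝒞, c ≠ []
  mem : ∀ c ∈ 𝒞, ∀ e ∈ consec c, e ∈ M

theorem IsChainPartition.merge {𝒞 : List (List V)} (h : IsChainPartition M 𝒞) {c c' : List V}
    (hc : c ∈ 𝒞) (hc' : c' ∈ 𝒞) (hne : c ≠ c') {x y : V} (hxy : s(x, y) ∈ M)
    (hx : c.head? = some x ∨ c.getLast? = some x) (hy : c'.head? = some y ∨ c'.getLast? = some y) :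
    ∃ 𝒞', IsChainPartition M 𝒞' ∧ 𝒞'.length < 𝒞.length := by
  obtain ⟨ℛ, hℛ⟩ : ∃ ℛ, 𝒞.Perm (c :: c' :: ℛ) := by
    have h1 := List.perm_cons_erase hc
    have h2 : c' ∈ 𝒞.erase c := by rwa [List.mem_erase_of_ne hne.symm]
    exact ⟨_, h1.trans ((List.perm_cons_erase h2).cons c)⟩
  obtain ⟨d, hd, hdx, hdM⟩ : ∃ d, d.Perm c ∧ d.getLast? = some x ∧ ∀ e ∈ consec d, e ∈ M := by
    rcases hx with hx | hx
    · refine ⟨c.reverse, List.reverse_perm c, by rw [List.getLast?_reverse, hx], fun e he => ?_⟩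
      rw [consec_reverse, List.mem_reverse] at he
      exact h.mem c hc e he
    · exact ⟨c, List.Perm.refl c, hx, h.mem c hc⟩
  obtain ⟨d', hd', hdy, hdM'⟩ : ∃ d, d.Perm c' ∧ d.head? = some y ∧ ∀ e ∈ consec d, e ∈ M := by
    rcases hy with hy | hy
    · exact ⟨c', List.Perm.refl c', hy, h.mem c' hc'⟩
    · refine ⟨c'.reverse, List.reverse_perm c', by rw [List.head?_reverse, hy], fun e he => ?_⟩
      rw [consec_reverse, List.mem_reverse] at he
      exact h.mem c' hc' e he
  have hsub : ∀ r ∈ ℛ, r ∈ 𝒞 := fun r hr => hℛ.mem_iff.2 (by simp [hr])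
  refine ⟨(d ++ d') :: ℛ, ⟨?_, ?_, ?_⟩, by rw [hℛ.length_eq]; simp⟩
  · refine h.ordering.of_perm (hℛ.flatten.trans ?_)
    rw [List.flatten_cons, List.flatten_cons, List.flatten_cons, ← List.append_assoc]
    exact (hd.symm.append hd'.symm).append_right _
  · intro r hr
    rcases List.mem_cons.1 hr with rfl | hr
    · intro h0
      rw [List.append_eq_nil_iff] at h0
      rw [h0.1] at hdx
      simp at hdx
    · exact h.ne_nil r (hsub r hr)
  · intro r hr e he
    rcases List.mem_cons.1 hr with rfl | hr
    · rw [consec_append hdx hdy, List.mem_append, List.mem_cons] at he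
      rcases he with he | rfl | he
      · exact hdM e he
      · exact hxy
      · exact hdM' e he
    · exact h.mem r (hsub r hr) e he

theorem hasDisjointCycles_of_chains {G : SimpleGraph V} (hMG : ∀ e ∈ M, e ∈ G.edgeSet)
    {𝒞 : List (List V)} (h : IsChainPartition M 𝒞) :
    HasDisjointCycles G (𝒞.filter fun c => IsClosedChain M c).length := by
  have hnd := List.nodup_flatten.1 h.ordering.1
  have hpw := hnd.2.filter (fun c => decide (IsClosedChain M c))
  have key : ∀ i : Fin (𝒞.filter fun c => IsClosedChain M c).length,
      ∃ (a : V) (p : G.Walk a a), p.IsCycle ∧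
        ∀ v ∈ p.support, v ∈ (𝒞.filter fun c => IsClosedChain M c).get i := by
    intro i
    have hi := List.get_mem (𝒞.filter fun c => IsClosedChain M c) i
    generalize (𝒞.filter fun c => IsClosedChain M c).get i = c at hi
    rw [List.mem_filter] at hi
    obtain ⟨hc, hi⟩ := hi
    obtain ⟨h3, a, b, ha, hb, hba⟩ := of_decide_eq_true hi
    obtain ⟨p, h1, h2, -⟩ := exists_cycle_of_list (G := G) (hnd.1 c hc) h3 ha hb
      (fun e he => hMG e (h.mem c hc e he)) (hMG _ hba)
    refine ⟨b, p, h1, fun v hv => ?_⟩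
    rw [h2, List.mem_cons] at hv
    rcases hv with rfl | hv
    · exact List.mem_of_getLast? hb
    · exact hv
  choose a p hp hsub using key
  refine ⟨a, p, hp, fun i j hij v hv hv' => ?_⟩
  have h1 := hsub i v hv
  have h2 := hsub j v hv'
  rw [List.pairwise_iff_get] at hpw
  rcases lt_or_gt_of_ne hij with hlt | hlt
  · exact hpw i j hlt h1 h2
  · exact hpw j i hlt h2 h1

/-- A chain accounts for one edge less than it has vertices, plus one if it closes up. -/
theorem length_flatMap_add_le {𝒞 : List (List V)} (hne : ∀ c ∈ 𝒞, c ≠ [])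
    {f : List V → List (Sym2 V)}
    (hf : ∀ c, (f c).length ≤ if IsClosedChain M c then 1 else 0) :
    (𝒞.flatMap fun c => consec c ++ f c).length + 𝒞.length ≤
      𝒞.flatten.length + (𝒞.filter fun c => IsClosedChain M c).length := by
  induction 𝒞 with
  | nil => simp
  | cons c 𝒞 ih =>
    have h1 := ih fun c hc => hne c (List.mem_cons_of_mem _ hc)
    have h2 := hf c
    have h3 := List.length_pos_iff.2 (hne c List.mem_cons_self)
    rw [List.flatMap_cons, List.length_append, List.length_append, length_consec,
      List.flatten_cons, List.length_append, List.length_cons, List.filter_cons]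
    split_ifs at h2 ⊢ with h4 <;> simp_all <;> omega

variable [Fintype V]

/-- A partition into the fewest chains is taken. An edge of `M` not on a chain joins two chain ends,
since inner vertices have used up their two edges. Ends of different chains would allow a merger, so
the edge closes a single chain; thus all of `M` is accounted for. -/
theorem exists_chainPartition (hMG : ∀ e ∈ M, ¬ e.IsDiag)
    (hM : ∀ v : V, (M.filter (fun e => v ∈ e)).card ≤ 2) :
    ∃ 𝒞, IsChainPartition M 𝒞 ∧
      M.card + 𝒞.length ≤ Fintype.card V + (𝒞.filter fun c => IsClosedChain M c).length := by
  have hex : ∃ k, ∃ 𝒞, IsChainPartition M 𝒞 ∧ 𝒞.length = k := by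
    have hfl : ∀ l : List V, (l.map fun v => [v]).flatten = l := by
      intro l
      induction l with
      | nil => rfl
      | cons a l ih => simpa using ih
    refine ⟨_, Finset.univ.toList.map fun v => [v], ⟨?_, ?_, ?_⟩, rfl⟩
    · rw [hfl]; exact ⟨Finset.nodup_toList _, fun v => by simp⟩
    · simp
    · simp
  obtain ⟨𝒞, h𝒞, hlen⟩ := Nat.find_spec hex
  have hmin : ∀ 𝒞', IsChainPartition M 𝒞' → 𝒞.length ≤ 𝒞'.length := fun 𝒞' h' => by
    rw [hlen]; exact Nat.find_min' hex ⟨𝒞', h', rfl⟩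
  refine ⟨𝒞, h𝒞, ?_⟩
  choose f hf hf' using exists_closing M
  have hnd := List.nodup_flatten.1 h𝒞.ordering.1
  have hsub : M ⊆ (𝒞.flatMap fun c => consec c ++ f c).toFinset := by
    intro e he
    rw [List.mem_toFinset, List.mem_flatMap]
    induction e with
    | _ x y =>
      obtain ⟨c, hc, hxc⟩ := List.mem_flatten.1 (h𝒞.ordering.2 x)
      obtain ⟨c', hc', hyc⟩ := List.mem_flatten.1 (h𝒞.ordering.2 y)
      by_cases h1 : s(x, y) ∈ consec c
      · exact ⟨c, hc, List.mem_append_left _ h1⟩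
      by_cases h2 : s(y, x) ∈ consec c'
      · exact ⟨c', hc', List.mem_append_left _ (by rwa [Sym2.eq_swap])⟩
      have e1 := isEnd_of_unused hM (hnd.1 c hc) (h𝒞.mem c hc) hxc he h1
      have e2 := isEnd_of_unused hM (hnd.1 c' hc') (h𝒞.mem c' hc') hyc
        (by rwa [Sym2.eq_swap]) h2
      by_cases hcc : c = c'
      · subst hcc
        have hxy : x ≠ y := fun h => hMG _ he (by simpa using h)
        have h3 : 3 ≤ c.length := by
          match c with
          | [] => simp at hxc
          | [a] => simp at hxc hyc; exact absurd (hxc.trans hyc.symm) hxy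
          | [a, b] =>
            exfalso
            simp only [List.mem_cons, List.not_mem_nil, or_false] at hxc hyc
            rcases hxc with rfl | rfl <;> rcases hyc with rfl | rfl
            · exact hxy rfl
            · exact h1 (by simp)
            · exact h2 (by simp)
            · exact hxy rfl
          | a :: b :: d :: l => simp
        refine ⟨c, hc, List.mem_append_right _ ?_⟩
        rcases e1 with e1 | e1 <;> rcases e2 with e2 | e2
        · rw [e1] at e2; exact absurd (Option.some.inj e2) hxy
        · rw [Sym2.eq_swap]; exact hf' c x y e1 e2 h3 (by rwa [Sym2.eq_swap])
        · exact hf' c y x e2 e1 h3 he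
        · rw [e1] at e2; exact absurd (Option.some.inj e2) hxy
      · obtain ⟨𝒞', h3, h4⟩ := h𝒞.merge hc hc' hcc he e1 e2
        have := hmin 𝒞' h3
        omega
  have h1 := (Finset.card_le_card hsub).trans (List.toFinset_card_le _)
  have h2 := length_flatMap_add_le h𝒞.ne_nil hf
  rw [h𝒞.ordering.length_eq] at h2
  omega

/-- There is an ordering with few consecutive pairs outside `M`, unless there are many disjoint
cycles. -/
theorem exists_ordering_loss_le {G : SimpleGraph V} (hM : IsTwoMatching G M) :
    ∃ L r, IsOrdering L ∧ HasDisjointCycles G r ∧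
      M.card + listLoss M L ≤ Fintype.card V + r := by
  obtain ⟨𝒞, h1, h2⟩ := exists_chainPartition (M := M)
    (fun e he => G.not_isDiag_of_mem_edgeSet (hM.1 e he)) hM.2
  have h3 := listLoss_flatten_le h1.mem
  exact ⟨_, _, h1.ordering, hasDisjointCycles_of_chains hM.1 h1, by omega⟩

/-- Outside `M` lie at most `Q` consecutive pairs and possibly the closing pair, hence the summand 1
in `hx`. -/
theorem IsClosable.hasHamiltonCycleMeeting {G : SimpleGraph V} {X : Finset (Sym2 V)} {Q : ℕ}
    (h : IsClosable G M Q X) (hX : ∀ e ∈ X, ¬ e.IsDiag) (hV : 3 ≤ Fintype.card V) {x : ℝ}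
    (hx : x + Q + 1 ≤ Fintype.card V) :
    HasHamiltonCycleMeeting (G ⊔ SimpleGraph.fromEdgeSet (X : Set (Sym2 V))) M x := by
  obtain ⟨L, u, v, h1, h2, h3, h4, h5, h6⟩ := h
  have hreal : ∀ e, IsReal G X e →
      e ∈ (G ⊔ SimpleGraph.fromEdgeSet (X : Set (Sym2 V))).edgeSet := by
    intro e he
    rw [SimpleGraph.edgeSet_sup, SimpleGraph.edgeSet_fromEdgeSet]
    rcases he with he | he
    · exact Or.inl he
    · exact Or.inr ⟨he, hX e he⟩
  obtain ⟨p, hp, hs, he⟩ := exists_cycle_of_list h1.1 (by rw [h1.length_eq]; exact hV) h2 h3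
    (fun e he => hreal e (h4 e he)) (hreal _ h5)
  refine ⟨u, p, ?_, ?_⟩
  · rw [SimpleGraph.Walk.isHamiltonianCycle_iff_isCycle_and_length_eq]
    refine ⟨hp, ?_⟩
    rw [← SimpleGraph.Walk.length_edges, he, List.length_cons, length_consec, h1.length_eq]
    omega
  · have hsub : ((consec L).filter fun e => e ∈ M).toFinset ⊆ p.edges.toFinset ∩ M := by
      intro e he'
      simp only [List.mem_toFinset, List.mem_filter, decide_eq_true_eq] at he'
      rw [Finset.mem_inter, List.mem_toFinset, he]
      exact ⟨List.mem_cons_of_mem _ he'.1, he'.2⟩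
    have hc1 := Finset.card_le_card hsub
    rw [List.toFinset_card_of_nodup ((nodup_consec h1.1).filter _), ← List.countP_eq_length_filter]
      at hc1
    have hc2 := List.length_eq_countP_add_countP (fun e => decide (e ∈ M)) (l := consec L)
    have hc3 : listLoss M L = (consec L).countP fun a => !decide (a ∈ M) := by
      unfold listLoss
      congr 1
      ext e; simp
    rw [length_consec, h1.length_eq] at hc2
    have hc4 : Fintype.card V ≤ (p.edges.toFinset ∩ M).card + Q + 1 := by
      simp only [Bool.not_eq_true, Bool.decide_eq_false] at hc2
      omega
    have : (Fintype.card V : ℝ) ≤ (p.edges.toFinset ∩ M).card + Q + 1 := by exact_mod_cast hc4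
    linarith

end Chains

/-! ### Assembling the probabilistic statement. -/

section Combine
variable {V : Type*} {G : SimpleGraph V} {M : Finset (Sym2 V)}

theorem gaps_empty_le_listLoss (hMG : ∀ e ∈ M, e ∈ G.edgeSet) (L : List V) :
    gaps G ∅ L ≤ listLoss M L := by
  unfold gaps listLoss
  refine List.countP_mono_left fun e _ h => ?_
  simp only [decide_eq_true_eq] at h ⊢
  exact fun h' => h (Or.inl (hMG e h'))

theorem listCost_le_two_mul_listLoss {U : Finset (Sym2 V)} (hMG : ∀ e ∈ M, e ∈ G.edgeSet)
    (L : List V) : listCost G U L ≤ 2 * listLoss M L := by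
  unfold listCost listLoss
  induction consec L with
  | nil => simp
  | cons e l ih =>
    rw [List.map_cons, List.sum_cons, List.countP_cons]
    have h2 := pairCost_le_two (G := G) (U := U) e
    by_cases he : e ∈ M
    · have : pairCost G U e = 0 := if_pos (hMG e he)
      omega
    · simp only [he, not_false_eq_true, decide_true, if_true]
      omega

variable [Fintype V]

theorem isSeparated_empty (G : SimpleGraph V) (Z : Finset V) : IsSeparated G Z ∅ := by
  constructor <;> simp [pairVerts]

/-- The factor is `401 = 1 + 200 * 2`: a pair outside `M` counts once as loss and costs at most two.
-/
theorem exists_isReachable (hMG : ∀ e ∈ M, e ∈ G.edgeSet) (Z : Finset V) (D : ℕ → ℕ)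
    {L : List V} (hL : IsOrdering L) {T₀ : ℕ} (hT : listLoss M L ≤ T₀) :
    ∃ t ≤ T₀, IsReachable G M Z (401 * T₀) D T₀ ∅ t := by
  have h1 := gaps_empty_le_listLoss hMG L
  have h2 := listCost_le_two_mul_listLoss (U := ∅) hMG L
  refine ⟨_, h1.trans hT, L, ∅, hL, le_rfl, isSeparated_empty G Z, rfl, ?_, ?_⟩
  · rw [Finset.card_empty]; omega
  · unfold penalty; omega

/-- The rank of `X` is the least number of gaps reachable with pairs of `X`. By `hc` a proportion
`c` of improving pairs survives the exclusion of `E'`. -/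
theorem card_not_isClosable_le {Z : Finset V} {K : ℕ} {B b c : ℝ} (hG : IsExpanding G Z K B)
    (hMG : ∀ e ∈ M, e ∈ G.edgeSet) (hV : Nonempty V) {ℓ T₀ : ℕ} {J : ℕ → ℕ}
    (h₀ : ∃ t ≤ T₀, IsReachable G M Z ℓ (fun τ => 2 * J τ) T₀ ∅ t)
    (hJ : ∀ τ ≤ T₀, (Fintype.card V : ℝ) < 1.01 ^ J τ * (max 1 τ : ℕ))
    (hb : (Z.card : ℝ) + (2 * T₀ + 1) * (K + 1) ^ 18 ≤ b) (hbB : b ≤ B / 6)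
    {A E' : Finset (Sym2 V)} (hA : ∀ e ∈ Gᶜ.edgeSet, e ∉ E' → e ∈ A) (hc0 : 0 ≤ c)
    (hc1 : c ≤ 1) (hc : c * A.card + E'.card ≤ (B / 6 - b) ^ 2 / 2) (m : ℕ) :
    (((A.powersetCard m).filter fun X =>
      ¬ IsClosable G M (ℓ + ∑ τ ∈ Finset.range (T₀ + 1), 2 * J τ) X).card : ℝ) ≤
      A.card.choose m * (1 - c / 2) ^ m * 2 ^ T₀ := by
  obtain ⟨t₀, ht₀, h₀⟩ := h₀
  have hex : ∀ X, ∃ t, IsReachable G M Z ℓ (fun τ => 2 * J τ) T₀ X t := fun X =>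
    ⟨t₀, h₀.mono (Finset.empty_subset X)⟩
  refine card_not_le (C := IsClosable G M (ℓ + ∑ τ ∈ Finset.range (T₀ + 1), 2 * J τ))
    (r := fun X => Nat.find (hex X)) (T₀ := T₀) hc1
    (fun X e h => h.mono (Finset.subset_insert _ _))
    (fun X e => Nat.find_min' _ ((Nat.find_spec (hex X)).mono (Finset.subset_insert _ _)))
    ((Nat.find_min' _ h₀).trans ht₀) ?_ m
  intro X _ hXc
  have hle : Nat.find (hex X) ≤ T₀ :=
    (Nat.find_min' _ (h₀.mono (Finset.empty_subset X))).trans ht₀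
  obtain ⟨E, hE, hE'⟩ := exists_many_improving hG hMG hV (Nat.find_spec (hex X))
    (fun t' ht' => Nat.find_min (hex X) ht') hXc le_rfl (hJ _ hle) hb hbB
  have hsub : E \ E' ⊆ (A \ X).filter fun e =>
      IsClosable G M (ℓ + ∑ τ ∈ Finset.range (T₀ + 1), 2 * J τ) (insert e X) ∨
        Nat.find (hex (insert e X)) < Nat.find (hex X) := by
    intro e he
    obtain ⟨he1, he2⟩ := Finset.mem_sdiff.1 he
    obtain ⟨h1, h2, h3⟩ := hE' e he1
    refine Finset.mem_filter.2 ⟨Finset.mem_sdiff.2 ⟨hA e (SimpleGraph.mem_edgeFinset.1 h1) he2, h2⟩, h3.imp_right ?_⟩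
    rintro ⟨t', h4, h5⟩
    exact (Nat.find_min' _ h5).trans_lt h4
  have h1 : E.card ≤ ((A \ X).filter fun e =>
      IsClosable G M (ℓ + ∑ τ ∈ Finset.range (T₀ + 1), 2 * J τ) (insert e X) ∨
        Nat.find (hex (insert e X)) < Nat.find (hex X)).card + E'.card := by
    have := Finset.card_le_card hsub
    have := Finset.le_card_sdiff E' E
    omega
  have h2 : (E.card : ℝ) ≤ _ := Nat.cast_le.2 h1
  push_cast at h2
  have h3 : c * ((A \ X).card : ℝ) ≤ c * A.card := by
    have := Finset.card_le_card (Finset.sdiff_subset (s := A) (t := X))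
    gcongr
  linarith

theorem measureReal_hasHamiltonCycleMeeting_ge {Z : Finset V} {K : ℕ} {B b c : ℝ}
    (hG : IsExpanding G Z K B) (hM : IsTwoMatching G M) {L₀ : List V} (hL₀ : IsOrdering L₀)
    {T₀ : ℕ} (hT₀ : listLoss M L₀ ≤ T₀) {J : ℕ → ℕ}
    (hJ : ∀ τ ≤ T₀, (Fintype.card V : ℝ) < 1.01 ^ J τ * (max 1 τ : ℕ))
    (hb : (Z.card : ℝ) + (2 * T₀ + 1) * (K + 1) ^ 18 ≤ b) (hbB : b ≤ B / 6)
    {A E' : Finset (Sym2 V)} (hA : ∀ e ∈ Gᶜ.edgeSet, e ∉ E' → e ∈ A)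
    (hA' : ∀ e ∈ A, ¬ e.IsDiag) (hc0 : 0 ≤ c)
    (hc1 : c ≤ 1) (hc : c * A.card + E'.card ≤ (B / 6 - b) ^ 2 / 2)
    (hV : 3 ≤ Fintype.card V) {x : ℝ}
    (hx : x + ((401 * T₀ + ∑ τ ∈ Finset.range (T₀ + 1), 2 * J τ : ℕ) : ℝ) + 1 ≤ Fintype.card V)
    {m : ℕ} {Ω : Type*} [MeasurableSpace Ω] {P : Measure Ω} [IsProbabilityMeasure P]
    {R : Ω → Finset (Sym2 V)} (hR : IsUniformSubset P R A m) :
    1 - (1 - c / 2) ^ m * 2 ^ T₀ ≤ P.real {ω | HasHamiltonCycleMeeting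
      (G ⊔ SimpleGraph.fromEdgeSet (R ω : Set (Sym2 V))) M x} := by
  have hV' : Nonempty V := Fintype.card_pos_iff.1 (by omega)
  have hc2 : 0 ≤ 1 - c / 2 := by linarith
  refine hR.measureReal_ge (C := fun X => HasHamiltonCycleMeeting
    (G ⊔ SimpleGraph.fromEdgeSet (X : Set (Sym2 V))) M x) (by positivity) ?_
  have key := card_not_isClosable_le hG hM.1 hV'
    (exists_isReachable hM.1 Z (fun τ => 2 * J τ) hL₀ hT₀) hJ hb hbB hA hc0 hc1 hc m
  rw [← mul_assoc]
  refine le_trans ?_ key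
  have : (A.powersetCard m).filter (fun X : Finset (Sym2 V) => ¬ HasHamiltonCycleMeeting
      (G ⊔ SimpleGraph.fromEdgeSet (X : Set (Sym2 V))) M x) ⊆
      (A.powersetCard m).filter fun X : Finset (Sym2 V) =>
      ¬ IsClosable G M (401 * T₀ + ∑ τ ∈ Finset.range (T₀ + 1), 2 * J τ) X := by
    intro X hX
    obtain ⟨h1, h2⟩ := Finset.mem_filter.1 hX
    exact Finset.mem_filter.2 ⟨h1, fun h => h2 (h.hasHamiltonCycleMeeting
      (fun e he => hA' e ((Finset.mem_powersetCard.1 h1).1 he)) hV hx)⟩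
  exact_mod_cast Finset.card_le_card this

end Combine

/-! ### The total number of rounds. -/

section Rounds

/-- A number of rounds after which sets that grow by one percent are too large. -/
noncomputable def rounds (n τ : ℕ) : ℕ :=
  ⌈(Real.log n - Real.log (max 1 τ : ℕ)) / Real.log 1.01⌉₊ + 1

theorem log_growth_pos : 0 < Real.log 1.01 := Real.log_pos (by norm_num)

theorem lt_pow_rounds {n : ℕ} (hn : 1 ≤ n) (τ : ℕ) :
    (n : ℝ) < 1.01 ^ rounds n τ * (max 1 τ : ℕ) := by
  have hτ : (0 : ℝ) < (max 1 τ : ℕ) := by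
    have : 0 < max 1 τ := by omega
    exact_mod_cast this
  have hn' : (0 : ℝ) < n := by exact_mod_cast hn
  rw [← Real.log_lt_log_iff hn' (by positivity), Real.log_mul (by positivity) hτ.ne',
    Real.log_pow]
  have h1 := Nat.le_ceil ((Real.log n - Real.log (max 1 τ : ℕ)) / Real.log 1.01)
  rw [div_le_iff₀ log_growth_pos] at h1
  have h2 : ((rounds n τ : ℕ) : ℝ) =
      ⌈(Real.log n - Real.log (max 1 τ : ℕ)) / Real.log 1.01⌉₊ + 1 := by
    unfold rounds; push_cast; ring
  rw [h2]
  nlinarith [log_growth_pos]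

/-- Induction with `T (log (T + 1) - log T) ≤ 1`. The order is `T log (n / T)` instead of `T log n`:
this is the profit from starting with one head per gap. -/
theorem sum_log_sub_log_le (n T : ℕ) :
    ∑ τ ∈ Finset.range (T + 1), (Real.log n - Real.log (max 1 τ : ℕ)) ≤
      Real.log n + T * (1 + (Real.log n - Real.log T)) := by
  induction T with
  | zero => simp
  | succ T ih =>
    rw [Finset.sum_range_succ]
    have h1 : (max 1 (T + 1) : ℕ) = T + 1 := by omega
    rw [h1]
    have h2 : (T : ℝ) * (Real.log (T + 1 : ℕ) - Real.log T) ≤ 1 := by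
      rcases Nat.eq_zero_or_pos T with rfl | hT
      · simp
      · have hT' : (0 : ℝ) < T := by exact_mod_cast hT
        rw [← Real.log_div (by positivity) hT'.ne']
        have h3 := Real.log_le_sub_one_of_pos (x := ((T + 1 : ℕ) : ℝ) / T) (by positivity)
        have h4 : (T : ℝ) * (((T + 1 : ℕ) : ℝ) / T - 1) = 1 := by
          push_cast; field_simp; ring
        calc _ ≤ (T : ℝ) * (((T + 1 : ℕ) : ℝ) / T - 1) := by gcongr
          _ = 1 := h4
    push_cast at *
    linarith

theorem sum_rounds_le {n T : ℕ} (hT : T ≤ n) (hn : 1 ≤ n) :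
    ((∑ τ ∈ Finset.range (T + 1), 2 * rounds n τ : ℕ) : ℝ) ≤
      2 / Real.log 1.01 * (Real.log n + T * (1 + (Real.log n - Real.log T))) + 4 * (T + 1) := by
  have h1 : ∀ τ ∈ Finset.range (T + 1), (2 * rounds n τ : ℝ) ≤
      2 / Real.log 1.01 * (Real.log n - Real.log (max 1 τ : ℕ)) + 4 := by
    intro τ hτ
    have hτ' : (max 1 τ : ℕ) ≤ n := by have := Finset.mem_range.1 hτ; omega
    have h0 : 0 ≤ (Real.log n - Real.log (max 1 τ : ℕ)) / Real.log 1.01 := by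
      refine div_nonneg (sub_nonneg.2 (Real.log_le_log ?_ (by exact_mod_cast hτ')))
        log_growth_pos.le
      have : 0 < max 1 τ := by omega
      exact_mod_cast this
    have h2 := (Nat.ceil_lt_add_one h0).le
    unfold rounds
    push_cast at h2 ⊢
    have h3 : 2 / Real.log 1.01 * (Real.log n - Real.log (max 1 (τ : ℝ))) =
      2 * ((Real.log n - Real.log (max 1 (τ : ℝ))) / Real.log 1.01) := by ring
    rw [h3]
    linarith
  push_cast
  refine (Finset.sum_le_sum h1).trans ?_
  rw [Finset.sum_add_distrib, ← Finset.mul_sum, Finset.sum_const, Finset.card_range, nsmul_eq_mul]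
  have h2 := sum_log_sub_log_le n T
  have h3 : (0 : ℝ) ≤ 2 / Real.log 1.01 := (div_pos two_pos log_growth_pos).le
  have := mul_le_mul_of_nonneg_left h2 h3
  push_cast at *
  linarith

end Rounds

/-! ### Asymptotic estimates. -/

section Asymptotic

theorem tendsto_log_natCast : Tendsto (fun n : ℕ => Real.log n) atTop atTop :=
  Real.tendsto_log_atTop.comp tendsto_natCast_atTop_atTop

theorem tendsto_loglog : Tendsto loglog atTop atTop :=
  Real.tendsto_log_atTop.comp tendsto_log_natCast

theorem eventually_log_pow_le (k : ℕ) : ∀ᶠ x : ℝ in atTop, Real.log x ^ k ≤ x := by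
  filter_upwards [(Real.isLittleO_pow_log_id_atTop (n := k)).bound one_pos, eventually_ge_atTop 0]
    with x hx hx0
  rw [one_mul, id, Real.norm_eq_abs, Real.norm_eq_abs, abs_of_nonneg hx0] at hx
  exact (le_abs_self _).trans hx

theorem eventually_loglog_pow_le : ∀ᶠ n : ℕ in atTop, loglog n ^ 6 ≤ Real.log n :=
  tendsto_log_natCast.eventually (eventually_log_pow_le 6)

theorem eventually_log_pow_three_le : ∀ᶠ n : ℕ in atTop, Real.log n ^ 3 ≤ n :=
  tendsto_natCast_atTop_atTop.eventually (eventually_log_pow_le 3)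

theorem eventually_log_loglog_le (C C' : ℝ) {δ : ℝ} (hδ : 0 < δ) :
    ∀ᶠ n : ℕ in atTop, C + C' * Real.log (loglog n) ≤ loglog n ^ δ := by
  have h1 : (fun x : ℝ => C + C' * Real.log x) =o[atTop] fun x => x ^ δ := by
    refine IsLittleO.add ?_ ((isLittleO_log_rpow_atTop hδ).const_mul_left C')
    exact isLittleO_const_left.2 (Or.inr (tendsto_norm_atTop_atTop.comp (tendsto_rpow_atTop hδ)))
  refine tendsto_loglog.eventually (p := fun x => C + C' * Real.log x ≤ x ^ δ) ?_
  filter_upwards [h1.bound one_pos, eventually_ge_atTop 0] with x hx hx0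
  rw [one_mul, Real.norm_eq_abs, Real.norm_eq_abs, abs_of_nonneg (Real.rpow_nonneg hx0 δ)] at hx
  exact (le_abs_self _).trans hx

/-- The bound for the number of gaps and used pairs. -/
noncomputable def maxGaps (a : ℝ) (n : ℕ) : ℕ := ⌊2 * ((n : ℝ) / loglog n ^ a)⌋₊

section Bounds
variable {n : ℕ} {a : ℝ}

theorem log_le_div_loglog (ha : a ≤ 6) (h1 : 1 ≤ loglog n) (h6 : loglog n ^ 6 ≤ Real.log n)
    (h3 : Real.log n ^ 3 ≤ n) : Real.log n ^ 2 ≤ n / loglog n ^ a := by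
  have hL : 1 ≤ Real.log n := (one_le_pow₀ h1).trans h6
  have h2 : loglog n ^ a ≤ Real.log n := by
    refine le_trans ?_ h6
    rw [← Real.rpow_natCast]
    exact Real.rpow_le_rpow_of_exponent_le h1 (by exact_mod_cast ha)
  rw [le_div_iff₀ (by positivity)]
  calc Real.log n ^ 2 * loglog n ^ a ≤ Real.log n ^ 2 * Real.log n := by gcongr
    _ = Real.log n ^ 3 := by ring
    _ ≤ n := h3

theorem maxGaps_le (h1 : 1 ≤ loglog n) : (maxGaps a n : ℝ) ≤ 2 * (n / loglog n ^ a) :=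
  Nat.floor_le (by positivity)

theorem le_maxGaps (hy : 1 ≤ n / loglog n ^ a) :
    n / loglog n ^ a ≤ maxGaps a n := by
  have := Nat.lt_floor_add_one (2 * ((n : ℝ) / loglog n ^ a))
  unfold maxGaps
  linarith

theorem div_loglog_le {b : ℝ} (hab : b ≤ a) (h1 : 1 ≤ loglog n) :
    n / loglog n ^ a ≤ n / loglog n ^ b := by
  gcongr

/-- The total penalty is small. -/
theorem sum_rounds_maxGaps_le {δ : ℝ} (ha1 : 1 ≤ a) (ha : a ≤ 6) (h1 : 2 ≤ loglog n)
    (h6 : loglog n ^ 6 ≤ Real.log n) (h3 : Real.log n ^ 3 ≤ n)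
    (hδ : (815 + 6 / Real.log 1.01) + 24 / Real.log 1.01 * Real.log (loglog n) ≤ loglog n ^ δ) :
    ((401 * maxGaps a n + ∑ τ ∈ Finset.range (maxGaps a n + 1), 2 * rounds n τ : ℕ) : ℝ) + 1 ≤
      n / loglog n ^ (a - δ) := by
  have h1' : 1 ≤ loglog n := by linarith
  have hL : 1 ≤ Real.log n := (one_le_pow₀ h1').trans h6
  have hL2 : 2 ^ 6 ≤ Real.log n := le_trans (by gcongr) h6
  have hn : 1 ≤ n := by
    by_contra h
    have : n = 0 := by omega
    subst this
    simp at hL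
    linarith
  have hn0 : (0 : ℝ) < n := by exact_mod_cast hn
  set y := (n : ℝ) / loglog n ^ a with hy
  have hylog := log_le_div_loglog ha h1' h6 h3
  rw [← hy] at hylog
  have hy2 : Real.log n ≤ y := by nlinarith
  have hT1 := maxGaps_le (a := a) h1'
  have hT2 := le_maxGaps (a := a) (by rw [← hy]; linarith)
  rw [← hy] at hT1 hT2
  have hTn : maxGaps a n ≤ n := by
    have h4 : (n : ℝ) / loglog n ^ a ≤ n / 2 := by
      refine div_le_div_of_nonneg_left hn0.le two_pos (h1.trans ?_)
      calc loglog n = loglog n ^ (1 : ℝ) := (Real.rpow_one _).symm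
        _ ≤ _ := Real.rpow_le_rpow_of_exponent_le h1' ha1
    have : (maxGaps a n : ℝ) ≤ n := by linarith
    exact_mod_cast this
  have hS := sum_rounds_le hTn hn
  have hy0 : 0 < y := by linarith
  -- The quotient of `n` by the number of gaps is at most a power of `loglog n`, so its logarithm
  -- has only the order of `log (loglog n)`.
  have hlogT : Real.log n - Real.log (maxGaps a n) ≤ 6 * Real.log (loglog n) := by
    have h4 : Real.log y ≤ Real.log (maxGaps a n) := Real.log_le_log hy0 hT2
    rw [hy, Real.log_div hn0.ne' (by positivity), Real.log_rpow (by linarith)] at h4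
    have := mul_le_mul_of_nonneg_right ha (Real.log_nonneg h1')
    linarith
  have hlogL := Real.log_nonneg h1'
  have hq : 0 < 2 / Real.log 1.01 := div_pos two_pos log_growth_pos
  have h5 : Real.log n + maxGaps a n * (1 + (Real.log n - Real.log (maxGaps a n))) ≤
      y * (3 + 12 * Real.log (loglog n)) := by
    have : (maxGaps a n : ℝ) * (1 + (Real.log n - Real.log (maxGaps a n))) ≤
        2 * y * (1 + 6 * Real.log (loglog n)) := by
      have hTpos : (0 : ℝ) < maxGaps a n := hy0.trans_le hT2
      have := Real.log_le_log hTpos (show (maxGaps a n : ℝ) ≤ n by exact_mod_cast hTn)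
      gcongr
    linarith
  have h7 := mul_le_mul_of_nonneg_left h5 hq.le
  have h8 : y * loglog n ^ δ = n / loglog n ^ (a - δ) := by
    rw [hy, Real.rpow_sub (by linarith)]
    have : loglog n ^ δ ≠ 0 := (Real.rpow_pos_of_pos (by linarith) δ).ne'
    field_simp
  rw [← h8]
  -- The constant 815 covers `401 * 2y`, the rounding term `4 * (2y + 1)` and the final 1, as `1 ≤
  -- y`.
  have h9 := mul_le_mul_of_nonneg_left hδ hy0.le
  have h10 : y * (815 + 6 / Real.log 1.01 + 24 / Real.log 1.01 * Real.log (loglog n)) =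
    815 * y + 2 / Real.log 1.01 * (y * (3 + 12 * Real.log (loglog n))) := by ring
  rw [h10] at h9
  push_cast at hS ⊢
  linarith

end Bounds

/-- The bound for the probability of failure. -/
noncomputable def failBound (c a : ℝ) (n : ℕ) : ℝ :=
  Real.exp (-(c / 2) * (n / loglog n - 1)) * 2 ^ maxGaps a n

theorem pow_mul_two_pow_le_failBound {c a : ℝ} {n m : ℕ} (hc0 : 0 ≤ c) (hc1 : c ≤ 1)
    (hm : |(m : ℝ) - n / loglog n| ≤ 1) :
    (1 - c / 2) ^ m * 2 ^ maxGaps a n ≤ failBound c a n := by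
  unfold failBound
  gcongr
  calc (1 - c / 2) ^ m ≤ Real.exp (-(c / 2)) ^ m := by
        gcongr
        · linarith
        · exact Real.one_sub_le_exp_neg _
    _ = Real.exp (-(c / 2) * m) := by rw [← Real.exp_nat_mul]; ring_nf
    _ ≤ _ := by
        rw [Real.exp_le_exp]
        have := (abs_le.1 hm).1
        nlinarith

/-- The exponent `c n / (2 loglog n)` dominates both `maxGaps a n` and `2 log n`, so the bound is
even of order `n⁻²`. The thresholds `16 / c` make `n / loglog n ^ a` and `log n` at most `c / 16`
times `n / loglog n`. -/
theorem failBound_isLittleO {c a : ℝ} (hc : 0 < c) (ha : 2 ≤ a) :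
    failBound c a =o[atTop] fun n : ℕ => (1 : ℝ) / n := by
  have h1 : failBound c a =O[atTop] fun n : ℕ => (1 : ℝ) / n * (n : ℝ)⁻¹ := by
    refine IsBigO.of_bound (Real.exp (c / 2)) ?_
    filter_upwards [eventually_loglog_pow_le, eventually_log_pow_three_le,
      tendsto_loglog.eventually_ge_atTop (max 1 (16 / c)),
      tendsto_log_natCast.eventually_ge_atTop (16 / c), eventually_ge_atTop 1] with n h6 h3 hL hl hn
    have hL1 : 1 ≤ loglog n := (le_max_left _ _).trans hL
    have hL2 : 16 / c ≤ loglog n := (le_max_right _ _).trans hL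
    have hn0 : (0 : ℝ) < n := by exact_mod_cast hn
    have hpos : 0 ≤ failBound c a n := by unfold failBound; positivity
    rw [Real.norm_of_nonneg hpos, Real.norm_of_nonneg (by positivity)]
    have e1 : (1 : ℝ) / n * (n : ℝ)⁻¹ = Real.exp (-(2 * Real.log n)) := by
      rw [Real.exp_neg, two_mul, Real.exp_add, Real.exp_log hn0]
      field_simp
    have e2 : (2 : ℝ) ^ maxGaps a n ≤ Real.exp (2 * (n / loglog n ^ a)) := by
      calc (2 : ℝ) ^ maxGaps a n ≤ Real.exp 1 ^ maxGaps a n := by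
            gcongr
            have := Real.add_one_le_exp (1 : ℝ)
            linarith
        _ = Real.exp (maxGaps a n) := by rw [← Real.exp_nat_mul, mul_one]
        _ ≤ _ := Real.exp_le_exp.2 (maxGaps_le hL1)
    rw [e1, ← Real.exp_add]
    unfold failBound
    refine (mul_le_mul_of_nonneg_left e2 (Real.exp_pos _).le).trans ?_
    rw [← Real.exp_add, Real.exp_le_exp]
    have e3 : c * (n / loglog n ^ a) ≤ c / 16 * c * (n / loglog n) := by
      have e4 : (n : ℝ) / loglog n ^ a ≤ n / loglog n ^ (2 : ℝ) := div_loglog_le ha hL1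
      have e5 : (n : ℝ) / loglog n ^ (2 : ℝ) ≤ c / 16 * (n / loglog n) := by
        rw [Real.rpow_two, div_le_iff₀ (by positivity)]
        have : (1 : ℝ) ≤ c / 16 * loglog n := by
          rw [div_le_iff₀ hc] at hL2; linarith
        calc (n : ℝ) = n * 1 := (mul_one _).symm
          _ ≤ n * (c / 16 * loglog n) := by gcongr
          _ = _ := by field_simp
      calc _ ≤ c * (c / 16 * (n / loglog n)) := by gcongr; exact e4.trans e5
        _ = _ := by ring
    have e3' : (n : ℝ) / loglog n ^ a ≤ c / 16 * (n / loglog n) := by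
      refine le_of_mul_le_mul_left ?_ hc
      linarith
    have e6 : Real.log n ≤ c / 16 * (n / loglog n) := by
      have hlog : loglog n ≤ Real.log n := by
        refine le_trans ?_ h6
        exact le_self_pow₀ hL1 (by norm_num)
      have hlog1 : 1 ≤ Real.log n := hL1.trans hlog
      have e7 : Real.log n ^ 2 ≤ n / loglog n := by
        rw [le_div_iff₀ (by linarith)]
        calc _ ≤ Real.log n ^ 2 * Real.log n := by gcongr
          _ = Real.log n ^ 3 := by ring
          _ ≤ n := h3
      have e8 : (1 : ℝ) ≤ c / 16 * Real.log n := by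
        rw [div_le_iff₀ hc] at hl; linarith
      calc Real.log n = Real.log n * 1 := (mul_one _).symm
        _ ≤ Real.log n * (c / 16 * Real.log n) := by gcongr
        _ = c / 16 * Real.log n ^ 2 := by ring
        _ ≤ _ := by gcongr
    have e9 : 0 ≤ c * (n / loglog n) := by positivity
    linarith
  refine h1.trans_isLittleO ?_
  have h2 : (fun n : ℕ => (n : ℝ)⁻¹) =o[atTop] fun _ : ℕ => (1 : ℝ) :=
    (isLittleO_one_iff ℝ).2 tendsto_inv_atTop_nhds_zero_nat
  simpa using (isBigO_refl (fun n : ℕ => (1 : ℝ) / n) atTop).mul_isLittleO h2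

end Asymptotic

/-! ### Verifying the conditions and choosing the constants. -/

section Main
variable {β γ ε : ℝ} {n : ℕ} {G : SimpleGraph (Fin n)} {M : Finset (Sym2 (Fin n))}

theorem Admissible.exists_isExpanding (h : Admissible β γ ε G M) (hβ : β ∈ Set.Ioo (0 : ℝ) 1)
    {K : ℕ} (hK : 8 ≤ β * K) (hK' : 21312 ≤ K)
    (hn : (K : ℝ) < 4 * γ * n) :
    ∃ Z, IsExpanding G Z K (γ * n) ∧ (Z.card : ℝ) ≤ 90 + γ * n / 48 := by
  have hK0 : (21312 : ℝ) ≤ K := by exact_mod_cast hK'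
  have hsp : ∀ T : Finset (Fin n), (T.card : ℝ) < γ * n →
      10 * spannedEdges G T ≤ 11 * T.card + 9 := by
    intro T hT
    have h1 := h.sparse T hT
    have h2 : (10 * spannedEdges G T : ℝ) < 11 * T.card + 10 := by linarith
    have h3 : 10 * spannedEdges G T < 11 * T.card + 10 := by exact_mod_cast h2
    omega
  have hγn : 0 < γ * n := by linarith
  have hβ1 : 0 < 1 - β := by linarith [hβ.2]
  have hD := card_large_degree_le (G := G) (K := K) (b := β * γ * n) (I := 2 * (1 - β) * γ * n)
    h.few_incident
    (by have := mul_pos hβ1 hγn; linarith)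
    (by
      have h1 := mul_le_mul_of_nonneg_right hK hγn.le
      have h2 := mul_pos hβ.1 hγn
      linarith)
  have h2 := mul_pos hβ.1 hγn
  -- As `21312 = 4 * 111 * 48`, the factor 111 from `exists_isCore` leaves a core of size at most
  -- `90 + γ * n / 48`.
  have hD' : ((Finset.univ.filter fun v => K < G.degree v).card : ℝ) * 21312 ≤ 4 * (γ * n) := by
    refine le_trans (mul_le_mul_of_nonneg_left hK0 (Nat.cast_nonneg _)) (hD.trans ?_)
    linarith
  obtain ⟨Z, hZ, hZc⟩ := exists_isCore (K := K) hsp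
    (D := Finset.univ.filter fun v => K < G.degree v) (fun v hv => by simpa using hv)
    (by linarith)
  have hZc' : (Z.card : ℝ) ≤ 90 + 111 * (Finset.univ.filter fun v => K < G.degree v).card := by
    exact_mod_cast hZc
  have hZ' : (Z.card : ℝ) ≤ 90 + γ * n / 48 := by linarith
  exact ⟨Z, ⟨h.minDegree, hsp, hZ, by linarith⟩, hZ'⟩

/-- The loss is at most `(n - M.card) + r`, and each of the two summands is at most `n / loglog n ^
(6 - ε)`; hence the factor 2 in `maxGaps`. -/
theorem Admissible.exists_ordering (h : Admissible β γ ε G M) (hε : ε ∈ Set.Ioo (0 : ℝ) 1)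
    (h1 : 1 ≤ loglog n) :
    ∃ L, IsOrdering L ∧ listLoss M L ≤ maxGaps (6 - ε) n := by
  obtain ⟨L, r, hL, hr, hle⟩ := exists_ordering_loss_le h.twoMatching
  refine ⟨L, hL, Nat.le_floor ?_⟩
  have hr' : (r : ℝ) < n / loglog n ^ 6 := not_le.1 fun h' => h.few_disjoint_cycles r h' hr
  have h2 : (n : ℝ) / loglog n ^ 6 ≤ n / loglog n ^ (6 - ε) := by
    have := div_loglog_le (n := n) (a := (6 : ℕ)) (b := 6 - ε)
      (by push_cast; linarith [hε.1]) h1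
    rwa [Real.rpow_natCast] at this
  have h3 : (M.card : ℝ) + listLoss M L ≤ n + r := by
    rw [Fintype.card_fin] at hle
    exact_mod_cast hle
  have h4 := h.card_twoMatching
  linarith

end Main

theorem mainTheorem4 (k : ℕ) (hk : 1 ≤ k) (β γ ε : ℝ)
    (hβ : β ∈ Set.Ioo (0 : ℝ) 1) (hγ : γ ∈ Set.Ioo (0 : ℝ) 1) (hε : ε ∈ Set.Ioo (0 : ℝ) 1)
    (g : ℕ → ℝ) (hg : g =o[atTop] (fun n : ℕ => (n : ℝ) ^ 2)) :
    ∃ f : ℕ → ℝ, f =o[atTop] (fun n : ℕ => (1 : ℝ) / (n : ℝ)) ∧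
      ∀ (n : ℕ) (G : SimpleGraph (Fin n)) (M E' : Finset (Sym2 (Fin n))) (m : ℕ),
        Admissible β γ ε G M →
        E' ⊆ Gᶜ.edgeFinset →
        (E'.card : ℝ) ≤ g n →
        |(m : ℝ) - n / loglog n| ≤ 1 →
        ∀ (Ω : Type*) [MeasurableSpace Ω] (P : Measure Ω) [IsProbabilityMeasure P]
          (R : Ω → Finset (Sym2 (Fin n))),
          IsUniformSubset P R (Gᶜ.edgeFinset \ E') m →
          1 - f n ≤ P.real {ω | HasHamiltonCycleMeeting
            (G ⊔ SimpleGraph.fromEdgeSet (R ω : Set (Sym2 (Fin n)))) M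
            ((n : ℝ) - n / loglog n ^ (6 - ε - 1 / (10 * (k : ℝ))))} := by
  obtain ⟨K, hK, hK'⟩ : ∃ K : ℕ, 8 ≤ β * K ∧ 21312 ≤ K := by
    refine ⟨max ⌈8 / β⌉₊ 21312, ?_, le_max_right _ _⟩
    have h1 := Nat.le_ceil (8 / β)
    have h2 : (⌈8 / β⌉₊ : ℝ) ≤ (max ⌈8 / β⌉₊ 21312 : ℕ) := by exact_mod_cast le_max_left _ _
    rw [mul_comm, ← div_le_iff₀ hβ.1]
    linarith
  have hδ : 0 < 1 / (10 * (k : ℝ)) := by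
    have : (0 : ℝ) < k := by exact_mod_cast hk
    positivity
  have hγ0 := hγ.1
  set C : ℝ := (K + 1) ^ 18 with hC
  have hC0 : 0 < C := by positivity
  -- With `b = γ n / 12` and `B = γ n` there are at least `(γ n / 12) ^ 2 / 2 = 2 c n ^ 2` good
  -- pairs; one half of them is reserved for the excluded set `E'`.
  set c : ℝ := γ ^ 2 / 576 with hc
  have hc0 : 0 < c := by positivity
  have hc1 : c ≤ 1 := by
    have : γ ^ 2 ≤ 1 := pow_le_one₀ hγ0.le hγ.2.le
    linarith
  have hev : ∀ᶠ n : ℕ in atTop, loglog n ^ 6 ≤ Real.log n ∧ Real.log n ^ 3 ≤ n ∧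
      max 2 (128 * C / γ) ≤ loglog n ∧ max (max (K : ℝ) 360) (32 * (C + 90)) / γ ≤ (n : ℝ) ∧
      (815 + 6 / Real.log 1.01) + 24 / Real.log 1.01 * Real.log (loglog n) ≤
        loglog n ^ (1 / (10 * (k : ℝ))) ∧ g n ≤ c * n ^ 2 := by
    filter_upwards [eventually_loglog_pow_le, eventually_log_pow_three_le,
      tendsto_loglog.eventually_ge_atTop _, (tendsto_natCast_atTop_atTop (R := ℝ)).eventually_ge_atTop _,
      eventually_log_loglog_le _ _ hδ, hg.bound hc0] with n h1 h2 h3 h4 h5 h6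
    refine ⟨h1, h2, h3, h4, h5, (le_abs_self _).trans ?_⟩
    rw [Real.norm_eq_abs, Real.norm_of_nonneg (by positivity)] at h6
    exact h6
  obtain ⟨N, hN⟩ := eventually_atTop.1 hev
  -- The value 1 for small `n` makes the claim empty there.
  refine ⟨fun n => if N ≤ n then failBound c (6 - ε) n else 1, ?_, ?_⟩
  · refine (failBound_isLittleO hc0 (a := 6 - ε) (by linarith [hε.2])).congr' ?_ EventuallyEq.rfl
    filter_upwards [eventually_ge_atTop N] with n hn
    rw [if_pos hn]
  intro n G M E' m hA hE' hE'g hm Ω _ P _ R hR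
  dsimp only
  split_ifs with hn
  swap
  · rw [sub_self]; exact measureReal_nonneg
  obtain ⟨h6, h3, hL, hn1, hδ', hgn⟩ := hN n hn
  have hL2 : 2 ≤ loglog n := (le_max_left _ _).trans hL
  have hLC : 128 * C ≤ loglog n * γ := by
    rw [← div_le_iff₀ hγ0]; exact (le_max_right _ _).trans hL
  rw [div_le_iff₀ hγ0, mul_comm (n : ℝ)] at hn1
  have hnK : (K : ℝ) ≤ γ * n := ((le_max_left _ _).trans (le_max_left _ _)).trans hn1
  have hn360 : 360 ≤ γ * n := ((le_max_right _ _).trans (le_max_left _ _)).trans hn1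
  have hnC : 32 * (C + 90) ≤ γ * n := (le_max_right _ _).trans hn1
  obtain ⟨Z, hZ, hZc⟩ := hA.exists_isExpanding hβ hK hK' (by linarith)
  obtain ⟨L₀, hL₀, hloss⟩ := hA.exists_ordering hε (by linarith)
  have hn0 : (360 : ℝ) ≤ n := by nlinarith [hγ.2, (Nat.cast_nonneg n : (0 : ℝ) ≤ n)]
  have hn0' : 360 ≤ n := by exact_mod_cast hn0
  -- The core contributes `γ n / 48`, the ends of used pairs `γ n / 32`, and the constants `C + 90`
  -- another `γ n / 32`. These add up to `γ n / 12`, half of `B / 6`.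
  have hb : (Z.card : ℝ) + (2 * maxGaps (6 - ε) n + 1) * (K + 1) ^ 18 ≤ γ * n / 12 := by
    rw [← hC]
    have h1 := maxGaps_le (a := 6 - ε) (n := n) (by linarith)
    have h2 : (n : ℝ) / loglog n ^ (6 - ε) ≤ n / loglog n ^ (1 : ℝ) :=
      div_loglog_le (by linarith [hε.2]) (by linarith)
    rw [Real.rpow_one] at h2
    have h4 : C * (n / loglog n) ≤ γ * n / 128 := by
      rw [mul_div_assoc', div_le_div_iff₀ (by linarith) (by norm_num)]
      nlinarith
    have h5 : (2 * maxGaps (6 - ε) n + 1) * C ≤ 4 * (C * (n / loglog n)) + C := by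
      have : C * maxGaps (6 - ε) n ≤ C * (2 * (n / loglog n)) := by gcongr; linarith
      linarith
    linarith
  have hAc : (((Gᶜ.edgeFinset \ E').card : ℕ) : ℝ) ≤ n ^ 2 := by
    have h1 := Gᶜ.card_edgeFinset_le_card_choose_two
    have h2 := Finset.card_le_card (Finset.sdiff_subset (s := Gᶜ.edgeFinset) (t := E'))
    have h4 := Nat.choose_le_pow n 2
    rw [Fintype.card_fin] at h1
    exact_mod_cast h2.trans (h1.trans h4)
  have key := measureReal_hasHamiltonCycleMeeting_ge (c := c) (J := rounds n)
    (x := (n : ℝ) - n / loglog n ^ (6 - ε - 1 / (10 * (k : ℝ)))) hZ hA.twoMatching hL₀ hloss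
    (fun τ _ => by rw [Fintype.card_fin]; exact lt_pow_rounds (by omega) τ) hb (by linarith)
    (A := Gᶜ.edgeFinset \ E') (E' := E')
    (fun e he he' => by
      simp only [Finset.mem_sdiff, SimpleGraph.mem_edgeFinset]
      exact ⟨he, he'⟩)
    (fun e he => by
      simp only [Finset.mem_sdiff, SimpleGraph.mem_edgeFinset] at he
      exact Gᶜ.not_isDiag_of_mem_edgeSet he.1)
    hc0.le hc1
    (by
      have h1 := mul_le_mul_of_nonneg_left hAc hc0.le
      have h2 : (γ * n / 6 - γ * n / 12) ^ 2 / 2 = 2 * (c * n ^ 2) := by rw [hc]; ring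
      rw [h2]
      linarith)
    (by rw [Fintype.card_fin]; omega)
    (by
      rw [Fintype.card_fin]
      have := sum_rounds_maxGaps_le (a := 6 - ε) (by linarith [hε.2]) (by linarith [hε.1]) hL2 h6
        h3 hδ'
      linarith)
    hR
  refine le_trans (sub_le_sub_left ?_ 1) key
  exact pow_mul_two_pow_le_failBound hc0.le hc1 hm
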